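/- Let $a,b>0$, $2<p<5$, $\delta\in(0,1)$, $\lambda\in[\delta,1]$ and $c>0$. Let $V:\mathbb R^3\to\mathbb R$ satisfy * $(V_2)$: $V_\infty:=\liminf_{|y|\to\infty}V(y)$ is a real number, $V(x)\le V_\infty$ for almost every $x\in\mathbb R^3$, and the inequality is strict on a set of positive Lebesgue measure; * $(V_3)$: $\int_{\mathbb R^3} V|u|^2$ is finite for every $u\in H^1(\mathbb R^3)$, and $\displaystyle\inf_{u\in H^1(\mathbb R^3)\setminus\{0\}}\frac{\int_{\mathbb R^3}|Du|^2+V(x)|u|^2}{\int_{\mathbb R^3}|u|^2}>0$; * the quadratic form $u\mapsto\int_{\mathbb R^3} a|Du|^2+V(x)|u|^2$ is bounded below on $H^1(\mathbb R^3)$ relative to $L^2$: for some $M\in\mathbb R$, $\int_{\mathbb R^3} a|Du|^2+V|u|^2\ge -M\int_{\mathbb R^3}|u|^2$ for all $u\in H^1(\mathbb R^3)$. (This holds if the form is the square of a norm; given $(V_2)$ and $(V_3)$ it is automatic if $V$ is continuous or if $a\ge1$.) For $u\in H^1(\mathbb R^3)$ and $A\in\mathbb R$ put $$I_{V,\lambda}(u)=\frac12\int_{\mathbb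 R^3}\left(a|Du|^2+V(x)|u|^2\right)+\frac b4\left(\int_{\mathbb R^3}|Du|^2\right)^2-\frac{\lambda}{p+1}\int_{\mathbb R^3}|u|^{p+1},$$ $$J_{V,\lambda}(u)=\frac{a+bA^2}{2}\int_{\mathbb R^3}|Du|^2+\frac12\int_{\mathbb R^3}V(x)|u|^2-\frac{\lambda}{p+1}\int_{\mathbb R^3}|u|^{p+1},$$ and let $J^\infty_\lambda$ be $J_{V,\lambda}$ with $V$ replaced by the constant $V_\infty$. Let $\{u_n\}\subset H^1(\mathbb R^3)$ be a bounded sequence with $I_{V,\lambda}(u_n)\to c$ and $I_{V,\lambda}'(u_n)\to0$ in the dual of $H^1(\mathbb R^3)$. Then, after passing to a subsequence (still denoted $\{u_n\}$), there are $u\in H^1(\mathbb R^3)$ and $A\in\mathbb R$ such that $u_n\rightharpoonup u$ weakly in $H^1(\mathbb R^3)$, $\int_{\mathbb R^3}|Du_n|^2\to A^2$, $J_{V,\lambda}'(u)=0$, and either (i) $u_n\to u$ in $H^1(\mathbb R^3)$, or (ii) there are an integer $l\ge1$, sequences $\{y_n^k\}_n\subset\mathbb R^3$ with $|y_n^k|\to\infty$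 as $n\to\infty$ for each $1\le k\le l$, and nontrivial weak solutions $w^1,\dots,w^l\in H^1(\mathbb R^3)$ of $$-(a+bA^2)\Delta w+V_\infty w=\lambda|w|^{p-1}w\quad\text{in }\mathbb R^3,$$ such that $$c+\frac{bA^4}{4}=J_{V,\lambda}(u)+\sum_{k=1}^lJ^\infty_\lambda(w^k),\qquad \Big\|u_n-u-\sum_{k=1}^lw^k(\cdot-y_n^k)\Big\|_{H^1(\mathbb R^3)}\to0,\qquad A^2=|Du|_2^2+\sum_{k=1}^l|Dw^k|_2^2 .$$ -/

import Mathlib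

open MeasureTheory Filter Topology
open scoped ContDiff ENNReal

noncomputable section

namespace Kirchhoff

/-- Euclidean three-space. -/
abbrev R3 : Type := EuclideanSpace ℝ (Fin 3)

/-- The Hilbert space `L²(ℝ³; ℝ) × L²(ℝ³; ℝ³)` in which `H¹(ℝ³)` is realised as the space of pairs
`(u, Du)`; its norm is `‖(f, g)‖² = |f|₂² + |g|₂²`. -/
abbrev L2Pair : Type :=
  WithLp 2 (Lp ℝ 2 (volume : Measure R3) × Lp R3 2 (volume : Measure R3))

/-- `g` is the weak (distributional) gradient of `f`: for every test function `φ ∈ C_c^∞(ℝ³)` and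
every direction `v`, `∫ f ∂ᵥφ = - ∫ (g, v) φ`. -/
def IsWeakGradient (f : R3 → ℝ) (g : R3 → R3) : Prop :=
  ∀ φ : R3 → ℝ, ContDiff ℝ ∞ φ → HasCompactSupport φ → ∀ v : R3,
    ∫ x, f x * fderiv ℝ φ x v = - ∫ x, inner ℝ (g x) v * φ x

theorem memLp_fderiv_apply {φ : R3 → ℝ} (hφ : ContDiff ℝ ∞ φ) (hc : HasCompactSupport φ) (v : R3) :
    MemLp (fun x => fderiv ℝ φ x v) 2 volume :=
  ((hφ.continuous_fderiv (by simp)).clm_apply continuous_const).memLp_of_hasCompactSupport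
    (hc.fderiv_apply ℝ v)

theorem integrable_mul_fderiv {φ : R3 → ℝ} (hφ : ContDiff ℝ ∞ φ) (hc : HasCompactSupport φ)
    (v : R3) (f : Lp ℝ 2 (volume : Measure R3)) :
    Integrable (fun x => f x * fderiv ℝ φ x v) :=
  MemLp.integrable_mul (p := 2) (q := 2) (Lp.memLp f) (memLp_fderiv_apply hφ hc v)

theorem integrable_inner_mul {φ : R3 → ℝ} (hφ : ContDiff ℝ ∞ φ) (hc : HasCompactSupport φ)
    (v : R3) (g : Lp R3 2 (volume : Measure R3)) :
    Integrable (fun x => inner ℝ (g x) v * φ x) :=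
  MemLp.integrable_mul (p := 2) (q := 2) ((Lp.memLp g).inner_const v) (hφ.continuous.memLp_of_hasCompactSupport hc)

/-- The linear subspace of all pairs `(u, Du)` with `u ∈ L²` whose weak gradient `Du` is in `L²`. -/
def h1Submodule : Submodule ℝ L2Pair where
  carrier := {z | IsWeakGradient z.fst z.snd}
  zero_mem' := by
    intro φ hφ hc v
    simp
  add_mem' := by
    intro z w hz hw φ hφ hc v
    have h1 : ∀ᵐ x : R3, ((z + w).fst : R3 → ℝ) x = z.fst x + w.fst x := Lp.coeFn_add z.fst w.fst
    have h2 : ∀ᵐ x : R3, ((z + w).snd : R3 → R3) x = z.snd x + w.snd x := Lp.coeFn_add z.snd w.snd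
    have e1 : ∫ x, (z + w).fst x * fderiv ℝ φ x v
        = ∫ x, (z.fst x * fderiv ℝ φ x v + w.fst x * fderiv ℝ φ x v) := by
      apply integral_congr_ae
      filter_upwards [h1] with x hx
      rw [hx]; ring
    have e2 : ∫ x, inner ℝ ((z + w).snd x) v * φ x
        = ∫ x, (inner ℝ (z.snd x) v * φ x + inner ℝ (w.snd x) v * φ x) := by
      apply integral_congr_ae
      filter_upwards [h2] with x hx
      rw [hx, inner_add_left]; ring
    rw [e1, e2, integral_add (integrable_mul_fderiv hφ hc v _) (integrable_mul_fderiv hφ hc v _),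
      integral_add (integrable_inner_mul hφ hc v _) (integrable_inner_mul hφ hc v _),
      hz φ hφ hc v, hw φ hφ hc v]
    ring
  smul_mem' := by
    intro r z hz φ hφ hc v
    have h1 : ∀ᵐ x : R3, ((r • z).fst : R3 → ℝ) x = r * z.fst x := Lp.coeFn_smul r z.fst
    have h2 : ∀ᵐ x : R3, ((r • z).snd : R3 → R3) x = r • z.snd x := Lp.coeFn_smul r z.snd
    have e1 : ∫ x, (r • z).fst x * fderiv ℝ φ x v = ∫ x, r * (z.fst x * fderiv ℝ φ x v) := by
      apply integral_congr_ae
      filter_upwards [h1] with x hx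
      rw [hx]; ring
    have e2 : ∫ x, inner ℝ ((r • z).snd x) v * φ x = ∫ x, r * (inner ℝ (z.snd x) v * φ x) := by
      apply integral_congr_ae
      filter_upwards [h2] with x hx
      rw [hx, real_inner_smul_left]; ring
    rw [e1, e2, integral_const_mul, integral_const_mul, hz φ hφ hc v]
    ring

/-- The Sobolev space `H¹(ℝ³)` with its usual norm, `‖u‖² = |u|₂² + |Du|₂²`. -/
abbrev H1 : Type := h1Submodule

/-- The function underlying an element of `H¹(ℝ³)`. -/
def H1.fn (u : H1) : R3 → ℝ := u.1.fst

/-- The weak gradient `Du` of an element of `H¹(ℝ³)`. -/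
def H1.grad (u : H1) : R3 → R3 := u.1.snd

theorem mp_sub (y : R3) : MeasurePreserving (fun x : R3 => x - y) volume volume :=
  measurePreserving_sub_right volume y

/-- The translate `w(· - y)` of `w ∈ H¹(ℝ³)`. -/
def H1.translate (w : H1) (y : R3) : H1 :=
  ⟨WithLp.toLp 2 (Lp.compMeasurePreserving (fun x : R3 => x - y) (mp_sub y) w.1.fst,
      Lp.compMeasurePreserving (fun x : R3 => x - y) (mp_sub y) w.1.snd), by
    intro φ hφ hc v
    have h1 : ∀ᵐ x : R3,
        Lp.compMeasurePreserving (fun x : R3 => x - y) (mp_sub y) w.1.fst x = w.1.fst (x - y) :=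
      Lp.coeFn_compMeasurePreserving w.1.fst (mp_sub y)
    have h2 : ∀ᵐ x : R3,
        Lp.compMeasurePreserving (fun x : R3 => x - y) (mp_sub y) w.1.snd x = w.1.snd (x - y) :=
      Lp.coeFn_compMeasurePreserving w.1.snd (mp_sub y)
    have hψ : ContDiff ℝ ∞ (fun x : R3 => φ (x + y)) := hφ.comp (contDiff_id.add contDiff_const)
    have hψc : HasCompactSupport (fun x : R3 => φ (x + y)) :=
      hc.comp_homeomorph (Homeomorph.addRight y)
    have key := w.2 _ hψ hψc v
    rw [← integral_sub_right_eq_self (fun x => w.1.fst x * fderiv ℝ (fun x => φ (x + y)) x v) y,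
      ← integral_sub_right_eq_self (fun x => inner ℝ (w.1.snd x) v * φ (x + y)) y] at key
    simp only [fderiv_comp_add_right, sub_add_cancel] at key
    have e1 := integral_congr_ae (μ := (volume : Measure R3))
      (h1.mono fun x hx => congrArg (fun t => t * fderiv ℝ φ x v) hx)
    have e2 := integral_congr_ae (μ := (volume : Measure R3))
      (h2.mono fun x hx => congrArg (fun t => inner ℝ t v * φ x) hx)
    exact e1.trans (key.trans (congrArg Neg.neg e2.symm))⟩

/-- `∫ |Du|²`. -/
def gradSq (u : H1) : ℝ := ∫ x, ‖u.grad x‖ ^ 2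

/-- `∫ W |u|²`. -/
def potSq (W : R3 → ℝ) (u : H1) : ℝ := ∫ x, W x * |u.fn x| ^ 2

/-- `∫ |u|^q`. -/
def powInt (q : ℝ) (u : H1) : ℝ := ∫ x, |u.fn x| ^ q

/-- The potential condition `(V₂)`, with `Vinf` the real number `V_∞ = liminf_{|y| → ∞} V(y)`
(the lower limit is taken in the extended reals): `V ≤ V_∞` almost everywhere, with strict
inequality on a set of positive measure. -/
structure CondV2 (V : R3 → ℝ) (Vinf : ℝ) : Prop where
  liminf_eq : liminf (fun y => (V y : EReal)) (cocompact R3) = (Vinf : EReal)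
  le_ae : ∀ᵐ x : R3, V x ≤ Vinf
  lt_pos : 0 < volume {x : R3 | V x < Vinf}

/-- The potential condition `(V₃)`: `∫ V |u|²` is finite on `H¹(ℝ³)`, and the infimum of
`(∫ |Du|² + V |u|²) / ∫ |u|²` over `H¹(ℝ³) \ {0}` is a positive number. -/
structure CondV3 (V : R3 → ℝ) : Prop where
  integrable : ∀ u : H1, Integrable (fun x => V x * |u.fn x| ^ 2)
  inf_pos : ∃ C : ℝ, 0 < C ∧
    IsGLB {r : ℝ | ∃ u : H1, u ≠ 0 ∧ r = (gradSq u + potSq V u) / powInt 2 u} C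

/-- The Kirchhoff functional
`I_{V,λ}(u) = ½ ∫ (a|Du|² + V|u|²) + (b/4) (∫ |Du|²)² - λ/(p+1) ∫ |u|^{p+1}`. -/
def energyI (a b p lam : ℝ) (V : R3 → ℝ) (u : H1) : ℝ :=
  1 / 2 * (a * gradSq u + potSq V u) + b / 4 * gradSq u ^ 2 - lam / (p + 1) * powInt (p + 1) u

/-- The frozen functional
`J_{V,λ}(u) = (a + bA²)/2 ∫ |Du|² + ½ ∫ V|u|² - λ/(p+1) ∫ |u|^{p+1}`.
The functional `J^∞_λ` is the case of the constant potential `V_∞`. -/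
def energyJ (a b p lam A : ℝ) (V : R3 → ℝ) (u : H1) : ℝ :=
  (a + b * A ^ 2) / 2 * gradSq u + 1 / 2 * potSq V u - lam / (p + 1) * powInt (p + 1) u

/-- `w ∈ H¹(ℝ³)` is a weak solution of `-κ Δw + m w = λ |w|^{p-1} w` in `ℝ³`. -/
def IsWeakSolution (κ m p lam : ℝ) (w : H1) : Prop :=
  ∀ ψ : H1, κ * (∫ x, inner ℝ (w.grad x) (ψ.grad x)) + m * (∫ x, w.fn x * ψ.fn x)
    = lam * (∫ x, |w.fn x| ^ (p - 1) * w.fn x * ψ.fn x)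

/-- `(x n)` is a Palais-Smale sequence of `Φ` at level `c`: `Φ (x n) → c`, and the Fréchet
derivatives `Φ' (x n)` exist and tend to `0` in the norm of the dual space. -/
def IsPSSeq {X : Type*} [NormedAddCommGroup X] [NormedSpace ℝ X] (Φ : X → ℝ) (c : ℝ)
    (x : ℕ → X) : Prop :=
  Tendsto (fun n => Φ (x n)) atTop (𝓝 c) ∧
    ∃ D : ℕ → X →L[ℝ] ℝ, (∀ n, HasFDerivAt Φ (D n) (x n)) ∧
      Tendsto (fun n => ‖D n‖) atTop (𝓝 0)

/-- Weak convergence in a normed space: convergence against every continuous linear functional. -/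
def WeaklyTendsto {X : Type*} [NormedAddCommGroup X] [NormedSpace ℝ X] (x : ℕ → X) (y : X) : Prop :=
  ∀ f : X →L[ℝ] ℝ, Tendsto (fun n => f (x n)) atTop (𝓝 (f y))

end Kirchhoff

end

noncomputable section

namespace Kirchhoff

/-! ### The Hilbert space structure of `H¹` -/

/-! Along a subsequence `u_n ⇀ u₀` and `∫|Du_n|² → A²`. The nonlocal coefficient `a + b∫|Du_n|²` can
then be frozen at `κ = a + bA²`, so `u_n` is almost critical for `energyJ`. Its derivative
`frozenDeriv`, paired with a fixed test function, is continuous along weakly convergent sequences,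
so `u₀` is critical.

Since `V ≤ V_∞`, `∫V|u|² = V_∞|u|₂² - |Tu|₂²` with `Tu = (V_∞ - V)^{1/2}u`. The closed graph theorem
makes `T` bounded (`weightL`), and `T w(· - y_n) → 0` as `|y_n| → ∞` (`tendsto_weightL_translateL`).
Hence weak limits of `u_n(· + y_n)` solve the equation at infinity
(`isWeakSolution_of_translated_limit`). As `V_∞ > 0`, nontrivial solutions of that equation have
norms bounded below (`exists_norm_sq_ge_of_isWeakSolution`).

Profiles are extracted by concentration compactness: a bounded sequence that does not vanish in
`L^{p+1}` has translates with a nonzero weak limit (`exists_translated_weak_limit`). Squared norms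
split along the decomposition, and each profile consumes a fixed amount, so after finitely many
steps the remainder `r_n` tends to zero in `L^{p+1}` (`exists_profileDecomp`).

Strong convergence of `r_n` comes from testing the almost-equation with `r_n`: cross terms and the
power term vanish, leaving `κ∫|Dr_n|² + ∫V|r_n|² → 0`. The form with coefficient `a` is
asymptotically nonnegative on weakly null sequences (`eventually_form_ge`), so `bA²∫|Dr_n|² → 0`.
Here `c > 0` matters: it excludes `A = 0` (`gradSq_limit_ne_zero`). Condition `(V₃)` then controls
the `L²` norm (`ProfileDecomp.tendsto_remainder`).

For the energies no quadratic term is needed: at every critical point involved, `J = (1/2 -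
1/(p+1))λ∫|u|^{p+1}`, and `c + bA⁴/4` is the same expression in the limit of `∫|u_n|^{p+1}`. The
energy identity is therefore the Brezis–Lieb splitting of that integral; the identity for `A²` is
the splitting of the Dirichlet integral. -/

/-- The inclusion of `H¹` in `L²`. -/
def toL2 : H1 →L[ℝ] Lp ℝ 2 (volume : Measure R3) :=
  (WithLp.fstL 2 ℝ (Lp ℝ 2 (volume : Measure R3)) (Lp R3 2 (volume : Measure R3))).comp
    h1Submodule.subtypeL

/-- The weak gradient as a bounded operator from `H¹` to `L²`. -/
def gradL : H1 →L[ℝ] Lp R3 2 (volume : Measure R3) :=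
  (WithLp.sndL 2 ℝ (Lp ℝ 2 (volume : Measure R3)) (Lp R3 2 (volume : Measure R3))).comp
    h1Submodule.subtypeL

theorem coe_toL2 (u : H1) : (toL2 u : R3 → ℝ) = u.fn := rfl

theorem coe_gradL (u : H1) : (gradL u : R3 → R3) = u.grad := rfl

theorem norm_sq_eq_toL2_add_gradL (u : H1) : ‖u‖ ^ 2 = ‖toL2 u‖ ^ 2 + ‖gradL u‖ ^ 2 :=
  WithLp.prod_norm_sq_eq_of_L2 u.1

theorem inner_eq_toL2_add_gradL (u v : H1) :
    inner ℝ u v = inner ℝ (toL2 u) (toL2 v) + inner ℝ (gradL u) (gradL v) :=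
  WithLp.prod_inner_apply u.1 v.1

theorem norm_toL2_le (u : H1) : ‖toL2 u‖ ≤ ‖u‖ := by
  have := norm_sq_eq_toL2_add_gradL u
  exact abs_le_of_sq_le_sq' (by nlinarith [sq_nonneg ‖gradL u‖]) (norm_nonneg _) |>.2

theorem norm_gradL_le (u : H1) : ‖gradL u‖ ≤ ‖u‖ := by
  have := norm_sq_eq_toL2_add_gradL u
  exact abs_le_of_sq_le_sq' (by nlinarith [sq_nonneg ‖toL2 u‖]) (norm_nonneg _) |>.2

theorem memLp_fn (u : H1) : MemLp u.fn 2 volume := Lp.memLp (toL2 u)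

theorem memLp_grad (u : H1) : MemLp u.grad 2 volume := Lp.memLp (gradL u)

theorem stronglyMeasurable_fn (u : H1) : StronglyMeasurable u.fn :=
  Lp.stronglyMeasurable (toL2 u)

theorem stronglyMeasurable_grad (u : H1) : StronglyMeasurable u.grad :=
  Lp.stronglyMeasurable (gradL u)

theorem norm_Lp_sq {E : Type*} [NormedAddCommGroup E] [InnerProductSpace ℝ E]
    (f : Lp E 2 (volume : Measure R3)) : ‖f‖ ^ 2 = ∫ x, ‖f x‖ ^ 2 := by
  rw [← real_inner_self_eq_norm_sq, L2.inner_def]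
  simp only [real_inner_self_eq_norm_sq]

theorem gradSq_eq (u : H1) : gradSq u = ‖gradL u‖ ^ 2 := (norm_Lp_sq (gradL u)).symm

theorem integral_sq_eq (u : H1) : ∫ x, |u.fn x| ^ 2 = ‖toL2 u‖ ^ 2 := (norm_Lp_sq (toL2 u)).symm

theorem powInt_two (u : H1) : powInt 2 u = ‖toL2 u‖ ^ 2 := by
  rw [← integral_sq_eq]
  unfold powInt
  norm_cast

theorem norm_sq_eq (u : H1) : ‖u‖ ^ 2 = powInt 2 u + gradSq u := by
  rw [powInt_two, gradSq_eq, norm_sq_eq_toL2_add_gradL]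

theorem integral_inner_grad (u v : H1) :
    ∫ x, inner ℝ (u.grad x) (v.grad x) = inner ℝ (gradL u) (gradL v) :=
  (L2.inner_def _ _).symm

theorem integral_fn_mul (u v : H1) : ∫ x, u.fn x * v.fn x = inner ℝ (toL2 u) (toL2 v) := by
  rw [L2.inner_def]
  exact integral_congr_ae (.of_forall fun x => by simp [mul_comm, coe_toL2])

/-- For a fixed test function and direction, the weak gradient identity equates two continuous
linear functionals on `L² × L²`; `H¹` is the intersection of these closed conditions. -/
theorem isClosed_h1Submodule : IsClosed (h1Submodule : Set L2Pair) := by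
  have : (h1Submodule : Set L2Pair) = ⋂ (φ : R3 → ℝ) (hφ : ContDiff ℝ ∞ φ)
      (hc : HasCompactSupport φ) (v : R3),
      {z : L2Pair | inner ℝ ((memLp_fderiv_apply hφ hc v).toLp _) z.fst
        = - inner ℝ (((hφ.continuous.smul continuous_const).memLp_of_hasCompactSupport
            (μ := volume) (p := 2) (f := fun x => φ x • v) hc.smul_right).toLp _) z.snd} := by
    ext z
    simp only [Set.mem_iInter, Set.mem_ofPred_eq]
    refine forall_congr' fun φ => forall_congr' fun hφ => forall_congr' fun hc =>
      forall_congr' fun v => ?_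
    rw [L2.inner_def, L2.inner_def]
    have e1 : ∫ x, inner ℝ ((memLp_fderiv_apply hφ hc v).toLp _ x) (z.fst x)
        = ∫ x, z.fst x * fderiv ℝ φ x v := by
      refine integral_congr_ae ?_
      filter_upwards [(memLp_fderiv_apply hφ hc v).coeFn_toLp] with x hx
      rw [hx]; simp
    have e2 : ∫ x, inner ℝ ((((hφ.continuous.smul continuous_const).memLp_of_hasCompactSupport
            (μ := volume) (p := 2) (f := fun x => φ x • v) hc.smul_right).toLp _) x) (z.snd x)
        = ∫ x, inner ℝ (z.snd x) v * φ x := by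
      refine integral_congr_ae ?_
      filter_upwards [((hφ.continuous.smul continuous_const).memLp_of_hasCompactSupport
            (μ := volume) (p := 2) (f := fun x => φ x • v) hc.smul_right).coeFn_toLp] with x hx
      rw [hx, inner_smul_left, real_inner_comm]; simp [mul_comm]
    rw [e1, e2]
  rw [this]
  refine isClosed_iInter fun φ => isClosed_iInter fun hφ => isClosed_iInter fun hc =>
    isClosed_iInter fun v => isClosed_eq ?_ ?_
  · exact continuous_const.inner (WithLp.fstL 2 ℝ _ _).continuous
  · exact (continuous_const.inner (WithLp.sndL 2 ℝ _ _).continuous).neg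

instance : CompleteSpace H1 := isClosed_h1Submodule.completeSpace_coe

instance : TopologicalSpace.SeparableSpace H1 := by
  have : Fact ((2 : ℝ≥0∞) ≠ ⊤) := ⟨by simp⟩
  have h1 : SecondCountableTopology (Lp ℝ 2 (volume : Measure R3)) := inferInstance
  have h2 : SecondCountableTopology (Lp R3 2 (volume : Measure R3)) := inferInstance
  have : SecondCountableTopology L2Pair := WithLp.secondCountableTopology _ _ _
  have : SecondCountableTopology H1 := TopologicalSpace.Subtype.secondCountableTopology _
  infer_instance

/-! ### Weak convergence -/

theorem weaklyTendsto_iff {X : Type*} [NormedAddCommGroup X] [InnerProductSpace ℝ X]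
    [CompleteSpace X] {x : ℕ → X} {y : X} :
    WeaklyTendsto x y ↔ ∀ ψ, Tendsto (fun n => inner ℝ (x n) ψ) atTop (𝓝 (inner ℝ y ψ)) := by
  constructor
  · intro h ψ
    simpa [real_inner_comm] using h (innerSL ℝ ψ)
  · intro h f
    have := h ((InnerProductSpace.toDual ℝ X).symm f)
    have e : ∀ z, inner ℝ z ((InnerProductSpace.toDual ℝ X).symm f) = f z := fun z => by
      rw [real_inner_comm, InnerProductSpace.toDual_symm_apply]
    simpa only [e] using this

/-- Sequential Banach–Alaoglu in the dual of a separable space, transported back by the Riesz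
isomorphism. -/
theorem exists_weaklyTendsto_subseq {X : Type*} [NormedAddCommGroup X] [InnerProductSpace ℝ X]
    [CompleteSpace X] [TopologicalSpace.SeparableSpace X] {x : ℕ → X} {R : ℝ}
    (hx : ∀ n, ‖x n‖ ≤ R) : ∃ s : ℕ → ℕ, StrictMono s ∧ ∃ y, WeaklyTendsto (x ∘ s) y := by
  have hc := WeakDual.isSeqCompact_closedBall ℝ X 0 R
  obtain ⟨f, -, s, hs, hlim⟩ := hc
    (x := fun n => StrongDual.toWeakDual (InnerProductSpace.toDual ℝ X (x n))) (by
      intro n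
      simpa using hx n)
  refine ⟨s, hs, (InnerProductSpace.toDual ℝ X).symm (WeakDual.toStrongDual f), ?_⟩
  rw [weaklyTendsto_iff]
  intro ψ
  have := (WeakBilin.eval_continuous _ ψ).tendsto f |>.comp hlim
  simp only [InnerProductSpace.toDual_symm_apply]
  exact this

namespace WeaklyTendsto

variable {X : Type*} [NormedAddCommGroup X] [NormedSpace ℝ X] {x x' : ℕ → X} {y y' : X}

theorem add (h : WeaklyTendsto x y) (h' : WeaklyTendsto x' y') :
    WeaklyTendsto (fun n => x n + x' n) (y + y') := fun f => by
  simpa using (h f).add (h' f)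

theorem sub (h : WeaklyTendsto x y) (h' : WeaklyTendsto x' y') :
    WeaklyTendsto (fun n => x n - x' n) (y - y') := fun f => by
  simpa using (h f).sub (h' f)

theorem const (y : X) : WeaklyTendsto (fun _ => y) y := fun _ => tendsto_const_nhds

theorem comp (h : WeaklyTendsto x y) {s : ℕ → ℕ} (hs : StrictMono s) :
    WeaklyTendsto (fun n => x (s n)) y := fun f => (h f).comp hs.tendsto_atTop

theorem map {Y : Type*} [NormedAddCommGroup Y] [NormedSpace ℝ Y] (h : WeaklyTendsto x y)
    (L : X →L[ℝ] Y) : WeaklyTendsto (fun n => L (x n)) (L y) := fun f => h (f.comp L)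

theorem sub_self (h : WeaklyTendsto x y) : WeaklyTendsto (fun n => x n - y) 0 := by
  simpa using h.sub (const y)

theorem finset_sum {ι : Type*} (S : Finset ι) {z : ι → ℕ → X} {w : ι → X}
    (h : ∀ i ∈ S, WeaklyTendsto (z i) (w i)) :
    WeaklyTendsto (fun n => ∑ i ∈ S, z i n) (∑ i ∈ S, w i) := fun f => by
  simpa using tendsto_finsetSum S fun i hi => h i hi f

/-- Uniform boundedness, applied to the images of the sequence in the double dual. -/
theorem bounded (h : WeaklyTendsto x y) : ∃ R, ∀ n, ‖x n‖ ≤ R := by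
  have h1 : ∀ f : X →L[ℝ] ℝ, ∃ C, ∀ n, ‖(NormedSpace.inclusionInDoubleDual ℝ X (x n)) f‖ ≤ C := by
    intro f
    obtain ⟨C, hC⟩ := (h f).norm.bddAbove_range
    exact ⟨C, fun n => hC ⟨n, rfl⟩⟩
  obtain ⟨C, hC⟩ := banach_steinhaus h1
  refine ⟨C, fun n => ?_⟩
  have := (NormedSpace.inclusionInDoubleDualLi ℝ (E := X)).norm_map (x n)
  rw [← this]
  exact hC n

end WeaklyTendsto

theorem WeaklyTendsto.inner_strong {X : Type*} [NormedAddCommGroup X] [InnerProductSpace ℝ X]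
    [CompleteSpace X] {x ψ : ℕ → X} {y φ : X} (h : WeaklyTendsto x y)
    (hψ : Tendsto ψ atTop (𝓝 φ)) :
    Tendsto (fun n => inner ℝ (x n) (ψ n)) atTop (𝓝 (inner ℝ y φ)) := by
  obtain ⟨R, hR⟩ := h.bounded
  have h1 := weaklyTendsto_iff.1 h φ
  have h2 : Tendsto (fun n => inner ℝ (x n) (ψ n - φ)) atTop (𝓝 0) := by
    have h3 : Tendsto (fun n => R * ‖ψ n - φ‖) atTop (𝓝 0) := by
      simpa using (tendsto_iff_norm_sub_tendsto_zero.1 hψ).const_mul R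
    refine squeeze_zero_norm (fun n => ?_) h3
    exact (norm_inner_le_norm _ _).trans (mul_le_mul_of_nonneg_right (hR n) (norm_nonneg _))
  have := h2.add h1
  simpa [inner_sub_right] using this

/-! ### Construction of elements of `H¹` -/

theorem IsWeakGradient.congr {f f' : R3 → ℝ} {g g' : R3 → R3} (h : IsWeakGradient f g)
    (hf : f =ᵐ[volume] f') (hg : g =ᵐ[volume] g') : IsWeakGradient f' g' := by
  intro φ hφ hc v
  have e1 : ∫ x, f' x * fderiv ℝ φ x v = ∫ x, f x * fderiv ℝ φ x v :=
    integral_congr_ae (hf.mono fun x hx => by simp only [hx])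
  have e2 : ∫ x, inner ℝ (g' x) v * φ x = ∫ x, inner ℝ (g x) v * φ x :=
    integral_congr_ae (hg.mono fun x hx => by simp only [hx])
  rw [e1, e2, h φ hφ hc v]

/-- The element of `H¹` given by a square integrable function with a square integrable weak
gradient. -/
def H1.ofWeakGradient {f : R3 → ℝ} {g : R3 → R3} (hf : MemLp f 2 volume) (hg : MemLp g 2 volume)
    (h : IsWeakGradient f g) : H1 :=
  ⟨WithLp.toLp 2 (hf.toLp f, hg.toLp g), h.congr hf.coeFn_toLp.symm hg.coeFn_toLp.symm⟩

theorem H1.fn_ofWeakGradient {f : R3 → ℝ} {g : R3 → R3} (hf : MemLp f 2 volume)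
    (hg : MemLp g 2 volume) (h : IsWeakGradient f g) :
    (H1.ofWeakGradient hf hg h).fn =ᵐ[volume] f := hf.coeFn_toLp

theorem H1.grad_ofWeakGradient {f : R3 → ℝ} {g : R3 → R3} (hf : MemLp f 2 volume)
    (hg : MemLp g 2 volume) (h : IsWeakGradient f g) :
    (H1.ofWeakGradient hf hg h).grad =ᵐ[volume] g := hg.coeFn_toLp

theorem inner_gradient (φ : R3 → ℝ) (x v : R3) : inner ℝ (gradient φ x) v = fderiv ℝ φ x v := by
  simp [gradient]

theorem norm_gradient (φ : R3 → ℝ) (x : R3) : ‖gradient φ x‖ = ‖fderiv ℝ φ x‖ := by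
  simp [gradient]

theorem continuous_gradient {φ : R3 → ℝ} (hφ : ContDiff ℝ ∞ φ) : Continuous (gradient φ) :=
  (LinearIsometryEquiv.continuous _).comp (hφ.continuous_fderiv (by simp))

theorem hasCompactSupport_gradient {φ : R3 → ℝ} (hc : HasCompactSupport φ) :
    HasCompactSupport (gradient φ) :=
  (hc.fderiv ℝ).comp_left (g := (InnerProductSpace.toDual ℝ R3).symm) (by simp)

theorem exists_bound_of_compactSupport {E : Type*} [NormedAddCommGroup E] {f : R3 → E}
    (hf : Continuous f) (hc : HasCompactSupport f) : ∃ C, ∀ x, ‖f x‖ ≤ C :=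
  hc.exists_bound_of_continuous hf

/-- The identity for `u` is tested with `χφ`. Since `φ` has compact support, `χ` needs neither
support nor growth conditions here. -/
theorem isWeakGradient_mul {χ : R3 → ℝ} (hχ : ContDiff ℝ ∞ χ) (u : H1) :
    IsWeakGradient (fun x => χ x * u.fn x) (fun x => χ x • u.grad x + u.fn x • gradient χ x) := by
  intro φ hφ hc v
  have key := u.2 (fun x => χ x * φ x) (hχ.mul hφ) hc.mul_left v
  have hd : ∀ x, fderiv ℝ (fun x => χ x * φ x) x v
      = χ x * fderiv ℝ φ x v + φ x * fderiv ℝ χ x v := by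
    intro x
    rw [fderiv_fun_mul (hχ.differentiable (by simp) x) (hφ.differentiable (by simp) x)]
    simp
  have hI : ∀ ρ : R3 → ℝ, Continuous ρ → HasCompactSupport ρ →
      Integrable (fun x => u.fn x * ρ x) := fun ρ h1 h2 =>
    MemLp.integrable_mul (p := 2) (q := 2) (memLp_fn u) (h1.memLp_of_hasCompactSupport h2)
  have hcd : ∀ w : R3, Continuous fun x => fderiv ℝ χ x w := fun w =>
    (hχ.continuous_fderiv (by simp)).clm_apply continuous_const
  have hcd' : ∀ w : R3, Continuous fun x => fderiv ℝ φ x w := fun w =>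
    (hφ.continuous_fderiv (by simp)).clm_apply continuous_const
  have i1 := hI (fun x => χ x * fderiv ℝ φ x v) (hχ.continuous.mul (hcd' v))
    (hc.fderiv_apply ℝ v).mul_left
  have i2 := hI (fun x => φ x * fderiv ℝ χ x v) (hφ.continuous.mul (hcd v)) hc.mul_right
  have i3 : Integrable (fun x => inner ℝ (u.grad x) v * (χ x * φ x)) :=
    MemLp.integrable_mul (p := 2) (q := 2) ((memLp_grad u).inner_const v)
      ((hχ.continuous.mul hφ.continuous).memLp_of_hasCompactSupport hc.mul_left)
  have e1 : ∫ x, u.fn x * fderiv ℝ (fun x => χ x * φ x) x v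
      = (∫ x, u.fn x * (χ x * fderiv ℝ φ x v)) + ∫ x, u.fn x * (φ x * fderiv ℝ χ x v) := by
    rw [← integral_add i1 i2]
    exact integral_congr_ae (.of_forall fun x => by simp only [hd]; ring)
  have e2 : ∫ x, inner ℝ (χ x • u.grad x + u.fn x • gradient χ x) v * φ x
      = (∫ x, inner ℝ (u.grad x) v * (χ x * φ x)) + ∫ x, u.fn x * (φ x * fderiv ℝ χ x v) := by
    rw [← integral_add i3 i2]
    refine integral_congr_ae (.of_forall fun x => ?_)
    simp only [inner_add_left, real_inner_smul_left, inner_gradient]; ring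
  have e3 : ∫ x, χ x * u.fn x * fderiv ℝ φ x v = ∫ x, u.fn x * (χ x * fderiv ℝ φ x v) :=
    integral_congr_ae (.of_forall fun x => by ring)
  change ∫ x, u.fn x * fderiv ℝ (fun x => χ x * φ x) x v
    = - ∫ x, inner ℝ (u.grad x) v * (χ x * φ x) at key
  rw [e1] at key
  rw [e2, e3]
  linarith

theorem memLp_smul_of_bounded {E : Type*} [NormedAddCommGroup E] [NormedSpace ℝ E]
    {q : ℝ≥0∞} {f : R3 → E} (hf : MemLp f q volume)
    {χ : R3 → ℝ} (hχ : Continuous χ) {C : ℝ} (hC : ∀ x, ‖χ x‖ ≤ C) :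
    MemLp (fun x => χ x • f x) q volume := by
  refine MemLp.of_le_mul (c := C) hf (hχ.aestronglyMeasurable.smul hf.1) (.of_forall fun x => ?_)
  rw [norm_smul]
  exact mul_le_mul_of_nonneg_right (hC x) (norm_nonneg _)

theorem memLp_fn_smul {E : Type*} [NormedAddCommGroup E] [NormedSpace ℝ E] (u : H1)
    {g : R3 → E} (hg : Continuous g) {C : ℝ} (hC : ∀ x, ‖g x‖ ≤ C) :
    MemLp (fun x => u.fn x • g x) 2 volume := by
  refine MemLp.of_le_mul (c := C) (memLp_fn u) ((memLp_fn u).1.smul hg.aestronglyMeasurable)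
    (.of_forall fun x => ?_)
  rw [norm_smul, mul_comm]
  exact mul_le_mul_of_nonneg_right (hC x) (norm_nonneg _)

/-- The product of an element of `H¹` with a smooth compactly supported function. -/
def H1.cutoff (u : H1) {χ : R3 → ℝ} (hχ : ContDiff ℝ ∞ χ) (hc : HasCompactSupport χ) : H1 :=
  H1.ofWeakGradient
    (memLp_smul_of_bounded (memLp_fn u) hχ.continuous
      (exists_bound_of_compactSupport hχ.continuous hc).choose_spec)
    ((memLp_smul_of_bounded (memLp_grad u) hχ.continuous
      (exists_bound_of_compactSupport hχ.continuous hc).choose_spec).add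
      (memLp_fn_smul u (continuous_gradient hχ) (exists_bound_of_compactSupport
        (continuous_gradient hχ) (hasCompactSupport_gradient hc)).choose_spec))
    (isWeakGradient_mul hχ u)

theorem H1.fn_cutoff (u : H1) {χ : R3 → ℝ} (hχ : ContDiff ℝ ∞ χ) (hc : HasCompactSupport χ) :
    (u.cutoff hχ hc).fn =ᵐ[volume] fun x => χ x * u.fn x :=
  H1.fn_ofWeakGradient _ _ _

theorem H1.grad_cutoff (u : H1) {χ : R3 → ℝ} (hχ : ContDiff ℝ ∞ χ) (hc : HasCompactSupport χ) :
    (u.cutoff hχ hc).grad =ᵐ[volume] fun x => χ x • u.grad x + u.fn x • gradient χ x :=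
  H1.grad_ofWeakGradient _ _ _

theorem isWeakGradient_of_contDiff {χ : R3 → ℝ} (hχ : ContDiff ℝ ∞ χ) :
    IsWeakGradient χ (gradient χ) := by
  intro φ hφ hc v
  have h := integral_mul_fderiv_eq_neg_fderiv_mul_of_integrable (μ := (volume : Measure R3))
    (f := χ) (g := φ) (v := v)
    (((hχ.continuous_fderiv (by simp)).clm_apply continuous_const).mul
      hφ.continuous |>.integrable_of_hasCompactSupport hc.mul_left)
    ((hχ.continuous.mul ((hφ.continuous_fderiv (by simp)).clm_apply
      continuous_const)).integrable_of_hasCompactSupport (hc.fderiv_apply ℝ v).mul_left)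
    ((hχ.continuous.mul hφ.continuous).integrable_of_hasCompactSupport hc.mul_left)
    (fun x _ => hχ.differentiable (by simp) x) (fun x _ => hφ.differentiable (by simp) x)
  simpa [inner_gradient] using h

/-- A test function as an element of `H¹`. -/
def H1.ofTest {χ : R3 → ℝ} (hχ : ContDiff ℝ ∞ χ) (hc : HasCompactSupport χ) : H1 :=
  H1.ofWeakGradient (hχ.continuous.memLp_of_hasCompactSupport hc)
    ((continuous_gradient hχ).memLp_of_hasCompactSupport (hasCompactSupport_gradient hc))
    (isWeakGradient_of_contDiff hχ)

theorem H1.fn_ofTest {χ : R3 → ℝ} (hχ : ContDiff ℝ ∞ χ) (hc : HasCompactSupport χ) :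
    (H1.ofTest hχ hc).fn =ᵐ[volume] χ := H1.fn_ofWeakGradient _ _ _

theorem H1.grad_ofTest {χ : R3 → ℝ} (hχ : ContDiff ℝ ∞ χ) (hc : HasCompactSupport χ) :
    (H1.ofTest hχ hc).grad =ᵐ[volume] gradient χ := H1.grad_ofWeakGradient _ _ _

/-! ### Translations -/

theorem H1.ext_of_toL2 {u v : H1} (h : toL2 u = toL2 v) (h' : gradL u = gradL v) : u = v :=
  Subtype.ext ((WithLp.equiv 2 _).injective (Prod.ext h h'))

/-- Translation as a linear isometry of `H¹`. -/
def translateL (y : R3) : H1 →ₗᵢ[ℝ] H1 where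
  toFun w := w.translate y
  map_add' u v := H1.ext_of_toL2
    ((Lp.compMeasurePreservingₗᵢ ℝ (fun x : R3 => x - y) (mp_sub y)).map_add (toL2 u) (toL2 v))
    ((Lp.compMeasurePreservingₗᵢ ℝ (fun x : R3 => x - y) (mp_sub y)).map_add (gradL u) (gradL v))
  map_smul' c u := H1.ext_of_toL2
    ((Lp.compMeasurePreservingₗᵢ ℝ (fun x : R3 => x - y) (mp_sub y)).map_smul c (toL2 u))
    ((Lp.compMeasurePreservingₗᵢ ℝ (fun x : R3 => x - y) (mp_sub y)).map_smul c (gradL u))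
  norm_map' u := by
    have h1 : ‖toL2 (u.translate y)‖ = ‖toL2 u‖ :=
      Lp.norm_compMeasurePreserving (toL2 u) (mp_sub y)
    have h2 : ‖gradL (u.translate y)‖ = ‖gradL u‖ :=
      Lp.norm_compMeasurePreserving (gradL u) (mp_sub y)
    have : ‖u.translate y‖ ^ 2 = ‖u‖ ^ 2 := by
      rw [norm_sq_eq_toL2_add_gradL, norm_sq_eq_toL2_add_gradL, h1, h2]
    exact (sq_eq_sq₀ (norm_nonneg _) (norm_nonneg _)).1 this

theorem translateL_apply (y : R3) (w : H1) : translateL y w = w.translate y := rfl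

theorem toL2_translateL (y : R3) (w : H1) : toL2 (translateL y w) =
    Lp.compMeasurePreservingₗᵢ ℝ (fun x : R3 => x - y) (mp_sub y) (toL2 w) := rfl

theorem gradL_translateL (y : R3) (w : H1) : gradL (translateL y w) =
    Lp.compMeasurePreservingₗᵢ ℝ (fun x : R3 => x - y) (mp_sub y) (gradL w) := rfl

theorem fn_translateL (y : R3) (w : H1) :
    (translateL y w).fn =ᵐ[volume] fun x => w.fn (x - y) :=
  Lp.coeFn_compMeasurePreserving (toL2 w) (mp_sub y)

theorem grad_translateL (y : R3) (w : H1) :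
    (translateL y w).grad =ᵐ[volume] fun x => w.grad (x - y) :=
  Lp.coeFn_compMeasurePreserving (gradL w) (mp_sub y)

theorem ae_sub_right {P : R3 → Prop} (h : ∀ᵐ x, P x) (y : R3) : ∀ᵐ x, P (x - y) :=
  (mp_sub y).quasiMeasurePreserving.ae h

theorem translateL_translateL (y z : R3) (w : H1) :
    translateL z (translateL y w) = translateL (y + z) w := by
  refine H1.ext_of_toL2 (Lp.ext ?_) (Lp.ext ?_)
  · filter_upwards [fn_translateL z (translateL y w), ae_sub_right (fn_translateL y w) z,
      fn_translateL (y + z) w] with x h1 h2 h3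
    rw [coe_toL2, coe_toL2, h1, h2, h3]
    congr 1; abel
  · filter_upwards [grad_translateL z (translateL y w), ae_sub_right (grad_translateL y w) z,
      grad_translateL (y + z) w] with x h1 h2 h3
    rw [coe_gradL, coe_gradL, h1, h2, h3]
    congr 1; abel

theorem translateL_zero (w : H1) : translateL 0 w = w := by
  refine H1.ext_of_toL2 (Lp.ext ?_) (Lp.ext ?_)
  · filter_upwards [fn_translateL 0 w] with x h1
    rw [coe_toL2, coe_toL2, h1, sub_zero]
  · filter_upwards [grad_translateL 0 w] with x h1
    rw [coe_gradL, coe_gradL, h1, sub_zero]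

theorem translateL_neg_translateL (y : R3) (w : H1) :
    translateL (-y) (translateL y w) = w := by
  rw [translateL_translateL, add_neg_cancel, translateL_zero]

theorem translateL_translateL_neg (y : R3) (w : H1) :
    translateL y (translateL (-y) w) = w := by
  rw [translateL_translateL, neg_add_cancel, translateL_zero]

theorem inner_gradL_translateL (y : R3) (v w : H1) :
    inner ℝ (gradL (translateL y v)) (gradL (translateL y w)) = inner ℝ (gradL v) (gradL w) := by
  rw [gradL_translateL, gradL_translateL, LinearIsometry.inner_map_map]

theorem inner_toL2_translateL (y : R3) (v w : H1) :
    inner ℝ (toL2 (translateL y v)) (toL2 (translateL y w)) = inner ℝ (toL2 v) (toL2 w) := by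
  rw [toL2_translateL, toL2_translateL, LinearIsometry.inner_map_map]

theorem inner_gradL_translateL_left (y : R3) (v w : H1) :
    inner ℝ (gradL (translateL y v)) (gradL w) = inner ℝ (gradL v) (gradL (translateL (-y) w)) := by
  rw [← inner_gradL_translateL (-y), translateL_neg_translateL]

theorem inner_toL2_translateL_left (y : R3) (v w : H1) :
    inner ℝ (toL2 (translateL y v)) (toL2 w) = inner ℝ (toL2 v) (toL2 (translateL (-y) w)) := by
  rw [← inner_toL2_translateL (-y), translateL_neg_translateL]

theorem inner_translateL_left (y : R3) (v w : H1) :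
    inner ℝ (translateL y v) w = inner ℝ v (translateL (-y) w) := by
  rw [inner_eq_toL2_add_gradL, inner_eq_toL2_add_gradL, inner_gradL_translateL_left,
    inner_toL2_translateL_left]

theorem gradSq_translateL (y : R3) (w : H1) : gradSq (translateL y w) = gradSq w := by
  rw [gradSq_eq, gradSq_eq, gradL_translateL, LinearIsometry.norm_map]

theorem integral_fn_translateL (g : ℝ → ℝ) (y : R3) (w : H1) :
    ∫ x, g ((translateL y w).fn x) = ∫ x, g (w.fn x) := by
  rw [← integral_sub_right_eq_self (fun x => g (w.fn x)) y]
  exact integral_congr_ae ((fn_translateL y w).mono fun x hx => by simp only [hx])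

theorem powInt_translateL (q : ℝ) (y : R3) (w : H1) : powInt q (translateL y w) = powInt q w :=
  integral_fn_translateL (fun s => |s| ^ q) y w

theorem norm_le_toL2_add_gradL (u : H1) : ‖u‖ ≤ ‖toL2 u‖ + ‖gradL u‖ := by
  have := norm_sq_eq_toL2_add_gradL u
  exact abs_le_of_sq_le_sq' (by nlinarith [norm_nonneg (toL2 u), norm_nonneg (gradL u)])
    (by positivity) |>.2

/-- Strong continuity of translations. It serves to show that bounded translations cannot turn a
weakly null sequence into one with a nonzero weak limit. -/
theorem tendsto_translateL {ι : Type*} {l : Filter ι} {y : ι → R3} {y₀ : R3}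
    (hy : Tendsto y l (𝓝 y₀)) (w : H1) :
    Tendsto (fun i => translateL (y i) w) l (𝓝 (translateL y₀ w)) := by
  have hg : Tendsto (fun i => (⟨fun x : R3 => x - y i, by fun_prop⟩ : C(R3, R3))) l
      (𝓝 ⟨fun x : R3 => x - y₀, by fun_prop⟩) := by
    have : Continuous fun z : R3 => (⟨fun x : R3 => x - z, by fun_prop⟩ : C(R3, R3)) :=
      ContinuousMap.continuous_of_continuous_uncurry _ (by
        simp only [Function.uncurry_def, ContinuousMap.coe_mk]; fun_prop)
    exact (this.tendsto y₀).comp hy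
  have h1 : Tendsto (fun i => toL2 (translateL (y i) w)) l (𝓝 (toL2 (translateL y₀ w))) :=
    (tendsto_const_nhds (x := toL2 w)).compMeasurePreservingLp hg (fun i => mp_sub (y i))
      (mp_sub y₀) (by simp)
  have h2 : Tendsto (fun i => gradL (translateL (y i) w)) l (𝓝 (gradL (translateL y₀ w))) :=
    (tendsto_const_nhds (x := gradL w)).compMeasurePreservingLp hg (fun i => mp_sub (y i))
      (mp_sub y₀) (by simp)
  rw [tendsto_iff_norm_sub_tendsto_zero] at h1 h2 ⊢
  refine squeeze_zero (fun _ => norm_nonneg _) (fun i => ?_) (by simpa using h1.add h2)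
  simpa using norm_le_toL2_add_gradL (translateL (y i) w - translateL y₀ w)

/-! ### Mollification -/

section Jensen

variable {E : Type*} [NormedAddCommGroup E] [NormedSpace ℝ E]

/-- Jensen's inequality, obtained from the monotonicity of `L^q` norms in `q` on a probability
space. -/
theorem enorm_integral_rpow_le {α : Type*} [MeasurableSpace α] (ν : Measure α)
    [IsProbabilityMeasure ν] {f : α → E} (hf : AEStronglyMeasurable f ν) {q : ℝ} (hq : 1 ≤ q) :
    ‖∫ t, f t ∂ν‖ₑ ^ q ≤ ∫⁻ t, ‖f t‖ₑ ^ q ∂ν := by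
  have h1 : ‖∫ t, f t ∂ν‖ₑ ≤ eLpNorm' f 1 ν := by
    simpa [eLpNorm'] using enorm_integral_le_lintegral_enorm (μ := ν) f
  have h2 := h1.trans (eLpNorm'_le_eLpNorm'_of_exponent_le one_pos hq ν hf)
  have hq0 : 0 < q := by linarith
  calc ‖∫ t, f t ∂ν‖ₑ ^ q ≤ (eLpNorm' f q ν) ^ q := ENNReal.rpow_le_rpow h2 hq0.le
    _ = _ := by
      rw [eLpNorm', ← ENNReal.rpow_mul, one_div, inv_mul_cancel₀ hq0.ne', ENNReal.rpow_one]

theorem lintegral_enorm_integral_rpow_le {α β : Type*} [MeasurableSpace α] [MeasurableSpace β]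
    (μ : Measure β) [SFinite μ] (ν : Measure α) [IsProbabilityMeasure ν] {F : β → α → E}
    (hF : StronglyMeasurable (Function.uncurry F)) {q : ℝ} (hq : 1 ≤ q) :
    ∫⁻ x, ‖∫ t, F x t ∂ν‖ₑ ^ q ∂μ ≤ ∫⁻ t, ∫⁻ x, ‖F x t‖ₑ ^ q ∂μ ∂ν := by
  calc ∫⁻ x, ‖∫ t, F x t ∂ν‖ₑ ^ q ∂μ ≤ ∫⁻ x, ∫⁻ t, ‖F x t‖ₑ ^ q ∂ν ∂μ :=
        lintegral_mono fun x => enorm_integral_rpow_le ν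
          (hF.comp_measurable measurable_prodMk_left).aestronglyMeasurable hq
    _ = _ := lintegral_lintegral_swap (hF.enorm.pow_const q).aemeasurable

/-- The mollification of a function by a normalised bump function. -/
def mollify (φ : ContDiffBump (0 : R3)) (f : R3 → E) (x : R3) : E :=
  ∫ t, φ.normed volume t • f (x - t)

/-- The probability measure whose density is a normalised bump function. -/
def bumpMeasure (φ : ContDiffBump (0 : R3)) : Measure R3 :=
  volume.withDensity fun t => ENNReal.ofReal (φ.normed volume t)

instance (φ : ContDiffBump (0 : R3)) : IsProbabilityMeasure (bumpMeasure φ) := ⟨by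
  rw [bumpMeasure, withDensity_apply _ MeasurableSet.univ, Measure.restrict_univ,
    ← ofReal_integral_eq_lintegral_ofReal φ.integrable_normed
      (.of_forall fun x => φ.nonneg_normed x), φ.integral_normed, ENNReal.ofReal_one]⟩

theorem mollify_eq_integral (φ : ContDiffBump (0 : R3)) (f : R3 → E) (x : R3) :
    mollify φ f x = ∫ t, f (x - t) ∂(bumpMeasure φ) := by
  rw [bumpMeasure, integral_withDensity_eq_integral_toReal_smul
    (φ.continuous_normed.measurable.ennreal_ofReal) (.of_forall fun x => by simp)]
  exact integral_congr_ae (.of_forall fun t => by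
    simp only [ENNReal.toReal_ofReal (φ.nonneg_normed t)])

theorem mollify_eq_convolution (φ : ContDiffBump (0 : R3)) (f : R3 → E) :
    mollify φ f = convolution (φ.normed volume) f (ContinuousLinearMap.lsmul ℝ ℝ) volume := rfl

/-- Mollification averages translates against a probability measure, and translations preserve the
integral. -/
theorem lintegral_mollify_rpow_le (φ : ContDiffBump (0 : R3)) {f : R3 → E}
    (hf : StronglyMeasurable f) {q : ℝ} (hq : 1 ≤ q) :
    ∫⁻ x, ‖mollify φ f x‖ₑ ^ q ≤ ∫⁻ x, ‖f x‖ₑ ^ q := by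
  simp only [mollify_eq_integral]
  refine (lintegral_enorm_integral_rpow_le volume (bumpMeasure φ) (F := fun x t => f (x - t))
    (hf.comp_measurable (measurable_fst.sub measurable_snd)) hq).trans ?_
  have : ∀ t : R3, ∫⁻ x, ‖f (x - t)‖ₑ ^ q = ∫⁻ x, ‖f x‖ₑ ^ q := fun t =>
    lintegral_sub_right_eq_self (fun x => ‖f x‖ₑ ^ q) t
  simp [this]

theorem integrable_comp_sub_bumpMeasure (φ : ContDiffBump (0 : R3)) {f : R3 → E}
    (hf : LocallyIntegrable f) (x : R3) : Integrable (fun t => f (x - t)) (bumpMeasure φ) := by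
  rw [bumpMeasure, integrable_withDensity_iff_integrable_smul'
    (φ.continuous_normed.measurable.ennreal_ofReal) (.of_forall fun x => by simp)]
  have h : ∀ t, (ENNReal.ofReal (φ.normed volume t)).toReal = φ.normed volume t := fun t =>
    ENNReal.toReal_ofReal (φ.nonneg_normed t)
  simp only [h]
  exact (φ.hasCompactSupport_normed.convolutionExists_left (ContinuousLinearMap.lsmul ℝ ℝ)
    φ.continuous_normed hf x)

theorem ae_bumpMeasure_norm_lt (φ : ContDiffBump (0 : R3)) :
    ∀ᵐ t ∂(bumpMeasure φ), ‖t‖ < φ.rOut := by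
  rw [bumpMeasure, ae_withDensity_iff (φ.continuous_normed.measurable.ennreal_ofReal)]
  refine .of_forall fun t ht => ?_
  have : t ∈ Function.support (φ.normed volume) := fun h => ht (by simp [h])
  simpa [φ.support_normed_eq] using this

theorem lintegral_mollify_sub_rpow_le (φ : ContDiffBump (0 : R3)) {f : R3 → E}
    (hf : StronglyMeasurable f) (hi : LocallyIntegrable f) [CompleteSpace E] {q : ℝ} (hq : 1 ≤ q)
    {C : ℝ≥0∞} (hC : ∀ t : R3, ‖t‖ < φ.rOut → ∫⁻ x, ‖f (x - t) - f x‖ₑ ^ q ≤ C) :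
    ∫⁻ x, ‖mollify φ f x - f x‖ₑ ^ q ≤ C := by
  have : ∀ x, mollify φ f x - f x = ∫ t, (f (x - t) - f x) ∂(bumpMeasure φ) := by
    intro x
    rw [integral_sub (integrable_comp_sub_bumpMeasure φ hi x) (integrable_const _),
      mollify_eq_integral]
    simp
  simp only [this]
  refine (lintegral_enorm_integral_rpow_le volume (bumpMeasure φ)
    (F := fun x t => f (x - t) - f x)
    ((hf.comp_measurable (measurable_fst.sub measurable_snd)).sub
      (hf.comp_measurable measurable_fst)) hq).trans ?_
  refine (lintegral_mono_ae ((ae_bumpMeasure_norm_lt φ).mono fun t ht => hC t ht)).trans ?_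
  simp

end Jensen

theorem locallyIntegrable_fn (u : H1) : LocallyIntegrable u.fn :=
  (memLp_fn u).locallyIntegrable (by norm_num)

theorem locallyIntegrable_grad (u : H1) : LocallyIntegrable u.grad :=
  (memLp_grad u).locallyIntegrable (by norm_num)

theorem contDiff_mollify (φ : ContDiffBump (0 : R3)) (u : H1) : ContDiff ℝ ∞ (mollify φ u.fn) := by
  rw [mollify_eq_convolution]
  exact φ.hasCompactSupport_normed.contDiff_convolution_left _ φ.contDiff_normed
    (locallyIntegrable_fn u)

theorem mollify_eq_swap {E : Type*} [NormedAddCommGroup E] [NormedSpace ℝ E]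
    (φ : ContDiffBump (0 : R3)) (f : R3 → E) (x : R3) :
    mollify φ f x = ∫ t, φ.normed volume (x - t) • f t :=
  convolution_lsmul_swap

/-- The classical derivative falls on the kernel, and `t ↦ φ(x - t)` is itself a test function, so
the weak gradient identity moves it onto `u`. -/
theorem gradient_mollify (φ : ContDiffBump (0 : R3)) (u : H1) (x : R3) :
    gradient (mollify φ u.fn) x = mollify φ u.grad x := by
  refine ext_inner_right ℝ fun v => ?_
  rw [inner_gradient]
  have hd := φ.hasCompactSupport_normed (μ := volume).hasFDerivAt_convolution_right
    (ContinuousLinearMap.lsmul ℝ ℝ).flip (locallyIntegrable_fn u)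
    (φ.contDiff_normed (μ := volume) (n := 1)) x
  rw [convolution_flip] at hd
  rw [mollify_eq_convolution, hd.fderiv, convolution_precompR_apply _ (locallyIntegrable_fn u)
    (φ.hasCompactSupport_normed.fderiv ℝ)
    ((φ.contDiff_normed (n := ⊤)).continuous_fderiv (by simp)), convolution_def]
  set ρ : R3 → ℝ := fun t => φ.normed volume (x - t) with hρ
  have hρs : ContDiff ℝ ∞ ρ := (φ.contDiff_normed (n := ⊤)).comp (contDiff_const.sub contDiff_id)
  have hρc : HasCompactSupport ρ :=
    φ.hasCompactSupport_normed.comp_homeomorph (Homeomorph.subLeft x)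
  have hρd : ∀ t, fderiv ℝ ρ t v = - fderiv ℝ (φ.normed volume) (x - t) v := by
    intro t
    have h1 : HasFDerivAt (φ.normed volume) (fderiv ℝ (φ.normed volume) (x - t)) (x - t) :=
      ((φ.contDiff_normed (n := ⊤)).differentiable (by simp) _).hasFDerivAt
    have h2 : HasFDerivAt (fun t : R3 => x - t) (-ContinuousLinearMap.id ℝ R3) t :=
      (hasFDerivAt_id t).const_sub x
    have h3 : HasFDerivAt ρ _ t := h1.comp t h2
    rw [h3.fderiv]
    simp
  have key := u.2 ρ hρs hρc v
  rw [mollify_eq_swap, real_inner_comm, ← integral_inner]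
  · simp only [ContinuousLinearMap.flip_apply, ContinuousLinearMap.lsmul_apply, smul_eq_mul]
    have e1 : ∫ t, fderiv ℝ (φ.normed volume) (x - t) v * u.fn t
        = - ∫ t, u.fn t * fderiv ℝ ρ t v := by
      rw [← integral_neg]
      exact integral_congr_ae (.of_forall fun t => by simp only [hρd]; ring)
    rw [e1]
    change - ∫ t, u.1.fst t * fderiv ℝ ρ t v = _
    rw [key, neg_neg]
    refine integral_congr_ae (.of_forall fun t => ?_)
    simp only [inner_smul_right, H1.grad]
    exact (congrArg (· * ρ t) (real_inner_comm _ _)).trans (mul_comm _ _)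
  · exact (locallyIntegrable_grad u).integrable_smul_left_of_hasCompactSupport hρs.continuous hρc

/-- The radii `1/(n+1)` of a sequence of mollifiers. -/
def stdBump (n : ℕ) : ContDiffBump (0 : R3) where
  rIn := 1 / (2 * (n + 1))
  rOut := 1 / (n + 1)
  rIn_pos := by positivity
  rIn_lt_rOut := by
    apply one_div_lt_one_div_of_lt <;> linarith [(n.cast_nonneg : (0 : ℝ) ≤ n)]

theorem tendsto_stdBump_rOut : Tendsto (fun n => (stdBump n).rOut) atTop (𝓝 0) :=
  tendsto_one_div_add_atTop_nhds_zero_nat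

theorem ae_tendsto_mollify (u : H1) :
    ∀ᵐ x, Tendsto (fun n => mollify (stdBump n) u.fn x) atTop (𝓝 (u.fn x)) := by
  -- `K` bounds the ratio of outer to inner radius, which is exactly 2 for these bumps.
  refine ContDiffBump.ae_convolution_tendsto_right_of_locallyIntegrable (K := 2)
    tendsto_stdBump_rOut (.of_forall fun n => ?_) (locallyIntegrable_fn u)
  have : (0 : ℝ) < n + 1 := by positivity
  simp only [stdBump]
  apply le_of_eq
  field_simp

/-! ### Translation and mollification errors in `L²`. -/

theorem lintegral_enorm_rpow_two {E : Type*} [NormedAddCommGroup E] [InnerProductSpace ℝ E]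
    (f : Lp E 2 (volume : Measure R3)) : ∫⁻ x, ‖f x‖ₑ ^ (2 : ℝ) = ENNReal.ofReal (‖f‖ ^ 2) := by
  rw [norm_Lp_sq, ofReal_integral_eq_lintegral_ofReal]
  · refine lintegral_congr fun x => ?_
    rw [← ofReal_norm, ENNReal.ofReal_rpow_of_nonneg (norm_nonneg _) (by norm_num)]
    norm_cast
  · exact (Lp.memLp f).integrable_norm_pow (by norm_num)
  · exact .of_forall fun x => by positivity

/-- The difference is the average of `-Df·h` over the segment from `x` to `x - h`; Jensen and
translation invariance then apply. -/
theorem lintegral_translate_smooth_le {f : R3 → ℝ} (hf : ContDiff ℝ ∞ f) (h : R3) :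
    ∫⁻ x, ‖f (x - h) - f x‖ₑ ^ (2 : ℝ)
      ≤ ‖h‖ₑ ^ (2 : ℝ) * ∫⁻ x, ‖gradient f x‖ₑ ^ (2 : ℝ) := by
  let ν : Measure ℝ := volume.restrict (Set.Ioc 0 1)
  have : IsProbabilityMeasure ν := ⟨by simp [ν]⟩
  have hcont : Continuous (fun z : R3 × ℝ => fderiv ℝ f (z.1 - z.2 • h) (-h)) :=
    ((hf.continuous_fderiv (by simp)).comp (by fun_prop)).clm_apply continuous_const
  have key : ∀ x, f (x - h) - f x = ∫ t, fderiv ℝ f (x - t • h) (-h) ∂ν := by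
    intro x
    have hd : ∀ t ∈ Set.uIcc (0 : ℝ) 1,
        HasDerivAt (fun t : ℝ => f (x - t • h)) (fderiv ℝ f (x - t • h) (-h)) t := by
      intro t _
      have h1 : HasDerivAt (fun t : ℝ => x - t • h) (-h) t := by
        simpa using ((hasDerivAt_id t).smul_const h).const_sub x
      exact (hf.differentiable (by simp) _).hasFDerivAt.comp_hasDerivAt t h1
    have := intervalIntegral.integral_eq_sub_of_hasDerivAt hd
      ((hcont.comp (by fun_prop : Continuous fun t : ℝ => (x, t))).intervalIntegrable 0 1)
    rw [intervalIntegral.integral_of_le zero_le_one] at this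
    simpa using this.symm
  simp only [key]
  refine (lintegral_enorm_integral_rpow_le volume ν
    (F := fun (x : R3) (t : ℝ) => fderiv ℝ f (x - t • h) (-h)) hcont.stronglyMeasurable
    (by norm_num)).trans ?_
  have h2 : ∀ t : ℝ, ∫⁻ x, ‖fderiv ℝ f (x - t • h) (-h)‖ₑ ^ (2 : ℝ)
      ≤ ‖h‖ₑ ^ (2 : ℝ) * ∫⁻ x, ‖gradient f x‖ₑ ^ (2 : ℝ) := by
    intro t
    rw [lintegral_sub_right_eq_self (fun x => ‖fderiv ℝ f x (-h)‖ₑ ^ (2 : ℝ)),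
      ← lintegral_const_mul _ ((continuous_gradient hf).enorm.measurable.pow_const _)]
    refine lintegral_mono fun x => ?_
    rw [← ENNReal.mul_rpow_of_nonneg _ _ (by norm_num)]
    refine ENNReal.rpow_le_rpow ?_ (by norm_num)
    rw [map_neg, enorm_neg, ← inner_gradient, mul_comm]
    rw [← ofReal_norm, ← ofReal_norm, ← ofReal_norm, ← ENNReal.ofReal_mul (norm_nonneg _)]
    exact ENNReal.ofReal_le_ofReal (norm_inner_le_norm _ _)
  refine (lintegral_mono h2).trans ?_
  simp

/-- Fatou's lemma carries the smooth estimate over from the mollifications, whose Dirichlet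
integrals do not exceed that of `u`. -/
theorem lintegral_translate_le (u : H1) (h : R3) :
    ∫⁻ x, ‖u.fn (x - h) - u.fn x‖ₑ ^ (2 : ℝ)
      ≤ ‖h‖ₑ ^ (2 : ℝ) * ENNReal.ofReal (gradSq u) := by
  have hlim : ∀ᵐ x, Tendsto (fun n => ‖mollify (stdBump n) u.fn (x - h)
      - mollify (stdBump n) u.fn x‖ₑ ^ (2 : ℝ)) atTop
      (𝓝 (‖u.fn (x - h) - u.fn x‖ₑ ^ (2 : ℝ))) := by
    filter_upwards [ae_tendsto_mollify u, ae_sub_right (ae_tendsto_mollify u) h] with x h1 h2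
    exact (ENNReal.continuous_rpow_const.tendsto _).comp (h2.sub h1).enorm
  calc ∫⁻ x, ‖u.fn (x - h) - u.fn x‖ₑ ^ (2 : ℝ)
      = ∫⁻ x, liminf (fun n => ‖mollify (stdBump n) u.fn (x - h)
        - mollify (stdBump n) u.fn x‖ₑ ^ (2 : ℝ)) atTop :=
        lintegral_congr_ae (hlim.mono fun x hx => hx.liminf_eq.symm)
    _ ≤ liminf (fun n => ∫⁻ x, ‖mollify (stdBump n) u.fn (x - h)
        - mollify (stdBump n) u.fn x‖ₑ ^ (2 : ℝ)) atTop := by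
        refine lintegral_liminf_le fun n => ?_
        have := (contDiff_mollify (stdBump n) u).continuous
        exact (by fun_prop : Continuous fun x => mollify (stdBump n) u.fn (x - h)
          - mollify (stdBump n) u.fn x).enorm.measurable.pow_const _
    _ ≤ _ := by
        refine liminf_le_of_frequently_le' (Frequently.of_forall fun n => ?_)
        refine (lintegral_translate_smooth_le (contDiff_mollify (stdBump n) u) h).trans ?_
        gcongr
        rw [gradSq_eq, ← lintegral_enorm_rpow_two]
        simp only [gradient_mollify, coe_gradL]
        exact lintegral_mollify_rpow_le _ (stronglyMeasurable_grad u) (by norm_num)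

theorem lintegral_mollify_sub_le (φ : ContDiffBump (0 : R3)) (u : H1) :
    ∫⁻ x, ‖mollify φ u.fn x - u.fn x‖ₑ ^ (2 : ℝ) ≤ ENNReal.ofReal (φ.rOut ^ 2 * gradSq u) := by
  refine lintegral_mollify_sub_rpow_le φ (stronglyMeasurable_fn u) (locallyIntegrable_fn u)
    (by norm_num) fun t ht => (lintegral_translate_le u t).trans ?_
  rw [ENNReal.ofReal_mul (by positivity)]
  gcongr
  rw [← ofReal_norm, ENNReal.ofReal_rpow_of_nonneg (norm_nonneg _) (by norm_num)]
  refine ENNReal.ofReal_le_ofReal ?_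
  norm_cast
  gcongr

/-! ### Cutoff functions -/

/-- A fixed smooth function equal to `1` on the unit ball and supported in the ball of radius 2. -/
def unitCutoff : ContDiffBump (0 : R3) := ⟨1, 2, one_pos, one_lt_two⟩

/-- The smooth cutoff equal to `1` on the ball of radius `R` and supported in the ball of radius
`2R`. -/
def ballCutoff (R : ℝ) (x : R3) : ℝ := unitCutoff (R⁻¹ • x)

theorem contDiff_ballCutoff (R : ℝ) : ContDiff ℝ ∞ (ballCutoff R) :=
  unitCutoff.contDiff.comp (contDiff_const_smul _)

theorem ballCutoff_nonneg (R : ℝ) (x : R3) : 0 ≤ ballCutoff R x := unitCutoff.nonneg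

theorem ballCutoff_le_one (R : ℝ) (x : R3) : ballCutoff R x ≤ 1 := unitCutoff.le_one

theorem ballCutoff_eq_one {R : ℝ} (hR : 0 < R) {x : R3} (hx : ‖x‖ ≤ R) : ballCutoff R x = 1 := by
  refine unitCutoff.one_of_mem_closedBall ?_
  rw [mem_closedBall_zero_iff, norm_smul, norm_inv, Real.norm_of_nonneg hR.le,
    inv_mul_le_iff₀ hR]
  simpa [unitCutoff] using hx

theorem ballCutoff_eq_zero {R : ℝ} (hR : 0 < R) {x : R3} (hx : 2 * R ≤ ‖x‖) :
    ballCutoff R x = 0 := by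
  refine unitCutoff.zero_of_le_dist ?_
  rw [dist_zero_right, norm_smul, norm_inv, Real.norm_of_nonneg hR.le, le_inv_mul_iff₀ hR]
  simpa [unitCutoff, mul_comm] using hx

theorem hasCompactSupport_ballCutoff {R : ℝ} (hR : 0 < R) : HasCompactSupport (ballCutoff R) :=
  unitCutoff.hasCompactSupport.comp_homeomorph (Homeomorph.smulOfNeZero R⁻¹ (inv_ne_zero hR.ne'))

theorem exists_norm_gradient_ballCutoff_le :
    ∃ C : ℝ, 0 < C ∧ ∀ R : ℝ, 0 < R → ∀ x, ‖gradient (ballCutoff R) x‖ ≤ C / R := by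
  obtain ⟨C, hC⟩ := exists_bound_of_compactSupport
    ((unitCutoff.contDiff (n := ⊤)).continuous_fderiv (by simp))
    (unitCutoff.hasCompactSupport.fderiv ℝ)
  refine ⟨|C| + 1, by positivity, fun R hR x => ?_⟩
  rw [norm_gradient]
  have : fderiv ℝ (ballCutoff R) x = R⁻¹ • fderiv ℝ unitCutoff (R⁻¹ • x) :=
    fderiv_comp_smul R⁻¹
  rw [this, norm_smul, norm_inv, Real.norm_of_nonneg hR.le, div_eq_inv_mul]
  gcongr
  linarith [hC (R⁻¹ • x), le_abs_self C]

theorem gradient_ballCutoff_eq_zero {R : ℝ} (hR : 0 < R) {x : R3} (hx : 2 * R < ‖x‖) :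
    gradient (ballCutoff R) x = 0 := by
  have : ballCutoff R =ᶠ[𝓝 x] fun _ => 0 := by
    filter_upwards [(isOpen_lt continuous_const continuous_norm).mem_nhds hx] with z hz
    exact ballCutoff_eq_zero hR (le_of_lt hz)
  rw [this.gradient.eq_of_nhds]
  simp

/-! ### The Sobolev inequality -/

theorem eLpNorm_two_eq {E : Type*} [NormedAddCommGroup E] (f : R3 → E) :
    eLpNorm f 2 volume = (∫⁻ x, ‖f x‖ₑ ^ (2 : ℝ)) ^ (1 / 2 : ℝ) := by
  rw [eLpNorm_eq_lintegral_rpow_enorm_toReal (by norm_num) (by norm_num)]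
  simp

theorem eLpNorm_mollify_le {E : Type*} [NormedAddCommGroup E] [NormedSpace ℝ E]
    (φ : ContDiffBump (0 : R3)) {f : R3 → E}
    (hf : StronglyMeasurable f) : eLpNorm (mollify φ f) 2 volume ≤ eLpNorm f 2 volume := by
  rw [eLpNorm_two_eq, eLpNorm_two_eq]
  exact ENNReal.rpow_le_rpow (lintegral_mollify_rpow_le φ hf one_le_two) (by norm_num)

theorem eLpNorm_fn (u : H1) : eLpNorm u.fn 2 volume = ENNReal.ofReal ‖toL2 u‖ := by
  rw [Lp.norm_def, ENNReal.ofReal_toReal (Lp.eLpNorm_ne_top _)]; rfl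

theorem eLpNorm_grad (u : H1) : eLpNorm u.grad 2 volume = ENNReal.ofReal ‖gradL u‖ := by
  rw [Lp.norm_def, ENNReal.ofReal_toReal (Lp.eLpNorm_ne_top _)]; rfl

/-- The inequality for compactly supported smooth functions is applied to cut-off mollifications.
The gradient of the cutoff costs only `C/(n+1)·|u|₂`, which disappears in the limit, and Fatou's
lemma handles the left side. -/
theorem exists_sobolev_const : ∃ K : ℝ, 0 ≤ K ∧ ∀ u : H1,
    eLpNorm u.fn 6 volume ≤ ENNReal.ofReal (K * ‖gradL u‖) := by
  obtain ⟨C, hC, hgrad⟩ := exists_norm_gradient_ballCutoff_le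
  let K := SNormLESNormFDerivOfEqConst ℝ (volume : Measure R3) 2
  refine ⟨K, NNReal.coe_nonneg _, fun u => ?_⟩
  let f : ℕ → R3 → ℝ := fun n x => ballCutoff (n + 1) x * mollify (stdBump n) u.fn x
  have hpos : ∀ n : ℕ, (0 : ℝ) < n + 1 := fun n => by positivity
  have hm : ∀ n, ContDiff ℝ ∞ (mollify (stdBump n) u.fn) := fun n => contDiff_mollify _ u
  have hf : ∀ n, ContDiff ℝ ∞ (f n) := fun n => (contDiff_ballCutoff _).mul (hm n)
  have hfc : ∀ n, HasCompactSupport (f n) := fun n =>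
    (hasCompactSupport_ballCutoff (hpos n)).mul_right
  have hlim : ∀ᵐ x, Tendsto (fun n => f n x) atTop (𝓝 (u.fn x)) := by
    filter_upwards [ae_tendsto_mollify u] with x hx
    refine hx.congr' ?_
    filter_upwards [eventually_ge_atTop ⌈‖x‖⌉₊] with n hn
    have : ‖x‖ ≤ n + 1 := (Nat.le_ceil _).trans (by
      have : ((⌈‖x‖⌉₊ : ℕ) : ℝ) ≤ n := by exact_mod_cast hn
      linarith)
    simp only [f, ballCutoff_eq_one (hpos n) this, one_mul]
  have hbound : ∀ n : ℕ, eLpNorm (f n) 6 volume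
      ≤ ENNReal.ofReal (K * (‖gradL u‖ + C / (n + 1) * ‖toL2 u‖)) := by
    intro n
    have h1 := eLpNorm_le_eLpNorm_fderiv_of_eq (volume : Measure R3) (F := ℝ)
      (u := f n) (p := 2) (p' := 6) ((hf n).of_le (by simp)) (hfc n) (by norm_num) (by simp)
      (by simp; norm_num)
    have h2 : eLpNorm (fderiv ℝ (f n)) 2 volume
        ≤ ENNReal.ofReal (‖gradL u‖ + C / (n + 1) * ‖toL2 u‖) := by
      have h3 : ∀ x, ‖fderiv ℝ (f n) x‖ ≤ ‖(fun x => ‖mollify (stdBump n) u.grad x‖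
          + (C / (n + 1)) • ‖mollify (stdBump n) u.fn x‖) x‖ := by
        intro x
        rw [Real.norm_of_nonneg (by positivity)]
        simp only [f]
        rw [fderiv_fun_mul ((contDiff_ballCutoff _).differentiable (by simp) x)
          ((hm n).differentiable (by simp) x)]
        refine (norm_add_le _ _).trans ?_
        rw [norm_smul, norm_smul, ← norm_gradient, ← norm_gradient, gradient_mollify,
          smul_eq_mul, mul_comm (C / (n + 1))]
        refine add_le_add ?_ (mul_le_mul_of_nonneg_left (hgrad _ (hpos n) x) (norm_nonneg _))
        rw [Real.norm_of_nonneg (ballCutoff_nonneg _ _)]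
        exact mul_le_of_le_one_left (norm_nonneg _) (ballCutoff_le_one _ _)
      have hmg : Continuous (mollify (stdBump n) u.grad) := by
        have := continuous_gradient (hm n)
        rwa [show gradient (mollify (stdBump n) u.fn) = mollify (stdBump n) u.grad from
          funext (gradient_mollify (stdBump n) u)] at this
      refine (eLpNorm_mono h3).trans ?_
      refine (eLpNorm_add_le hmg.norm.aestronglyMeasurable
        ((hm n).continuous.norm.const_smul (C / (n + 1 : ℝ))).aestronglyMeasurable
        (by norm_num)).trans ?_
      rw [ENNReal.ofReal_add (norm_nonneg _) (by positivity), ENNReal.ofReal_mul (by positivity),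
        ← eLpNorm_fn, ← eLpNorm_grad]
      refine add_le_add ?_ ?_
      · rw [eLpNorm_norm]
        exact eLpNorm_mollify_le _ (stronglyMeasurable_grad u)
      · refine (eLpNorm_const_smul_le (c := C / (n + 1 : ℝ))
          (f := fun x => ‖mollify (stdBump n) u.fn x‖)).trans ?_
        rw [eLpNorm_norm, ← ofReal_norm, Real.norm_of_nonneg (by positivity)]
        gcongr
        exact eLpNorm_mollify_le _ (stronglyMeasurable_fn u)
    rw [ENNReal.ofReal_mul (NNReal.coe_nonneg _), ENNReal.ofReal_coe_nnreal]
    exact h1.trans (mul_le_mul_right h2 _)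
  have hfat := Lp.eLpNorm_lim_le_liminf_eLpNorm (p := 6) (μ := volume)
    (fun n => (hf n).continuous.aestronglyMeasurable) u.fn hlim
  refine hfat.trans ?_
  have hT : Tendsto (fun n : ℕ => ENNReal.ofReal (K * (‖gradL u‖ + C / (n + 1) * ‖toL2 u‖)))
      atTop (𝓝 (ENNReal.ofReal (K * ‖gradL u‖))) := by
    refine (ENNReal.continuous_ofReal.tendsto _).comp ?_
    have h0 : Tendsto (fun n : ℕ => C / (n + 1 : ℝ)) atTop (𝓝 0) := by
      simpa [div_eq_mul_inv] using
        (tendsto_one_div_add_atTop_nhds_zero_nat (𝕜 := ℝ)).const_mul C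
    simpa using (((h0.mul_const ‖toL2 u‖).const_add ‖gradL u‖).const_mul (K : ℝ))
  rw [← hT.liminf_eq]
  exact liminf_le_liminf (.of_forall hbound)

/-! ### Elementary inequalities for powers -/

/-- The cases are `s ≤ κ` and `s ≥ κ`. The free threshold is the point: for `q < 6` a large `κ`
makes the critical term small. -/
theorem rpow_le_interpolation {q κ s : ℝ} (hq : 2 ≤ q) (hq6 : q ≤ 6) (hκ : 0 < κ) (hs : 0 ≤ s) :
    s ^ q ≤ κ ^ (q - 2) * s ^ (2 : ℝ) + κ ^ (q - 6) * s ^ (6 : ℝ) := by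
  rcases hs.eq_or_lt with rfl | hs
  · rw [Real.zero_rpow (by linarith)]; positivity
  rcases le_total s κ with h | h
  · have h1 : s ^ q = s ^ (q - 2) * s ^ (2 : ℝ) := by rw [← Real.rpow_add hs]; ring_nf
    have h2 : s ^ (q - 2) ≤ κ ^ (q - 2) := Real.rpow_le_rpow hs.le h (by linarith)
    rw [h1]
    have : 0 ≤ κ ^ (q - 6) * s ^ (6 : ℝ) := by positivity
    have := mul_le_mul_of_nonneg_right h2 (by positivity : 0 ≤ s ^ (2 : ℝ))
    linarith
  · have h1 : s ^ q = s ^ (q - 6) * s ^ (6 : ℝ) := by rw [← Real.rpow_add hs]; ring_nf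
    have h2 : s ^ (q - 6) ≤ κ ^ (q - 6) := Real.rpow_le_rpow_of_nonpos hκ h (by linarith)
    rw [h1]
    have : 0 ≤ κ ^ (q - 2) * s ^ (2 : ℝ) := by positivity
    have := mul_le_mul_of_nonneg_right h2 (by positivity : 0 ≤ s ^ (6 : ℝ))
    linarith

/-- A form of Young's inequality with an explicit weight: whichever of `b` and `ηa` is larger
controls the product. -/
theorem rpow_mul_rpow_le {α β η a b : ℝ} (hα : 0 < α) (hβ : 0 < β) (hη : 0 < η) (ha : 0 ≤ a)
    (hb : 0 ≤ b) :
    a ^ α * b ^ β ≤ η ^ β * a ^ (α + β) + η ^ (-α) * b ^ (α + β) := by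
  rcases le_total b (η * a) with h | h
  · have h1 : b ^ β ≤ η ^ β * a ^ β := by
      rw [← Real.mul_rpow hη.le ha]; exact Real.rpow_le_rpow hb h hβ.le
    have h2 : a ^ α * b ^ β ≤ η ^ β * a ^ (α + β) := by
      rw [Real.rpow_add_of_nonneg ha hα.le hβ.le]
      calc a ^ α * b ^ β ≤ a ^ α * (η ^ β * a ^ β) := by gcongr
        _ = _ := by ring
    have : 0 ≤ η ^ (-α) * b ^ (α + β) := by positivity
    linarith
  · have h0 : a ≤ η⁻¹ * b := by rwa [le_inv_mul_iff₀ hη]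
    have h1 : a ^ α ≤ η ^ (-α) * b ^ α := by
      rw [Real.rpow_neg hη.le, ← Real.inv_rpow hη.le, ← Real.mul_rpow (by positivity) hb]
      exact Real.rpow_le_rpow ha h0 hα.le
    have h2 : a ^ α * b ^ β ≤ η ^ (-α) * b ^ (α + β) := by
      rw [Real.rpow_add_of_nonneg hb hα.le hβ.le]
      calc a ^ α * b ^ β ≤ (η ^ (-α) * b ^ α) * b ^ β := by gcongr
        _ = _ := by ring
    have : 0 ≤ η ^ β * a ^ (α + β) := by positivity
    linarith

theorem exists_rpow_mul_rpow_le {α β ε : ℝ} (hα : 0 < α) (hβ : 0 < β) (hε : 0 < ε) :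
    ∃ C : ℝ, 0 < C ∧ ∀ a b : ℝ, 0 ≤ a → 0 ≤ b →
      a ^ α * b ^ β ≤ ε * a ^ (α + β) + C * b ^ (α + β) := by
  refine ⟨(ε ^ (1 / β)) ^ (-α), by positivity, fun a b ha hb => ?_⟩
  have := rpow_mul_rpow_le hα hβ (by positivity : 0 < ε ^ (1 / β)) ha hb
  rwa [← Real.rpow_mul hε.le, one_div_mul_cancel hβ.ne', Real.rpow_one] at this

theorem exists_rpow_mul_rpow_le' {α β ε : ℝ} (hα : 0 < α) (hβ : 0 < β) (hε : 0 < ε) :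
    ∃ C : ℝ, 0 < C ∧ ∀ a b : ℝ, 0 ≤ a → 0 ≤ b →
      a ^ α * b ^ β ≤ C * a ^ (α + β) + ε * b ^ (α + β) := by
  obtain ⟨C, hC, h⟩ := exists_rpow_mul_rpow_le hβ hα hε
  refine ⟨C, hC, fun a b ha hb => ?_⟩
  have := h b a hb ha
  rw [add_comm β α] at this
  linarith [mul_comm (a ^ α) (b ^ β)]

theorem add_rpow_le {x y r : ℝ} (hx : 0 ≤ x) (hy : 0 ≤ y) (hr : 0 ≤ r) :
    (x + y) ^ r ≤ 2 ^ r * (x ^ r + y ^ r) := by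
  have h1 : (x + y) ^ r ≤ (2 * max x y) ^ r :=
    Real.rpow_le_rpow (by positivity) (by linarith [le_max_left x y, le_max_right x y]) hr
  rw [Real.mul_rpow (by norm_num) (by positivity)] at h1
  refine h1.trans (mul_le_mul_of_nonneg_left ?_ (by positivity))
  have := Real.rpow_nonneg hx r
  have := Real.rpow_nonneg hy r
  rcases max_choice x y with h | h <;> rw [h] <;> linarith

/-! ### Integrability of powers -/

theorem integrable_rpow_of_lintegral_le {f : R3 → ℝ} (hf : AEStronglyMeasurable f volume) {q C : ℝ}
    (hq : 0 < q) (hC : 0 ≤ C) (h : ∫⁻ x, ‖f x‖ₑ ^ q ≤ ENNReal.ofReal C) :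
    Integrable (fun x => |f x| ^ q) ∧ ∫ x, |f x| ^ q ≤ C := by
  have he : ∀ x, ‖f x‖ₑ ^ q = ENNReal.ofReal (|f x| ^ q) := fun x => by
    rw [← ofReal_norm, ENNReal.ofReal_rpow_of_nonneg (norm_nonneg _) hq.le, Real.norm_eq_abs]
  simp only [he] at h
  have hm : AEStronglyMeasurable (fun x => |f x| ^ q) volume :=
    ((hf.aemeasurable.abs).pow_const q).aestronglyMeasurable
  constructor
  · refine ⟨hm, ?_⟩
    rw [hasFiniteIntegral_iff_ofReal (.of_forall fun x => by positivity)]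
    exact h.trans_lt ENNReal.ofReal_lt_top
  · rw [integral_eq_lintegral_of_nonneg_ae (.of_forall fun x => by positivity) hm]
    exact ENNReal.toReal_le_of_le_ofReal hC h

theorem integrable_abs_fn_rpow_two (u : H1) : Integrable (fun x => |u.fn x| ^ (2 : ℝ)) :=
  (integrable_rpow_of_lintegral_le (memLp_fn u).1 (by norm_num) (sq_nonneg ‖toL2 u‖)
    (lintegral_enorm_rpow_two (toL2 u)).le).1

theorem exists_powInt_six_le : ∃ K : ℝ, 0 < K ∧ ∀ u : H1,
    Integrable (fun x => |u.fn x| ^ (6 : ℝ)) ∧ powInt 6 u ≤ K * ‖gradL u‖ ^ 6 := by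
  obtain ⟨K, hK, h⟩ := exists_sobolev_const
  refine ⟨K ^ 6 + 1, by positivity, fun u => ?_⟩
  have h1 := h u
  rw [eLpNorm_eq_lintegral_rpow_enorm_toReal (by norm_num) (by norm_num)] at h1
  have h2 := ENNReal.rpow_le_rpow h1 (by norm_num : (0 : ℝ) ≤ 6)
  rw [← ENNReal.rpow_mul] at h2
  norm_num at h2
  have h3 : ∫⁻ x, ‖u.fn x‖ₑ ^ (6 : ℝ) ≤ ENNReal.ofReal ((K * ‖gradL u‖) ^ 6) := by
    rw [ENNReal.ofReal_pow (by positivity)]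
    norm_num
    exact h2
  obtain ⟨h4, h5⟩ := integrable_rpow_of_lintegral_le (memLp_fn u).1 (by norm_num) (by positivity) h3
  refine ⟨h4, h5.trans ?_⟩
  rw [mul_pow]
  gcongr
  linarith

theorem integrable_abs_fn_rpow {q : ℝ} (hq : 2 ≤ q) (hq6 : q ≤ 6) (u : H1) :
    Integrable (fun x => |u.fn x| ^ q) := by
  obtain ⟨K, -, hK⟩ := exists_powInt_six_le
  have h := (integrable_abs_fn_rpow_two u).add (hK u).1
  refine h.mono' (((stronglyMeasurable_fn u).measurable.abs).pow_const q).aestronglyMeasurable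
    (.of_forall fun x => ?_)
  have := rpow_le_interpolation hq hq6 one_pos (abs_nonneg (u.fn x))
  simp only [Real.one_rpow, one_mul] at this
  rw [Real.norm_of_nonneg (by positivity)]
  exact this

theorem powInt_nonneg (q : ℝ) (u : H1) : 0 ≤ powInt q u := integral_nonneg fun x => by positivity

theorem powInt_le_interpolation {q κ : ℝ} (hq : 2 ≤ q) (hq6 : q ≤ 6) (hκ : 0 < κ) (u : H1) :
    powInt q u ≤ κ ^ (q - 2) * powInt 2 u + κ ^ (q - 6) * powInt 6 u := by
  unfold powInt
  rw [← integral_const_mul, ← integral_const_mul, ← integral_add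
    ((integrable_abs_fn_rpow_two u).const_mul _)
    ((integrable_abs_fn_rpow (by norm_num) le_rfl u).const_mul _)]
  exact integral_mono (integrable_abs_fn_rpow hq hq6 u)
    (((integrable_abs_fn_rpow_two u).const_mul _).add
      ((integrable_abs_fn_rpow (by norm_num) le_rfl u).const_mul _))
    fun x => rpow_le_interpolation hq hq6 hκ (abs_nonneg _)

/-- Interpolation at the threshold `κ = ‖u‖` makes both terms multiples of `‖u‖^q`. -/
theorem exists_powInt_le {q : ℝ} (hq : 2 ≤ q) (hq6 : q ≤ 6) :
    ∃ C : ℝ, 0 < C ∧ ∀ u : H1, powInt q u ≤ C * ‖u‖ ^ q := by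
  obtain ⟨K, hK0, hK⟩ := exists_powInt_six_le
  refine ⟨1 + K, by positivity, fun u => ?_⟩
  rcases eq_or_ne u 0 with rfl | hu
  · have h0 : powInt q 0 = 0 := by
      unfold powInt
      rw [integral_eq_zero_of_ae]
      have : ((0 : H1).fn) =ᵐ[volume] 0 := Lp.coeFn_zero ℝ 2 volume
      filter_upwards [this] with x hx
      rw [hx]
      simp [Real.zero_rpow (by linarith : q ≠ 0)]
    rw [h0]; positivity
  have hn : 0 < ‖u‖ := norm_pos_iff.2 hu
  have h1 := powInt_le_interpolation hq hq6 hn u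
  have h2 : powInt 2 u ≤ ‖u‖ ^ (2 : ℝ) := by
    rw [powInt_two]
    norm_cast
    exact pow_le_pow_left₀ (norm_nonneg _) (norm_toL2_le u) 2
  have h3 : powInt 6 u ≤ K * ‖u‖ ^ (6 : ℝ) := by
    refine (hK u).2.trans ?_
    norm_cast
    gcongr
    exact norm_gradL_le u
  have e1 : ‖u‖ ^ (q - 2) * ‖u‖ ^ (2 : ℝ) = ‖u‖ ^ q := by rw [← Real.rpow_add hn]; ring_nf
  have e2 : ‖u‖ ^ (q - 6) * ‖u‖ ^ (6 : ℝ) = ‖u‖ ^ q := by rw [← Real.rpow_add hn]; ring_nf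
  calc powInt q u ≤ ‖u‖ ^ (q - 2) * ‖u‖ ^ (2 : ℝ) + ‖u‖ ^ (q - 6) * (K * ‖u‖ ^ (6 : ℝ)) := by
        refine h1.trans ?_; gcongr
    _ = ‖u‖ ^ (q - 2) * ‖u‖ ^ (2 : ℝ) + K * (‖u‖ ^ (q - 6) * ‖u‖ ^ (6 : ℝ)) := by ring
    _ = (1 + K) * ‖u‖ ^ q := by rw [e1, e2]; ring

/-! ### Local convergence -/

/-- If `v n` is bounded in `L^(α+β)` and tends to zero in `L^(α+β)` on bounded sets, then the
mixed integrals of `(v n)^α g^β` tend to zero. -/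
theorem tendsto_integral_rpow_mul_rpow {α β : ℝ} (hα : 0 < α) (hβ : 0 < β) {v : ℕ → R3 → ℝ}
    {g : R3 → ℝ} (hv0 : ∀ n x, 0 ≤ v n x) (hg0 : ∀ x, 0 ≤ g x)
    (hvi : ∀ n, Integrable (fun x => v n x ^ (α + β))) (hgi : Integrable (fun x => g x ^ (α + β)))
    {B : ℝ} (hB : ∀ n, ∫ x, v n x ^ (α + β) ≤ B)
    (hloc : ∀ R : ℝ, Tendsto (fun n => ∫ x in Metric.closedBall 0 R, v n x ^ (α + β)) atTop (𝓝 0)) :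
    Tendsto (fun n => ∫ x, v n x ^ α * g x ^ β) atTop (𝓝 0) := by
  have hB0 : 0 ≤ B := (integral_nonneg fun x => by have := hv0 0 x; positivity).trans (hB 0)
  set G := ∫ x, g x ^ (α + β) with hG
  have hG0 : 0 ≤ G := integral_nonneg fun x => by have := hg0 x; positivity
  rw [Metric.tendsto_atTop]
  intro ε hε
  -- Outside a large ball the small weight goes on `v`, because the tail of `g` is small there;
  -- inside, it goes on `g`, because `v` is small there. Each of the four resulting terms costs at
  -- most `ε/4`.
  obtain ⟨C, hC, hyoung⟩ := exists_rpow_mul_rpow_le hα hβ (by positivity : 0 < ε / (4 * (B + 1)))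
  obtain ⟨C', hC', hyoung'⟩ :=
    exists_rpow_mul_rpow_le' hα hβ (by positivity : 0 < ε / (4 * (G + 1)))
  have htail : ∃ R : ℝ, ∫ x in (Metric.closedBall (0 : R3) R)ᶜ, g x ^ (α + β) < ε / (4 * C) := by
    have h1 : Tendsto (fun R : ℝ => ∫ x in Metric.closedBall (0 : R3) R, g x ^ (α + β)) atTop
        (𝓝 G) := (aecover_closedBall tendsto_id).integral_tendsto_of_countably_generated hgi
    obtain ⟨R, hR⟩ := ((tendsto_order.1 h1).1 (G - ε / (4 * C)) (by
      have : 0 < ε / (4 * C) := by positivity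
      linarith)).exists
    refine ⟨R, ?_⟩
    have := integral_add_compl (Metric.isClosed_closedBall (x := (0 : R3)) (ε := R)).measurableSet
      hgi
    linarith
  obtain ⟨R, hR⟩ := htail
  obtain ⟨n₀, hn₀⟩ := Metric.tendsto_atTop.1 (hloc R) (ε / (4 * C')) (by positivity)
  refine ⟨n₀, fun n hn => ?_⟩
  set S := Metric.closedBall (0 : R3) R
  have hS : MeasurableSet S := Metric.isClosed_closedBall.measurableSet
  have hint0 : 0 ≤ ∫ x, v n x ^ α * g x ^ β :=
    integral_nonneg fun x => by have := hv0 n x; have := hg0 x; positivity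
  rw [Real.dist_0_eq_abs, abs_of_nonneg hint0]
  have hSn : ∫ x in S, v n x ^ (α + β) < ε / (4 * C') := by
    have := hn₀ n hn
    rw [Real.dist_0_eq_abs] at this
    exact (le_abs_self _).trans_lt this
  have hbound : ∫ x, v n x ^ α * g x ^ β ≤ ∫ x, (S.indicator (fun x => C' * v n x ^ (α + β)) x
      + ε / (4 * (G + 1)) * g x ^ (α + β) + ε / (4 * (B + 1)) * v n x ^ (α + β)
      + Sᶜ.indicator (fun x => C * g x ^ (α + β)) x) := by
    refine integral_mono_of_nonneg
      (.of_forall fun x => by have := hv0 n x; have := hg0 x; positivity)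
      (((((hvi n).const_mul C').indicator hS).add (hgi.const_mul _)).add
        ((hvi n).const_mul _) |>.add ((hgi.const_mul C).indicator hS.compl))
      (.of_forall fun x => ?_)
    have hv := hv0 n x
    have hg := hg0 x
    have p1 : 0 ≤ ε / (4 * (G + 1)) * g x ^ (α + β) := by positivity
    have p2 : 0 ≤ ε / (4 * (B + 1)) * v n x ^ (α + β) := by positivity
    by_cases hx : x ∈ S
    · simp only [Set.indicator_of_mem hx, Set.indicator_of_notMem (Set.notMem_compl_iff.2 hx)]
      linarith [hyoung' _ _ hv hg]
    · simp only [Set.indicator_of_notMem hx, Set.indicator_of_mem (Set.mem_compl hx)]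
      linarith [hyoung _ _ hv hg]
  rw [integral_add _ ((hgi.const_mul C).indicator hS.compl), integral_add _ ((hvi n).const_mul _),
    integral_add (((hvi n).const_mul C').indicator hS) (hgi.const_mul _),
    integral_indicator hS, integral_indicator hS.compl, integral_const_mul, integral_const_mul,
    integral_const_mul, integral_const_mul] at hbound
  rotate_left
  · exact (((hvi n).const_mul C').indicator hS).add (hgi.const_mul _)
  · exact ((((hvi n).const_mul C').indicator hS).add (hgi.const_mul _)).add ((hvi n).const_mul _)
  have b1 : C' * ∫ x in S, v n x ^ (α + β) < ε / 4 := by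
    calc _ < C' * (ε / (4 * C')) := by gcongr
      _ = _ := by field_simp
  have b2 : ε / (4 * (G + 1)) * G ≤ ε / 4 := by
    calc _ ≤ ε / (4 * (G + 1)) * (G + 1) := by gcongr; linarith
      _ = _ := by field_simp
  have b3 : ε / (4 * (B + 1)) * ∫ x, v n x ^ (α + β) ≤ ε / 4 := by
    calc _ ≤ ε / (4 * (B + 1)) * (B + 1) := by gcongr; linarith [hB n]
      _ = _ := by field_simp
  have b4 : C * ∫ x in Sᶜ, g x ^ (α + β) < ε / 4 := by
    calc _ < C * (ε / (4 * C)) := by gcongr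
      _ = _ := by field_simp
  linarith

/-! ### Mollification under weak convergence and Rellich's theorem. -/

/-- The normalised bump function as an element of `H¹`. -/
def bumpH1 (φ : ContDiffBump (0 : R3)) : H1 :=
  H1.ofTest (φ.contDiff_normed (μ := volume) (n := ⊤)) φ.hasCompactSupport_normed

/-- The bump is even, so point values of a mollification are `L²` pairings. Weak convergence
therefore gives pointwise convergence of mollifications. -/
theorem mollify_eq_inner (φ : ContDiffBump (0 : R3)) (u : H1) (x : R3) :
    mollify φ u.fn x = inner ℝ (toL2 (translateL (-x) u)) (toL2 (bumpH1 φ)) := by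
  rw [← integral_fn_mul]
  have e1 : mollify φ u.fn x = ∫ t, φ.normed volume t * u.fn (t + x) := by
    unfold mollify
    rw [← integral_neg_eq_self]
    exact integral_congr_ae (.of_forall fun t => by
      simp only [φ.normed_neg, smul_eq_mul]; congr 2; abel)
  rw [e1]
  refine integral_congr_ae ?_
  filter_upwards [fn_translateL (-x) u, H1.fn_ofTest (φ.contDiff_normed (μ := volume) (n := ⊤))
    φ.hasCompactSupport_normed] with t h1 h2
  rw [h1, bumpH1, h2, sub_neg_eq_add, mul_comm]

theorem abs_mollify_le (φ : ContDiffBump (0 : R3)) (u : H1) (x : R3) :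
    |mollify φ u.fn x| ≤ ‖u‖ * ‖bumpH1 φ‖ := by
  rw [mollify_eq_inner]
  refine (abs_real_inner_le_norm _ _).trans ?_
  have := norm_toL2_le (translateL (-x) u)
  rw [LinearIsometry.norm_map] at this
  exact mul_le_mul this (norm_toL2_le _) (norm_nonneg _) (norm_nonneg _)

theorem WeaklyTendsto.inner_toL2 {v : ℕ → H1} {v₀ : H1} (h : WeaklyTendsto v v₀) (ψ : H1) :
    Tendsto (fun n => inner ℝ (toL2 (v n)) (toL2 ψ)) atTop (𝓝 (inner ℝ (toL2 v₀) (toL2 ψ))) :=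
  weaklyTendsto_iff.1 (h.map toL2) (toL2 ψ)

theorem WeaklyTendsto.inner_gradL {v : ℕ → H1} {v₀ : H1} (h : WeaklyTendsto v v₀) (ψ : H1) :
    Tendsto (fun n => inner ℝ (gradL (v n)) (gradL ψ)) atTop
      (𝓝 (inner ℝ (gradL v₀) (gradL ψ))) :=
  weaklyTendsto_iff.1 (h.map gradL) (gradL ψ)

theorem WeaklyTendsto.mollify {v : ℕ → H1} {v₀ : H1} (h : WeaklyTendsto v v₀)
    (φ : ContDiffBump (0 : R3)) (x : R3) :
    Tendsto (fun n => mollify φ (v n).fn x) atTop (𝓝 (mollify φ v₀.fn x)) := by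
  simp only [mollify_eq_inner]
  exact (h.map (translateL (-x)).toContinuousLinearMap).inner_toL2 _

theorem integrable_abs_mollify_sub (φ : ContDiffBump (0 : R3)) (u : H1) :
    Integrable (fun x => |Kirchhoff.mollify φ u.fn x - u.fn x| ^ (2 : ℝ)) ∧
      ∫ x, |Kirchhoff.mollify φ u.fn x - u.fn x| ^ (2 : ℝ) ≤ φ.rOut ^ 2 * gradSq u := by
  refine integrable_rpow_of_lintegral_le ?_ (by norm_num) ?_ (lintegral_mollify_sub_le φ u)
  · exact (contDiff_mollify φ u).continuous.aestronglyMeasurable.sub (memLp_fn u).1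
  · rw [gradSq_eq]; positivity

theorem gradSq_le (u : H1) : gradSq u ≤ ‖u‖ ^ 2 := by
  rw [gradSq_eq]; gcongr; exact norm_gradL_le u

theorem exists_stdBump_rOut_lt {ε : ℝ} (hε : 0 < ε) : ∃ k, (stdBump k).rOut ^ 2 < ε := by
  have : Tendsto (fun k => (stdBump k).rOut ^ 2) atTop (𝓝 0) := by
    simpa using tendsto_stdBump_rOut.pow 2
  exact ((tendsto_order.1 this).2 ε hε).exists

/-- Rellich's theorem on balls. -/
theorem WeaklyTendsto.tendsto_setIntegral_sq {v : ℕ → H1} (h : WeaklyTendsto v 0) (R : ℝ) :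
    Tendsto (fun n => ∫ x in Metric.closedBall 0 R, |(v n).fn x| ^ (2 : ℝ)) atTop (𝓝 0) := by
  obtain ⟨M, hM⟩ := h.bounded
  have hM0 : 0 ≤ M := (norm_nonneg _).trans (hM 0)
  set S := Metric.closedBall (0 : R3) R
  have hfin : volume S < ⊤ := measure_closedBall_lt_top
  rw [Metric.tendsto_atTop]
  intro ε hε
  -- The mollifier is fixed first: its squared error is at most `rOut²∫|Dv_n|²`, hence small
  -- uniformly in `n`. For that mollifier, dominated convergence on the ball finishes.
  obtain ⟨k, hk⟩ := exists_stdBump_rOut_lt (by positivity : 0 < ε / (4 * (M ^ 2 + 1)))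
  set φ := stdBump k
  have hφ0 : ∀ x, Kirchhoff.mollify φ (0 : H1).fn x = 0 := fun x => by
    rw [mollify_eq_inner]; simp
  have hlim : Tendsto (fun n => ∫ x in S, |Kirchhoff.mollify φ (v n).fn x| ^ (2 : ℝ)) atTop
      (𝓝 (∫ x in S, (0 : ℝ))) := by
    refine tendsto_integral_of_dominated_convergence (fun _ => (M * ‖bumpH1 φ‖) ^ (2 : ℝ))
      (fun n => ?_) ?_ (fun n => ?_) ?_
    · exact (((contDiff_mollify φ (v n)).continuous.abs).measurable.pow_const
        _).aestronglyMeasurable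
    · exact integrableOn_const hfin.ne
    · refine .of_forall fun x => ?_
      rw [Real.norm_of_nonneg (by positivity)]
      refine Real.rpow_le_rpow (abs_nonneg _) ((abs_mollify_le φ (v n) x).trans ?_) (by norm_num)
      exact mul_le_mul_of_nonneg_right (hM n) (norm_nonneg _)
    · refine .of_forall fun x => ?_
      have := (h.mollify φ x).abs.rpow_const (p := 2) (.inr (by norm_num))
      simpa [hφ0] using this
  simp only [integral_zero] at hlim
  obtain ⟨n₀, hn₀⟩ := Metric.tendsto_atTop.1 hlim (ε / 4) (by positivity)
  refine ⟨n₀, fun n hn => ?_⟩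
  have h1 := hn₀ n hn
  rw [Real.dist_0_eq_abs, abs_of_nonneg (integral_nonneg fun x => by positivity)] at h1 ⊢
  have hmi : IntegrableOn (fun x => |Kirchhoff.mollify φ (v n).fn x| ^ (2 : ℝ)) S := by
    refine ContinuousOn.integrableOn_compact (isCompact_closedBall _ _) ?_
    exact (((contDiff_mollify φ (v n)).continuous.abs).rpow_const
      fun _ => .inr (by norm_num)).continuousOn
  obtain ⟨hdi, hd⟩ := integrable_abs_mollify_sub φ (v n)
  have h2 : ∫ x in S, |(v n).fn x| ^ (2 : ℝ)
      ≤ ∫ x in S, (2 * |Kirchhoff.mollify φ (v n).fn x| ^ (2 : ℝ)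
        + 2 * |Kirchhoff.mollify φ (v n).fn x - (v n).fn x| ^ (2 : ℝ)) := by
    refine integral_mono_of_nonneg (.of_forall fun x => by positivity)
      ((hmi.const_mul 2).add (hdi.integrableOn.const_mul 2)) (.of_forall fun x => ?_)
    simp only [Real.rpow_two, sq_abs]
    nlinarith [sq_nonneg (2 * Kirchhoff.mollify φ (v n).fn x - (v n).fn x)]
  rw [integral_add (hmi.const_mul 2) (hdi.integrableOn.const_mul 2), integral_const_mul,
    integral_const_mul] at h2
  have h3 : ∫ x in S, |Kirchhoff.mollify φ (v n).fn x - (v n).fn x| ^ (2 : ℝ) ≤ ε / 4 := by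
    refine (setIntegral_le_integral hdi (.of_forall fun x => by positivity)).trans (hd.trans ?_)
    have : gradSq (v n) ≤ M ^ 2 := (gradSq_le _).trans (by gcongr; exact hM n)
    calc _ ≤ ε / (4 * (M ^ 2 + 1)) * (M ^ 2 + 1) := by
          gcongr
          · rw [gradSq_eq]; positivity
          · linarith
      _ = _ := by field_simp
  linarith

/-- Interpolation between the `L²` convergence on balls and the Sobolev bound in `L⁶`; strict
subcriticality lets `κ` be taken large. -/
theorem WeaklyTendsto.tendsto_setIntegral_rpow {v : ℕ → H1} (h : WeaklyTendsto v 0) {q : ℝ}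
    (hq : 2 ≤ q) (hq6 : q < 6) (R : ℝ) :
    Tendsto (fun n => ∫ x in Metric.closedBall 0 R, |(v n).fn x| ^ q) atTop (𝓝 0) := by
  obtain ⟨M, hM⟩ := h.bounded
  obtain ⟨K, hK0, hK⟩ := exists_powInt_six_le
  have hM0 : 0 ≤ M := (norm_nonneg _).trans (hM 0)
  have h2 := h.tendsto_setIntegral_sq R
  rw [Metric.tendsto_atTop]
  intro ε hε
  have hκ : ∃ κ : ℝ, 0 < κ ∧ κ ^ (q - 6) * (K * M ^ 6) < ε / 2 := by
    have : Tendsto (fun κ : ℝ => κ ^ (q - 6) * (K * M ^ 6)) atTop (𝓝 (0 * (K * M ^ 6))) := by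
      have h0 := (tendsto_rpow_neg_atTop (by linarith : 0 < 6 - q)).mul_const (K * M ^ 6)
      simpa using h0
    rw [zero_mul] at this
    obtain ⟨κ, h1, h2⟩ := (((tendsto_order.1 this).2 (ε / 2) (by positivity)).and
      (eventually_gt_atTop 0)).exists
    exact ⟨κ, h2, h1⟩
  obtain ⟨κ, hκ0, hκ⟩ := hκ
  obtain ⟨n₀, hn₀⟩ := Metric.tendsto_atTop.1 h2 (ε / 2 / κ ^ (q - 2)) (by positivity)
  refine ⟨n₀, fun n hn => ?_⟩
  have h1 := hn₀ n hn
  rw [Real.dist_0_eq_abs, abs_of_nonneg (integral_nonneg fun x => by positivity)] at h1 ⊢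
  set S := Metric.closedBall (0 : R3) R
  have i2 := (integrable_abs_fn_rpow_two (v n)).integrableOn (s := S)
  have i6 := (hK (v n)).1.integrableOn (s := S)
  have h3 : ∫ x in S, |(v n).fn x| ^ q ≤ ∫ x in S, (κ ^ (q - 2) * |(v n).fn x| ^ (2 : ℝ)
      + κ ^ (q - 6) * |(v n).fn x| ^ (6 : ℝ)) :=
    integral_mono_of_nonneg (.of_forall fun x => by positivity)
      ((i2.const_mul _).add (i6.const_mul _))
      (.of_forall fun x => rpow_le_interpolation hq hq6.le hκ0 (abs_nonneg _))
  rw [integral_add (i2.const_mul _) (i6.const_mul _), integral_const_mul, integral_const_mul] at h3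
  have h4 : ∫ x in S, |(v n).fn x| ^ (6 : ℝ) ≤ K * M ^ 6 := by
    refine (setIntegral_le_integral (hK (v n)).1 (.of_forall fun x => by positivity)).trans
      ((hK (v n)).2.trans ?_)
    gcongr
    exact (norm_gradL_le _).trans (hM n)
  have h5 : κ ^ (q - 2) * ∫ x in S, |(v n).fn x| ^ (2 : ℝ) < ε / 2 := by
    rwa [lt_div_iff₀' (by positivity)] at h1
  have h6 : κ ^ (q - 6) * ∫ x in S, |(v n).fn x| ^ (6 : ℝ) ≤ κ ^ (q - 6) * (K * M ^ 6) := by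
    gcongr
  linarith

/-! ### Vanishing and non-vanishing -/

/-- A bounded sequence in `H¹` whose mollifications tend to zero uniformly tends to zero in `L^q`. -/
theorem tendsto_powInt_of_vanishing {v : ℕ → H1} {M : ℝ} (hM : ∀ n, ‖v n‖ ≤ M) {q : ℝ}
    (hq : 2 < q) (hq6 : q < 6)
    (hvan : ∀ k, ∀ δ > 0, ∀ᶠ n in atTop, ∀ x, |mollify (stdBump k) (v n).fn x| ≤ δ) :
    Tendsto (fun n => powInt q (v n)) atTop (𝓝 0) := by
  obtain ⟨K, hK0, hK⟩ := exists_powInt_six_le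
  have hM0 : 0 ≤ M := (norm_nonneg _).trans (hM 0)
  rw [Metric.tendsto_atTop]
  intro ε hε
  have hκ : ∃ κ : ℝ, 0 < κ ∧ κ ^ (q - 6) * (K * M ^ 6) < ε / 3 := by
    have : Tendsto (fun κ : ℝ => κ ^ (q - 6) * (K * M ^ 6)) atTop (𝓝 (0 * (K * M ^ 6))) := by
      have h0 := (tendsto_rpow_neg_atTop (by linarith : 0 < 6 - q)).mul_const (K * M ^ 6)
      simpa using h0
    rw [zero_mul] at this
    obtain ⟨κ, h1, h2⟩ := (((tendsto_order.1 this).2 (ε / 3) (by positivity)).and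
      (eventually_gt_atTop 0)).exists
    exact ⟨κ, h2, h1⟩
  obtain ⟨κ, hκ0, hκ⟩ := hκ
  obtain ⟨k, hk⟩ := exists_stdBump_rOut_lt
    (by positivity : 0 < ε / (3 * (4 * κ ^ (q - 2)) * (M ^ 2 + 1)))
  have hδ : ∃ δ : ℝ, 0 < δ ∧ (2 * δ) ^ (q - 2) * M ^ 2 < ε / 3 := by
    have hc : Tendsto (fun δ : ℝ => (2 * δ) ^ (q - 2) * M ^ 2) (𝓝[>] 0) (𝓝 0) := by
      have : Continuous (fun δ : ℝ => (2 * δ) ^ (q - 2) * M ^ 2) :=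
        ((continuous_const.mul continuous_id).rpow_const fun _ => .inr (by linarith)).mul
          continuous_const
      have h0 := (this.tendsto 0).mono_left (nhdsWithin_le_nhds (s := Set.Ioi 0))
      simpa [Real.zero_rpow (by linarith : q - 2 ≠ 0)] using h0
    obtain ⟨δ, h1, h2⟩ := (((tendsto_order.1 hc).2 (ε / 3) (by positivity)).and
      self_mem_nhdsWithin).exists
    exact ⟨δ, h2, h1⟩
  obtain ⟨δ, hδ0, hδ⟩ := hδ
  obtain ⟨n₀, hn₀⟩ := eventually_atTop.1 (hvan k δ hδ0)
  refine ⟨n₀, fun n hn => ?_⟩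
  rw [Real.dist_0_eq_abs, abs_of_nonneg (powInt_nonneg _ _)]
  set m := mollify (stdBump k) (v n).fn
  obtain ⟨hdi, hd⟩ := integrable_abs_mollify_sub (stdBump k) (v n)
  have i2 := integrable_abs_fn_rpow_two (v n)
  have i6 := (hK (v n)).1
  -- Values above `κ` go into the sixth power. Below `κ`, either the mollification dominates the
  -- error, so `|v| ≤ 2δ`, or the error dominates, so `|v|² ≤ 4|m - v|²`.
  have hpt : ∀ x, |(v n).fn x| ^ q ≤ κ ^ (q - 6) * |(v n).fn x| ^ (6 : ℝ)
      + (2 * δ) ^ (q - 2) * |(v n).fn x| ^ (2 : ℝ)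
      + 4 * κ ^ (q - 2) * |m x - (v n).fn x| ^ (2 : ℝ) := by
    intro x
    set r := |(v n).fn x|
    have hr : 0 ≤ r := abs_nonneg _
    have hmx : |m x| ≤ δ := hn₀ n hn x
    have htri : r ≤ |m x| + |m x - (v n).fn x| := by
      have := abs_sub_abs_le_abs_sub ((v n).fn x) (m x)
      rw [abs_sub_comm] at this
      linarith
    have p6 : 0 ≤ κ ^ (q - 6) * r ^ (6 : ℝ) := by positivity
    have p2 : 0 ≤ (2 * δ) ^ (q - 2) * r ^ (2 : ℝ) := by positivity
    have pd : 0 ≤ 4 * κ ^ (q - 2) * |m x - (v n).fn x| ^ (2 : ℝ) := by positivity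
    rcases hr.eq_or_lt with h0 | hr0
    · rw [← h0, Real.zero_rpow (by linarith : q ≠ 0), h0]; linarith
    have hsplit : r ^ q = r ^ (q - 2) * r ^ (2 : ℝ) := by rw [← Real.rpow_add hr0]; ring_nf
    rcases le_total κ r with h | h
    · have h1 : r ^ q = r ^ (q - 6) * r ^ (6 : ℝ) := by rw [← Real.rpow_add hr0]; ring_nf
      have h2 : r ^ (q - 6) ≤ κ ^ (q - 6) := Real.rpow_le_rpow_of_nonpos hκ0 h (by linarith)
      have := mul_le_mul_of_nonneg_right h2 (by positivity : 0 ≤ r ^ (6 : ℝ))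
      linarith
    rcases le_total |m x - (v n).fn x| |m x| with h' | h'
    · have h2 : r ^ (q - 2) ≤ (2 * δ) ^ (q - 2) :=
        Real.rpow_le_rpow hr (by linarith) (by linarith)
      have := mul_le_mul_of_nonneg_right h2 (by positivity : 0 ≤ r ^ (2 : ℝ))
      linarith
    · have h2 : r ^ (q - 2) ≤ κ ^ (q - 2) := Real.rpow_le_rpow hr h (by linarith)
      have h3 : r ^ (2 : ℝ) ≤ 4 * |m x - (v n).fn x| ^ (2 : ℝ) := by
        simp only [Real.rpow_two]
        nlinarith
      have := mul_le_mul h2 h3 (by positivity) (by positivity)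
      linarith
  have hint : powInt q (v n) ≤ κ ^ (q - 6) * powInt 6 (v n) + (2 * δ) ^ (q - 2) * powInt 2 (v n)
      + 4 * κ ^ (q - 2) * ∫ x, |m x - (v n).fn x| ^ (2 : ℝ) := by
    unfold powInt
    have hmono := integral_mono (integrable_abs_fn_rpow hq.le hq6.le (v n))
      (((i6.const_mul _).add (i2.const_mul _)).add (hdi.const_mul _)) hpt
    rwa [integral_add' ((i6.const_mul _).add (i2.const_mul _)) (hdi.const_mul _),
      integral_add' (i6.const_mul _) (i2.const_mul _), integral_const_mul, integral_const_mul,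
      integral_const_mul] at hmono
  have b1 : κ ^ (q - 6) * powInt 6 (v n) < ε / 3 := by
    refine lt_of_le_of_lt ?_ hκ
    gcongr
    refine (hK (v n)).2.trans ?_
    gcongr
    exact (norm_gradL_le _).trans (hM n)
  have b2 : (2 * δ) ^ (q - 2) * powInt 2 (v n) < ε / 3 := by
    refine lt_of_le_of_lt ?_ hδ
    gcongr
    rw [powInt_two]
    gcongr
    exact (norm_toL2_le _).trans (hM n)
  have b3 : 4 * κ ^ (q - 2) * ∫ x, |m x - (v n).fn x| ^ (2 : ℝ) ≤ ε / 3 := by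
    have : gradSq (v n) ≤ M ^ 2 := (gradSq_le _).trans (by gcongr; exact hM n)
    calc _ ≤ 4 * κ ^ (q - 2) * (ε / (3 * (4 * κ ^ (q - 2)) * (M ^ 2 + 1)) * (M ^ 2 + 1)) := by
          gcongr
          refine hd.trans ?_
          gcongr
          · rw [gradSq_eq]; positivity
          · linarith
      _ = _ := by field_simp
  linarith

/-- A bounded sequence in `H¹` that does not tend to zero in `L^q` has, along a subsequence and up
to translations, a nonzero weak limit. -/
theorem exists_translated_weak_limit {v : ℕ → H1} {M : ℝ} (hM : ∀ n, ‖v n‖ ≤ M) {q : ℝ}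
    (hq : 2 < q) (hq6 : q < 6) (hnot : ¬ Tendsto (fun n => powInt q (v n)) atTop (𝓝 0)) :
    ∃ (s : ℕ → ℕ) (y : ℕ → R3) (w : H1), StrictMono s ∧ w ≠ 0 ∧
      WeaklyTendsto (fun n => translateL (-(y n)) (v (s n))) w := by
  have h1 : ∃ k, ∃ δ > 0, ∃ᶠ n in atTop, ∃ x, δ < |mollify (stdBump k) (v n).fn x| := by
    by_contra! h
    refine hnot (tendsto_powInt_of_vanishing hM hq hq6 fun k δ hδ => ?_)
    simpa [not_frequently] using h k δ hδ
  obtain ⟨k, δ, hδ, hfreq⟩ := h1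
  obtain ⟨s, hs, hx⟩ := extraction_of_frequently_atTop hfreq
  choose y hy using hx
  obtain ⟨s', hs', w, hw⟩ := exists_weaklyTendsto_subseq
    (x := fun n => translateL (-(y n)) (v (s n))) (R := M) (fun n => by
      rw [LinearIsometry.norm_map]; exact hM _)
  refine ⟨s ∘ s', y ∘ s', w, hs.comp hs', ?_, hw⟩
  rintro rfl
  -- The pairing of the translates with the bump is the mollification at `y n`, of size greater than
  -- `δ`, so the weak limit cannot vanish.
  have h2 := (hw.inner_toL2 (bumpH1 (stdBump k))).abs
  simp only [map_zero, inner_zero_left, abs_zero] at h2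
  have h3 := ge_of_tendsto h2 (.of_forall fun n => by
    have := hy (s' n)
    rw [mollify_eq_inner] at this
    exact this.le)
  linarith

/-! ### Translations to infinity -/

/-- After a change of variables the ball has centre `-y n` and eventually misses any given point;
dominated convergence applies. -/
theorem tendsto_setIntegral_comp_sub {h : R3 → ℝ} (hi : Integrable h) {y : ℕ → R3}
    (hy : Tendsto (fun n => ‖y n‖) atTop atTop) (R : ℝ) :
    Tendsto (fun n => ∫ x in Metric.closedBall 0 R, h (x - y n)) atTop (𝓝 0) := by
  have e : ∀ n, ∫ x in Metric.closedBall 0 R, h (x - y n)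
      = ∫ x, (Metric.closedBall (-(y n)) R).indicator h x := by
    intro n
    rw [← integral_indicator Metric.isClosed_closedBall.measurableSet,
      ← integral_sub_right_eq_self (fun x => (Metric.closedBall (-(y n)) R).indicator h x) (y n)]
    refine integral_congr_ae (.of_forall fun x => ?_)
    simp only [Set.indicator, Metric.mem_closedBall, dist_eq_norm]
    simp
  simp only [e]
  have := tendsto_integral_of_dominated_convergence (μ := (volume : Measure R3))
    (F := fun n x => (Metric.closedBall (-(y n)) R).indicator h x) (f := fun _ => 0)
    (fun x => ‖h x‖)
    (fun n => (hi.1.indicator Metric.isClosed_closedBall.measurableSet)) hi.norm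
    (fun n => .of_forall fun x => norm_indicator_le_norm_self _ _)
    (.of_forall fun x => by
      refine tendsto_const_nhds.congr' ?_
      filter_upwards [hy.eventually_gt_atTop (R + ‖x‖)] with n hn
      rw [Set.indicator_of_notMem]
      rw [Metric.mem_closedBall, dist_eq_norm, sub_neg_eq_add, not_le]
      have := norm_sub_norm_le (y n) (-x)
      rw [norm_neg, sub_neg_eq_add, add_comm] at this
      linarith)
  simpa using this

theorem tendsto_inner_comp_sub {E : Type*} [NormedAddCommGroup E] [InnerProductSpace ℝ E]
    (f g : Lp E 2 (volume : Measure R3)) {y : ℕ → R3}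
    (hy : Tendsto (fun n => ‖y n‖) atTop atTop) :
    Tendsto (fun n => inner ℝ
      (Lp.compMeasurePreservingₗᵢ ℝ (fun x : R3 => x - y n) (mp_sub (y n)) f) g) atTop (𝓝 0) := by
  have hfi : Integrable (fun x => ‖f x‖ ^ (1 + 1 : ℝ)) := by
    have := (Lp.memLp f).integrable_norm_pow (by norm_num)
    norm_num
    exact this
  have hgi : Integrable (fun x => ‖g x‖ ^ (1 + 1 : ℝ)) := by
    have := (Lp.memLp g).integrable_norm_pow (by norm_num)
    norm_num
    exact this
  have key := tendsto_integral_rpow_mul_rpow one_pos one_pos (v := fun n x => ‖f (x - y n)‖)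
    (g := fun x => ‖g x‖) (fun _ _ => norm_nonneg _) (fun _ => norm_nonneg _)
    (fun n => hfi.comp_sub_right (y n)) hgi
    (B := ∫ x, ‖f x‖ ^ (1 + 1 : ℝ))
    (fun n => (integral_sub_right_eq_self (fun x => ‖f x‖ ^ (1 + 1 : ℝ)) (y n)).le)
    (fun R => tendsto_setIntegral_comp_sub hfi hy R)
  refine squeeze_zero_norm (fun n => ?_) key
  rw [L2.inner_def]
  refine (norm_integral_le_integral_norm _).trans (le_of_eq_of_le rfl
    (integral_mono_of_nonneg (.of_forall fun x => norm_nonneg _) ?_ ?_))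
  · simp only [Real.rpow_one]
    exact MemLp.integrable_mul (p := 2) (q := 2)
      ((Lp.memLp f).comp_measurePreserving (mp_sub (y n))).norm (Lp.memLp g).norm
  · filter_upwards [Lp.coeFn_compMeasurePreserving f (mp_sub (y n))] with x hx
    simp only [Real.rpow_one]
    refine (norm_inner_le_norm _ _).trans (le_of_eq ?_)
    congr 2

theorem weaklyTendsto_translateL {y : ℕ → R3} (hy : Tendsto (fun n => ‖y n‖) atTop atTop)
    (w : H1) : WeaklyTendsto (fun n => translateL (y n) w) 0 := by
  rw [weaklyTendsto_iff]
  intro ψ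
  simp only [inner_eq_toL2_add_gradL, inner_zero_left, toL2_translateL, gradL_translateL]
  simpa using (tendsto_inner_comp_sub (toL2 w) (toL2 ψ) hy).add
    (tendsto_inner_comp_sub (gradL w) (gradL ψ) hy)

/-- If translates of a weakly null sequence have a nonzero weak limit, the translations escape to
infinity. -/
theorem tendsto_norm_of_translateL_weaklyTendsto {v : ℕ → H1} (hv : WeaklyTendsto v 0)
    {d : ℕ → R3} {w : H1} (hw : w ≠ 0) (h : WeaklyTendsto (fun n => translateL (d n) (v n)) w) :
    Tendsto (fun n => ‖d n‖) atTop atTop := by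
  by_contra hcon
  rw [tendsto_atTop] at hcon
  push Not at hcon
  obtain ⟨C, hC⟩ := hcon
  obtain ⟨s, hs, hsC⟩ := extraction_of_frequently_atTop hC
  -- If the translations had a bounded subsequence, a further one would converge. Moving it onto the
  -- fixed function `w` pairs a weakly null sequence with a strongly convergent one, giving `⟨w, w⟩
  -- = 0`.
  obtain ⟨d₀, -, s', hs', hlim⟩ := tendsto_subseq_of_bounded
    (Metric.isBounded_closedBall (x := (0 : R3)) (r := C)) (x := d ∘ s) (fun n => by
      simpa using (hsC n).le)
  have h1 := (hv.comp (hs.comp hs')).inner_strong (tendsto_translateL hlim.neg w)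
  have h2 := weaklyTendsto_iff.1 (h.comp (hs.comp hs')) w
  simp only [inner_translateL_left] at h2
  have := tendsto_nhds_unique h2 h1
  rw [inner_zero_left, inner_self_eq_zero] at this
  exact hw this

theorem fn_add (u v : H1) : (u + v).fn =ᵐ[volume] fun x => u.fn x + v.fn x :=
  Lp.coeFn_add (toL2 u) (toL2 v)

theorem fn_sub (u v : H1) : (u - v).fn =ᵐ[volume] fun x => u.fn x - v.fn x :=
  Lp.coeFn_sub (toL2 u) (toL2 v)

theorem fn_smul (c : ℝ) (u : H1) : (c • u).fn =ᵐ[volume] fun x => c * u.fn x :=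
  Lp.coeFn_smul c (toL2 u)

/-! ### The power nonlinearity -/

section Pointwise

variable {p : ℝ}

/-- Because `p - 1 > 1`, the factor `|s|^{p-1}` is differentiable even at the origin and the product
rule holds everywhere. -/
theorem hasDerivAt_abs_rpow_mul (hp : 2 < p) (s : ℝ) :
    HasDerivAt (fun s : ℝ => |s| ^ (p - 1) * s) (p * |s| ^ (p - 1)) s := by
  have h : HasDerivAt (fun s : ℝ => |s| ^ (p - 1) * s)
      ((p - 1) * |s| ^ (p - 1 - 2) * s * s + |s| ^ (p - 1) * 1) s :=
    (hasDerivAt_abs_rpow s (by linarith : 1 < p - 1)).mul (hasDerivAt_id s)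
  refine h.congr_deriv ?_
  rcases eq_or_ne s 0 with rfl | hs
  · simp [Real.zero_rpow (by linarith : p - 1 ≠ 0)]
  · have hs' : 0 < |s| := abs_pos.2 hs
    have : |s| ^ (p - 1) = |s| ^ (p - 1 - 2) * (s * s) := by
      rw [← abs_mul_abs_self s, ← sq, ← Real.rpow_two, ← Real.rpow_add hs']
      ring_nf
    calc _ = (p - 1) * (|s| ^ (p - 1 - 2) * (s * s)) + |s| ^ (p - 1) := by ring
      _ = (p - 1) * |s| ^ (p - 1) + |s| ^ (p - 1) := by rw [← this]
      _ = _ := by ring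

theorem hasDerivAt_abs_rpow_add_one (hp : 2 < p) (s : ℝ) :
    HasDerivAt (fun s : ℝ => |s| ^ (p + 1)) ((p + 1) * (|s| ^ (p - 1) * s)) s := by
  have h := hasDerivAt_abs_rpow s (by linarith : 1 < p + 1)
  convert h using 1
  rw [show p + 1 - 2 = p - 1 by ring, mul_assoc]

theorem abs_rpow_mul_self (hp : 2 < p) (s : ℝ) : |s| ^ (p - 1) * |s| = |s| ^ p := by
  rcases (abs_nonneg s).eq_or_lt with h | h
  · rw [← h, Real.zero_rpow (by linarith : p ≠ 0)]; ring
  · nth_rewrite 2 [← Real.rpow_one |s|]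
    rw [← Real.rpow_add h]; ring_nf

theorem abs_sub_rpow_mul_le (hp : 2 < p) {M s t : ℝ} (hs : |s| ≤ M) (ht : |t| ≤ M) :
    |(|s| ^ (p - 1) * s) - |t| ^ (p - 1) * t| ≤ p * M ^ (p - 1) * |s - t| := by
  have := Convex.norm_image_sub_le_of_norm_hasDerivWithin_le (𝕜 := ℝ)
    (f := fun s : ℝ => |s| ^ (p - 1) * s) (f' := fun s => p * |s| ^ (p - 1))
    (s := Set.Icc (-M) M) (C := p * M ^ (p - 1)) (x := t) (y := s)
    (fun x _ => (hasDerivAt_abs_rpow_mul hp x).hasDerivWithinAt)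
    (fun x hx => by
      rw [Real.norm_of_nonneg (by positivity)]
      exact mul_le_mul_of_nonneg_left (Real.rpow_le_rpow (abs_nonneg x) (abs_le.2 hx)
        (by linarith)) (by linarith))
    (convex_Icc _ _) (abs_le.1 ht) (abs_le.1 hs)
  simpa using this

theorem abs_rpow_sub_le (hp : 2 < p) {M s t : ℝ} (hs : |s| ≤ M) (ht : |t| ≤ M) :
    |(|s| ^ (p + 1)) - |t| ^ (p + 1)| ≤ (p + 1) * M ^ p * |s - t| := by
  have := Convex.norm_image_sub_le_of_norm_hasDerivWithin_le (𝕜 := ℝ)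
    (f := fun s : ℝ => |s| ^ (p + 1)) (f' := fun s => (p + 1) * (|s| ^ (p - 1) * s))
    (s := Set.Icc (-M) M) (C := (p + 1) * M ^ p) (x := t) (y := s)
    (fun x _ => (hasDerivAt_abs_rpow_add_one hp x).hasDerivWithinAt)
    (fun x hx => by
      rw [norm_mul, norm_mul, Real.norm_of_nonneg (by positivity : 0 ≤ |x| ^ (p - 1)),
        Real.norm_of_nonneg (by linarith : 0 ≤ p + 1), Real.norm_eq_abs, abs_rpow_mul_self hp]
      gcongr
      exact abs_le.2 hx)
    (convex_Icc _ _) (abs_le.1 ht) (abs_le.1 hs)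
  simpa using this

/-- The mean value inequality on the segment from `s` to `s + t`, applied to `|z|^{p+1}` minus its
linear part at `s`; the Lipschitz bound for `|z|^{p-1}z` supplies the second factor `|t|`. -/
theorem abs_rpow_add_sub_sub_le (hp : 2 < p) (s t : ℝ) :
    |(|s + t| ^ (p + 1)) - |s| ^ (p + 1) - (p + 1) * (|s| ^ (p - 1) * s * t)|
      ≤ (p + 1) * p * (|s| + |t|) ^ (p - 1) * |t| ^ (2 : ℝ) := by
  set M := |s| + |t|
  have hM : 0 ≤ M := by positivity
  have hseg : ∀ x ∈ segment ℝ s (s + t), |x| ≤ M ∧ |x - s| ≤ |t| := by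
    rintro x ⟨a, b, ha, hb, hab, rfl⟩
    have e : a • s + b • (s + t) - s = b * t := by
      simp only [smul_eq_mul]; linear_combination s * hab
    have h1 : |a • s + b • (s + t) - s| ≤ |t| := by
      rw [e, abs_mul, abs_of_nonneg hb]
      exact mul_le_of_le_one_left (abs_nonneg t) (by linarith)
    exact ⟨by linarith [abs_sub_abs_le_abs_sub (a • s + b • (s + t)) s], h1⟩
  have := Convex.norm_image_sub_le_of_norm_hasDerivWithin_le (𝕜 := ℝ)
    (f := fun z : ℝ => |z| ^ (p + 1) - (p + 1) * (|s| ^ (p - 1) * s) * z)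
    (f' := fun z => (p + 1) * (|z| ^ (p - 1) * z) - (p + 1) * (|s| ^ (p - 1) * s))
    (s := segment ℝ s (s + t)) (C := (p + 1) * (p * M ^ (p - 1) * |t|)) (x := s) (y := s + t)
    (fun x _ => by
      have := (hasDerivAt_abs_rpow_add_one hp x).sub
        ((hasDerivAt_id x).const_mul ((p + 1) * (|s| ^ (p - 1) * s)))
      simp only [mul_one] at this
      exact this.hasDerivWithinAt)
    (fun x hx => by
      obtain ⟨h1, h2⟩ := hseg x hx
      rw [← mul_sub, norm_mul, Real.norm_of_nonneg (by linarith : 0 ≤ p + 1), Real.norm_eq_abs]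
      gcongr
      refine (abs_sub_rpow_mul_le hp h1 (by simp [M])).trans ?_
      gcongr)
    (convex_segment _ _) (left_mem_segment ℝ _ _) (right_mem_segment ℝ _ _)
  simp only [Real.norm_eq_abs, add_sub_cancel_left] at this
  have e : |s + t| ^ (p + 1) - |s| ^ (p + 1) - (p + 1) * (|s| ^ (p - 1) * s * t)
      = |s + t| ^ (p + 1) - (p + 1) * (|s| ^ (p - 1) * s) * (s + t)
        - (|s| ^ (p + 1) - (p + 1) * (|s| ^ (p - 1) * s) * s) := by ring
  rw [e]
  refine this.trans (le_of_eq ?_)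
  rw [Real.rpow_two]; ring

/-- By symmetry `|t| ≤ |s|` may be assumed. The increment from `s` to `s + t` and the term
`|t|^{p+1}` are then both controlled by `|s|^p|t|`. -/
theorem abs_brezis_lieb_le (hp : 2 < p) (s t : ℝ) :
    |(|s + t| ^ (p + 1)) - |s| ^ (p + 1) - |t| ^ (p + 1)|
      ≤ ((p + 1) * 2 ^ p + 1) * (|s| ^ p * |t| + |t| ^ p * |s|) := by
  have key : ∀ s t : ℝ, |t| ≤ |s| → |(|s + t| ^ (p + 1)) - |s| ^ (p + 1) - |t| ^ (p + 1)|
      ≤ ((p + 1) * 2 ^ p + 1) * (|s| ^ p * |t|) := by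
    intro s t h
    have h1 := abs_rpow_sub_le hp (M := 2 * |s|) (s := s + t) (t := s)
      (by linarith [abs_add_le s t]) (by linarith [abs_nonneg s])
    rw [add_sub_cancel_left, Real.mul_rpow (by norm_num) (abs_nonneg s)] at h1
    have h2 : |t| ^ (p + 1) ≤ |s| ^ p * |t| := by
      rw [Real.rpow_add_one' (abs_nonneg t) (by linarith)]
      gcongr
    have h3 := abs_sub (|s + t| ^ (p + 1) - |s| ^ (p + 1)) (|t| ^ (p + 1))
    rw [abs_of_nonneg (by positivity : 0 ≤ |t| ^ (p + 1))] at h3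
    linarith
  have hp0 : 0 ≤ (p + 1) * 2 ^ p + 1 := by positivity
  rcases le_total |t| |s| with h | h
  · refine (key s t h).trans ?_
    gcongr
    have : 0 ≤ |t| ^ p * |s| := by positivity
    linarith
  · have := key t s h
    rw [add_comm t s, sub_right_comm] at this
    refine this.trans ?_
    gcongr
    have : 0 ≤ |s| ^ p * |t| := by positivity
    linarith

end Pointwise

/-! ### Integrals of products of powers. -/

theorem integrable_rpow_mul_rpow {α β : ℝ} (hα : 0 < α) (hβ : 0 < β) {v g : R3 → ℝ}
    (hv : AEStronglyMeasurable v volume) (hg : AEStronglyMeasurable g volume)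
    (hv0 : ∀ x, 0 ≤ v x) (hg0 : ∀ x, 0 ≤ g x)
    (hvi : Integrable (fun x => v x ^ (α + β))) (hgi : Integrable (fun x => g x ^ (α + β))) :
    Integrable (fun x => v x ^ α * g x ^ β) := by
  refine (hvi.add hgi).mono' ((hv.aemeasurable.pow_const α).mul
    (hg.aemeasurable.pow_const β)).aestronglyMeasurable (.of_forall fun x => ?_)
  have h1 := hv0 x
  have h2 := hg0 x
  rw [Real.norm_of_nonneg (by positivity)]
  simpa using rpow_mul_rpow_le hα hβ one_pos h1 h2

theorem integral_rpow_mul_rpow_le {α β η : ℝ} (hα : 0 < α) (hβ : 0 < β) (hη : 0 < η) {v g : R3 → ℝ}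
    (hv0 : ∀ x, 0 ≤ v x) (hg0 : ∀ x, 0 ≤ g x)
    (hvi : Integrable (fun x => v x ^ (α + β))) (hgi : Integrable (fun x => g x ^ (α + β))) :
    ∫ x, v x ^ α * g x ^ β
      ≤ η ^ β * (∫ x, v x ^ (α + β)) + η ^ (-α) * ∫ x, g x ^ (α + β) := by
  rw [← integral_const_mul, ← integral_const_mul,
    ← integral_add (hvi.const_mul _) (hgi.const_mul _)]
  exact integral_mono_of_nonneg
    (.of_forall fun x => by have := hv0 x; have := hg0 x; positivity)
    ((hvi.const_mul _).add (hgi.const_mul _))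
    (.of_forall fun x => rpow_mul_rpow_le hα hβ hη (hv0 x) (hg0 x))

/-! ### The power functional: derivative, weak continuity and Brezis–Lieb splitting. -/

section Functional

variable {p : ℝ}

theorem aestronglyMeasurable_abs_fn (u : H1) : AEStronglyMeasurable (fun x => |u.fn x|) volume :=
  (memLp_fn u).1.norm

theorem integrable_abs_fn_rpow_mul (hp : 2 < p) (hp5 : p < 5) (u ψ : H1) :
    Integrable (fun x => |u.fn x| ^ p * |ψ.fn x|) := by
  have := integrable_rpow_mul_rpow (by linarith : 0 < p) one_pos (aestronglyMeasurable_abs_fn u)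
    (aestronglyMeasurable_abs_fn ψ) (fun _ => abs_nonneg _) (fun _ => abs_nonneg _)
    (integrable_abs_fn_rpow (by linarith) (by linarith) u)
    (integrable_abs_fn_rpow (by linarith) (by linarith) ψ)
  simpa only [Real.rpow_one] using this

theorem norm_power_mul (hp : 2 < p) (s t : ℝ) :
    ‖|s| ^ (p - 1) * s * t‖ = |s| ^ p * |t| := by
  rw [norm_mul, norm_mul, Real.norm_of_nonneg (by positivity), Real.norm_eq_abs, Real.norm_eq_abs,
    abs_rpow_mul_self hp]

theorem integrable_power_mul (hp : 2 < p) (hp5 : p < 5) (u ψ : H1) :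
    Integrable (fun x => |u.fn x| ^ (p - 1) * u.fn x * ψ.fn x) := by
  refine (integrable_abs_fn_rpow_mul hp hp5 u ψ).mono' ?_ (.of_forall fun x => ?_)
  · exact ((((aestronglyMeasurable_abs_fn u).aemeasurable.pow_const _).mul
      (memLp_fn u).1.aemeasurable).mul (memLp_fn ψ).1.aemeasurable).aestronglyMeasurable
  · exact (norm_power_mul hp _ _).le

theorem abs_integral_power_mul_le (hp : 2 < p) (hp5 : p < 5) {η : ℝ} (hη : 0 < η) (u ψ : H1) :
    |∫ x, |u.fn x| ^ (p - 1) * u.fn x * ψ.fn x|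
      ≤ η * powInt (p + 1) u + η ^ (-p) * powInt (p + 1) ψ := by
  have h1 := integral_rpow_mul_rpow_le (by linarith : 0 < p) one_pos hη
    (fun x => abs_nonneg (u.fn x)) (fun x => abs_nonneg (ψ.fn x))
    (integrable_abs_fn_rpow (by linarith) (by linarith) u)
    (integrable_abs_fn_rpow (by linarith) (by linarith) ψ)
  simp only [Real.rpow_one] at h1
  refine le_trans ?_ h1
  rw [← Real.norm_eq_abs]
  refine (norm_integral_le_integral_norm _).trans (le_of_eq ?_)
  exact integral_congr_ae (.of_forall fun x => norm_power_mul hp _ _)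

theorem exists_abs_integral_power_mul_le (hp : 2 < p) (hp5 : p < 5) (u : H1) :
    ∃ C : ℝ, ∀ ψ : H1, |∫ x, |u.fn x| ^ (p - 1) * u.fn x * ψ.fn x| ≤ C * ‖ψ‖ := by
  obtain ⟨C, hC0, hC⟩ := exists_powInt_le (by linarith : 2 ≤ p + 1) (by linarith)
  refine ⟨powInt (p + 1) u + C, fun ψ => ?_⟩
  rcases eq_or_ne ψ 0 with rfl | hψ
  · have : ((0 : H1).fn) =ᵐ[volume] 0 := Lp.coeFn_zero ℝ 2 volume
    rw [integral_eq_zero_of_ae]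
    · simp
    · filter_upwards [this] with x hx
      simp [hx]
  have hn : 0 < ‖ψ‖ := norm_pos_iff.2 hψ
  -- The weight `η = ‖ψ‖` turns both terms into multiples of `‖ψ‖`.
  refine (abs_integral_power_mul_le hp hp5 hn u ψ).trans ?_
  have e : ‖ψ‖ ^ (-p) * ‖ψ‖ ^ (p + 1) = ‖ψ‖ := by
    rw [← Real.rpow_add hn]; simp
  calc _ ≤ ‖ψ‖ * powInt (p + 1) u + ‖ψ‖ ^ (-p) * (C * ‖ψ‖ ^ (p + 1)) := by
        gcongr; exact hC ψ
    _ = ‖ψ‖ * powInt (p + 1) u + C * (‖ψ‖ ^ (-p) * ‖ψ‖ ^ (p + 1)) := by ring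
    _ = _ := by rw [e]; ring

/-- The functional `ψ ↦ ∫ |u|^{p-1} u ψ` on `H¹`. -/
def powerL (hp : 2 < p) (hp5 : p < 5) (u : H1) : H1 →L[ℝ] ℝ :=
  LinearMap.mkContinuousOfExistsBound
    { toFun := fun ψ => ∫ x, |u.fn x| ^ (p - 1) * u.fn x * ψ.fn x
      map_add' := fun ψ ψ' => by
        rw [← integral_add (integrable_power_mul hp hp5 u ψ) (integrable_power_mul hp hp5 u ψ')]
        refine integral_congr_ae ((fn_add ψ ψ').mono fun x hx => ?_)
        simp only [hx]; ring
      map_smul' := fun c ψ => by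
        simp only [RingHom.id_apply, smul_eq_mul]
        rw [← integral_const_mul]
        refine integral_congr_ae ((fn_smul c ψ).mono fun x hx => ?_)
        simp only [hx]; ring }
    (exists_abs_integral_power_mul_le hp hp5 u)

theorem powerL_apply (hp : 2 < p) (hp5 : p < 5) (u ψ : H1) :
    powerL hp hp5 u ψ = ∫ x, |u.fn x| ^ (p - 1) * u.fn x * ψ.fn x := rfl

theorem powerL_self (hp : 2 < p) (hp5 : p < 5) (u : H1) :
    powerL hp hp5 u u = powInt (p + 1) u := by
  rw [powerL_apply, powInt]
  refine integral_congr_ae (.of_forall fun x => ?_)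
  simp only
  rw [Real.rpow_add_one' (abs_nonneg _) (by linarith), ← abs_rpow_mul_self hp, mul_assoc, mul_assoc,
    abs_mul_abs_self]

theorem powerL_translateL (hp : 2 < p) (hp5 : p < 5) (y : R3) (u ψ : H1) :
    powerL hp hp5 (translateL y u) (translateL y ψ) = powerL hp hp5 u ψ := by
  rw [powerL_apply, powerL_apply,
    ← integral_sub_right_eq_self (fun x => |u.fn x| ^ (p - 1) * u.fn x * ψ.fn x) y]
  refine integral_congr_ae ?_
  filter_upwards [fn_translateL y u, fn_translateL y ψ] with x h1 h2
  rw [h1, h2]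

/-- The pointwise Taylor bound is integrated. Weighting the mixed integral of `|u|^{p-1}|h|²` with
`η = ‖h‖` gives a remainder of order `‖h‖²`, without Hölder's inequality. -/
theorem hasFDerivAt_powInt (hp : 2 < p) (hp5 : p < 5) (u : H1) :
    HasFDerivAt (powInt (p + 1)) ((p + 1) • powerL hp hp5 u) u := by
  obtain ⟨C, hC0, hC⟩ := exists_powInt_le (by linarith : 2 ≤ p + 1) (by linarith)
  have hI : ∀ v : H1, Integrable (fun x => |v.fn x| ^ (p + 1)) := fun v =>
    integrable_abs_fn_rpow (by linarith) (by linarith) v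
  have hI' : ∀ v : H1, Integrable (fun x => |v.fn x| ^ (p - 1 + 2)) := fun v =>
    integrable_abs_fn_rpow (by linarith) (by linarith) v
  set c := (p + 1) * p * 2 ^ (p - 1) with hc
  have hc0 : 0 ≤ c := by positivity
  have hbound : ∀ h : H1, h ≠ 0 →
      |powInt (p + 1) (u + h) - powInt (p + 1) u - (p + 1) * powerL hp hp5 u h|
        ≤ c * (powInt (p + 1) u + C + C * ‖h‖ ^ (p - 1)) * ‖h‖ ^ (2 : ℝ) := by
    intro h hh
    have hn : 0 < ‖h‖ := norm_pos_iff.2 hh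
    have imix : Integrable (fun x => |u.fn x| ^ (p - 1) * |h.fn x| ^ (2 : ℝ)) :=
      integrable_rpow_mul_rpow (by linarith) two_pos (aestronglyMeasurable_abs_fn u)
        (aestronglyMeasurable_abs_fn h) (fun _ => abs_nonneg _) (fun _ => abs_nonneg _)
        (hI' u) (hI' h)
    have e1 : powInt (p + 1) (u + h) - powInt (p + 1) u - (p + 1) * powerL hp hp5 u h
        = ∫ x, (|u.fn x + h.fn x| ^ (p + 1) - |u.fn x| ^ (p + 1)
          - (p + 1) * (|u.fn x| ^ (p - 1) * u.fn x * h.fn x)) := by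
      have hae : (fun x => |u.fn x + h.fn x| ^ (p + 1)) =ᵐ[volume]
          fun x => |(u + h).fn x| ^ (p + 1) := (fn_add u h).mono fun x hx => by simp only [hx]
      have iA := (hI (u + h)).congr hae.symm
      have a1 := integral_sub (iA.sub (hI u)) ((integrable_power_mul hp hp5 u h).const_mul (p + 1))
      simp only [Pi.sub_apply] at a1
      rw [powerL_apply, ← integral_const_mul, powInt, powInt, ← integral_congr_ae hae, a1,
        integral_sub iA (hI u)]
    have e2 : |∫ x, (|u.fn x + h.fn x| ^ (p + 1) - |u.fn x| ^ (p + 1)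
          - (p + 1) * (|u.fn x| ^ (p - 1) * u.fn x * h.fn x))|
        ≤ ∫ x, c * (|u.fn x| ^ (p - 1) * |h.fn x| ^ (2 : ℝ) + |h.fn x| ^ (p + 1)) := by
      rw [← Real.norm_eq_abs]
      refine (norm_integral_le_integral_norm _).trans (integral_mono_of_nonneg
        (.of_forall fun x => norm_nonneg _) ((imix.add (hI h)).const_mul c)
        (.of_forall fun x => ?_))
      refine (abs_rpow_add_sub_sub_le hp (u.fn x) (h.fn x)).trans ?_
      have h1 := add_rpow_le (abs_nonneg (u.fn x)) (abs_nonneg (h.fn x))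
        (by linarith : 0 ≤ p - 1)
      have h2 : |h.fn x| ^ (p + 1) = |h.fn x| ^ (p - 1) * |h.fn x| ^ (2 : ℝ) := by
        rw [← Real.rpow_add_of_nonneg (abs_nonneg _) (by linarith) (by norm_num)]; ring_nf
      simp only
      rw [h2, hc]
      calc (p + 1) * p * (|u.fn x| + |h.fn x|) ^ (p - 1) * |h.fn x| ^ (2 : ℝ)
          ≤ (p + 1) * p * (2 ^ (p - 1) * (|u.fn x| ^ (p - 1) + |h.fn x| ^ (p - 1)))
            * |h.fn x| ^ (2 : ℝ) := by gcongr
        _ = _ := by ring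
    have e3 : ∫ x, |u.fn x| ^ (p - 1) * |h.fn x| ^ (2 : ℝ)
        ≤ ‖h‖ ^ (2 : ℝ) * powInt (p + 1) u + ‖h‖ ^ (-(p - 1)) * powInt (p + 1) h := by
      have := integral_rpow_mul_rpow_le (by linarith : 0 < p - 1) two_pos hn
        (fun x => abs_nonneg (u.fn x)) (fun x => abs_nonneg (h.fn x)) (hI' u) (hI' h)
      rw [show p - 1 + 2 = p + 1 by ring] at this
      exact this
    have e4 : ‖h‖ ^ (-(p - 1)) * ‖h‖ ^ (p + 1) = ‖h‖ ^ (2 : ℝ) := by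
      rw [← Real.rpow_add hn]; ring_nf
    have e5 : ‖h‖ ^ (p + 1) = ‖h‖ ^ (p - 1) * ‖h‖ ^ (2 : ℝ) := by
      rw [← Real.rpow_add hn]; ring_nf
    rw [e1]
    refine e2.trans ?_
    rw [integral_const_mul, integral_add imix (hI h), mul_assoc c]
    refine mul_le_mul_of_nonneg_left ?_ hc0
    calc (∫ x, |u.fn x| ^ (p - 1) * |h.fn x| ^ (2 : ℝ)) + ∫ x, |h.fn x| ^ (p + 1)
        ≤ ‖h‖ ^ (2 : ℝ) * powInt (p + 1) u + ‖h‖ ^ (-(p - 1)) * (C * ‖h‖ ^ (p + 1))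
          + C * ‖h‖ ^ (p + 1) := by
          gcongr
          · refine e3.trans ?_
            gcongr
            exact hC h
          · exact hC h
      _ = ‖h‖ ^ (2 : ℝ) * powInt (p + 1) u + C * (‖h‖ ^ (-(p - 1)) * ‖h‖ ^ (p + 1))
          + C * ‖h‖ ^ (p + 1) := by ring
      _ = _ := by rw [e4, e5]; ring
  rw [hasFDerivAt_iff_isLittleO_nhds_zero, Asymptotics.isLittleO_iff]
  intro ε hε
  set D := c * (powInt (p + 1) u + C + C) with hD
  have hD0 : 0 ≤ D := by have := powInt_nonneg (p + 1) u; positivity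
  -- The bound `‖h‖ < 1` replaces `‖h‖^{p-1}` by 1, so that `D` no longer depends on `h`.
  filter_upwards [Metric.ball_mem_nhds (0 : H1) (by positivity : 0 < min 1 (ε / (D + 1)))] with h hh
  rw [mem_ball_zero_iff, lt_min_iff] at hh
  rcases eq_or_ne h 0 with rfl | hne
  · simp
  have h1 := hbound h hne
  simp only [Real.norm_eq_abs, smul_apply, smul_eq_mul]
  refine h1.trans ?_
  have h2 : ‖h‖ ^ (p - 1) ≤ 1 := Real.rpow_le_one (norm_nonneg _) hh.1.le (by linarith)
  have h3 : c * (powInt (p + 1) u + C + C * ‖h‖ ^ (p - 1)) ≤ D := by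
    rw [hD]
    gcongr
    exact mul_le_of_le_one_right hC0.le h2
  rw [Real.rpow_two, sq, ← mul_assoc]
  gcongr
  calc _ ≤ (D + 1) * (ε / (D + 1)) := by
        gcongr
        · linarith
        · exact hh.2.le
    _ = ε := by field_simp

theorem WeaklyTendsto.tendsto_integral_mixed {v : ℕ → H1} (h : WeaklyTendsto v 0) {α β : ℝ}
    (hα : 0 < α) (hβ : 0 < β) (h2 : 2 ≤ α + β) (h6 : α + β < 6) {g : R3 → ℝ}
    (hg0 : ∀ x, 0 ≤ g x) (hgi : Integrable (fun x => g x ^ (α + β))) :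
    Tendsto (fun n => ∫ x, |(v n).fn x| ^ α * g x ^ β) atTop (𝓝 0) := by
  obtain ⟨M, hM⟩ := h.bounded
  have hM0 : 0 ≤ M := (norm_nonneg _).trans (hM 0)
  obtain ⟨C, hC0, hC⟩ := exists_powInt_le h2 h6.le
  refine tendsto_integral_rpow_mul_rpow hα hβ (fun _ _ => abs_nonneg _) hg0
    (fun n => integrable_abs_fn_rpow h2 h6.le (v n)) hgi (B := C * M ^ (α + β)) (fun n => ?_)
    (fun R => h.tendsto_setIntegral_rpow h2 h6 R)
  refine (hC (v n)).trans ?_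
  gcongr
  exact hM n

/-- Weak continuity of the power nonlinearity. -/
theorem WeaklyTendsto.powerL (hp : 2 < p) (hp5 : p < 5) {u : ℕ → H1} {u₀ : H1}
    (h : WeaklyTendsto u u₀) (ψ : H1) :
    Tendsto (fun n => powerL hp hp5 (u n) ψ) atTop (𝓝 (powerL hp hp5 u₀ ψ)) := by
  have hv := h.sub_self
  -- One function dominating both `u₀` and `ψ` reduces all error terms to mixed integrals of `u n -
  -- u₀` with `g`.
  set g : R3 → ℝ := fun x => |u₀.fn x| + |ψ.fn x| with hg
  have hg0 : ∀ x, 0 ≤ g x := fun x => by positivity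
  have hgm : AEStronglyMeasurable g volume :=
    (aestronglyMeasurable_abs_fn u₀).add (aestronglyMeasurable_abs_fn ψ)
  have hgi : Integrable (fun x => g x ^ (p + 1)) := by
    refine (((integrable_abs_fn_rpow (by linarith : 2 ≤ p + 1) (by linarith) u₀).add
      (integrable_abs_fn_rpow (q := p + 1) (by linarith) (by linarith) ψ)).const_mul
        (2 ^ (p + 1))).mono'
      (hgm.aemeasurable.pow_const _).aestronglyMeasurable (.of_forall fun x => ?_)
    rw [Real.norm_of_nonneg (by have := hg0 x; positivity)]
    exact add_rpow_le (abs_nonneg _) (abs_nonneg _) (by linarith : 0 ≤ p + 1)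
  have t1 := hv.tendsto_integral_mixed (by linarith : 0 < p) one_pos (by linarith) (by linarith)
    hg0 hgi
  have t2 := hv.tendsto_integral_mixed one_pos (by linarith : 0 < p) (by linarith) (by linarith)
    hg0 (by rwa [add_comm])
  simp only [Real.rpow_one] at t1 t2
  rw [tendsto_iff_norm_sub_tendsto_zero]
  have ht : Tendsto (fun n => p * 2 ^ (p - 1) * ((∫ x, |(u n - u₀).fn x| ^ p * g x)
      + 2 ^ (p - 1) * ∫ x, |(u n - u₀).fn x| * g x ^ p)) atTop (𝓝 0) := by
    simpa using (t1.add (t2.const_mul (2 ^ (p - 1)))).const_mul (p * 2 ^ (p - 1))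
  refine squeeze_zero (fun n => norm_nonneg _) (fun n => ?_) ht
  have i1 : Integrable (fun x => |(u n - u₀).fn x| ^ p * g x) := by
    have := integrable_rpow_mul_rpow (by linarith : 0 < p) one_pos
      (aestronglyMeasurable_abs_fn (u n - u₀)) hgm (fun _ => abs_nonneg _) hg0
      (integrable_abs_fn_rpow (by linarith) (by linarith) _) hgi
    simpa only [Real.rpow_one] using this
  have i2 : Integrable (fun x => |(u n - u₀).fn x| * g x ^ p) := by
    have := integrable_rpow_mul_rpow one_pos (by linarith : 0 < p)
      (aestronglyMeasurable_abs_fn (u n - u₀)) hgm (fun _ => abs_nonneg _) hg0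
      (integrable_abs_fn_rpow (by linarith) (by linarith) _) (by rwa [add_comm])
    simpa only [Real.rpow_one] using this
  rw [powerL_apply, powerL_apply,
    ← integral_sub (integrable_power_mul hp hp5 _ _) (integrable_power_mul hp hp5 _ _),
    ← integral_const_mul, ← integral_add i1 (i2.const_mul _), ← integral_const_mul]
  refine (norm_integral_le_integral_norm _).trans (integral_mono_of_nonneg
    (.of_forall fun x => norm_nonneg _) ((i1.add (i2.const_mul _)).const_mul _) ?_)
  filter_upwards [fn_sub (u n) u₀] with x hx
  set s := (u n).fn x
  set t := u₀.fn x
  set d := |s - t| with hd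
  have hdx : |(u n - u₀).fn x| = d := by rw [hx]
  have hgx : g x = |t| + |ψ.fn x| := rfl
  have htg : |t| ≤ g x := by rw [hgx]; linarith [abs_nonneg (ψ.fn x)]
  have hψg : |ψ.fn x| ≤ g x := by rw [hgx]; linarith [abs_nonneg t]
  have hd0 : 0 ≤ d := abs_nonneg _
  rw [hdx, ← sub_mul, norm_mul, Real.norm_eq_abs, Real.norm_eq_abs]
  have h1 := abs_sub_rpow_mul_le hp (M := d + 2 * g x) (s := s) (t := t)
    (by linarith [abs_sub_abs_le_abs_sub s t, hg0 x]) (by linarith [hg0 x])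
  have h2 : (d + 2 * g x) ^ (p - 1) ≤ 2 ^ (p - 1) * (d ^ (p - 1) + 2 ^ (p - 1) * g x ^ (p - 1)) := by
    have := add_rpow_le hd0 (by linarith [hg0 x] : 0 ≤ 2 * g x) (by linarith : 0 ≤ p - 1)
    rwa [Real.mul_rpow (by norm_num) (hg0 x)] at this
  have h3 : d ^ p = d ^ (p - 1) * d := by
    rw [← Real.rpow_add_one' hd0 (by linarith)]; ring_nf
  have h4 : g x ^ p = g x ^ (p - 1) * g x := by
    rw [← Real.rpow_add_one' (hg0 x) (by linarith)]; ring_nf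
  calc _ ≤ p * (2 ^ (p - 1) * (d ^ (p - 1) + 2 ^ (p - 1) * g x ^ (p - 1))) * d * g x := by
        refine mul_le_mul (h1.trans ?_) hψg (abs_nonneg _) ?_
        · gcongr
        · have := hg0 x; positivity
    _ = _ := by rw [h3, h4]; ring

/-- The Brezis--Lieb splitting along weakly convergent sequences of `H¹`. -/
theorem WeaklyTendsto.brezisLieb (hp : 2 < p) (hp5 : p < 5) {u : ℕ → H1} {u₀ : H1}
    (h : WeaklyTendsto u u₀) :
    Tendsto (fun n => powInt (p + 1) (u n) - powInt (p + 1) (u n - u₀)) atTop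
      (𝓝 (powInt (p + 1) u₀)) := by
  have hv := h.sub_self
  have hI : ∀ v : H1, Integrable (fun x => |v.fn x| ^ (p + 1)) := fun v =>
    integrable_abs_fn_rpow (by linarith) (by linarith) v
  have t1 := hv.tendsto_integral_mixed (by linarith : 0 < p) one_pos (by linarith) (by linarith)
    (fun x => abs_nonneg (u₀.fn x)) (hI u₀)
  have t2 := hv.tendsto_integral_mixed one_pos (by linarith : 0 < p) (by linarith) (by linarith)
    (fun x => abs_nonneg (u₀.fn x)) (by rw [add_comm]; exact hI u₀)
  simp only [Real.rpow_one] at t1 t2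
  rw [tendsto_iff_norm_sub_tendsto_zero]
  have ht : Tendsto (fun n => ((p + 1) * 2 ^ p + 1) * ((∫ x, |(u n - u₀).fn x| ^ p * |u₀.fn x|)
      + ∫ x, |(u n - u₀).fn x| * |u₀.fn x| ^ p)) atTop (𝓝 0) := by
    simpa using (t1.add t2).const_mul ((p + 1) * 2 ^ p + 1)
  refine squeeze_zero (fun n => norm_nonneg _) (fun n => ?_) ht
  have i1 := integrable_abs_fn_rpow_mul hp hp5 (u n - u₀) u₀
  have i2 : Integrable (fun x => |(u n - u₀).fn x| * |u₀.fn x| ^ p) := by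
    simpa only [mul_comm] using integrable_abs_fn_rpow_mul hp hp5 u₀ (u n - u₀)
  have a1 := integral_sub ((hI (u n)).sub (hI (u n - u₀))) (hI u₀)
  simp only [Pi.sub_apply] at a1
  rw [powInt, powInt, powInt, ← integral_sub (hI _) (hI _), ← a1, ← integral_add i1 i2,
    ← integral_const_mul]
  refine (norm_integral_le_integral_norm _).trans (integral_mono_of_nonneg
    (.of_forall fun x => norm_nonneg _) ((i1.add i2).const_mul _) ?_)
  filter_upwards [fn_sub (u n) u₀] with x hx
  have := abs_brezis_lieb_le hp ((u n).fn x - u₀.fn x) (u₀.fn x)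
  rw [sub_add_cancel] at this
  rw [hx, Real.norm_eq_abs]
  refine this.trans (le_of_eq ?_)
  ring

/-- The weight `η` is chosen small against the uniform bound on `u`, and only then is `n` taken
large to absorb `η^{-p}∫|r_n|^{p+1}`. -/
theorem tendsto_powerL_of_powInt (hp : 2 < p) (hp5 : p < 5) {u r : ℕ → H1} {M : ℝ}
    (hu : ∀ n, ‖u n‖ ≤ M) (hr : Tendsto (fun n => powInt (p + 1) (r n)) atTop (𝓝 0)) :
    Tendsto (fun n => powerL hp hp5 (u n) (r n)) atTop (𝓝 0) := by
  have hM0 : 0 ≤ M := (norm_nonneg _).trans (hu 0)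
  obtain ⟨C, hC0, hC⟩ := exists_powInt_le (by linarith : 2 ≤ p + 1) (by linarith)
  set B := C * M ^ (p + 1)
  have hB : ∀ n, powInt (p + 1) (u n) ≤ B := fun n => (hC _).trans
    (mul_le_mul_of_nonneg_left (Real.rpow_le_rpow (norm_nonneg _) (hu n) (by linarith)) hC0.le)
  have hB0 : 0 ≤ B := by positivity
  rw [Metric.tendsto_atTop]
  intro ε hε
  set η := ε / (2 * (B + 1))
  have hη : 0 < η := by positivity
  obtain ⟨n₀, hn₀⟩ := Metric.tendsto_atTop.1 hr (ε / 2 / η ^ (-p)) (by positivity)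
  refine ⟨n₀, fun n hn => ?_⟩
  have h1 := hn₀ n hn
  rw [Real.dist_0_eq_abs, abs_of_nonneg (powInt_nonneg _ _), lt_div_iff₀' (by positivity)] at h1
  rw [Real.dist_0_eq_abs, powerL_apply]
  have h2 : η * powInt (p + 1) (u n) ≤ ε / 2 := by
    calc _ ≤ η * (B + 1) := by gcongr; linarith [hB n]
      _ = _ := by simp only [η]; field_simp
  linarith [abs_integral_power_mul_le hp hp5 hη (u n) (r n)]

end Functional

/-! ### Cutoffs of weakly null sequences -/

theorem integrable_sq_fn (u : H1) : Integrable (fun x => |u.fn x| ^ 2) :=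
  (memLp_fn u).integrable_norm_pow (by norm_num)

theorem integrable_sq_grad (u : H1) : Integrable (fun x => ‖u.grad x‖ ^ 2) :=
  (memLp_grad u).integrable_norm_pow (by norm_num)

theorem powInt_two_eq (u : H1) : powInt 2 u = ∫ x, |u.fn x| ^ 2 := by
  rw [powInt_two, integral_sq_eq]

/-- The product of an element of `H¹` with `ballCutoff R`. -/
def cutBall {R : ℝ} (hR : 0 < R) (u : H1) : H1 :=
  u.cutoff (contDiff_ballCutoff R) (hasCompactSupport_ballCutoff hR)

theorem fn_cutBall {R : ℝ} (hR : 0 < R) (u : H1) :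
    (cutBall hR u).fn =ᵐ[volume] fun x => ballCutoff R x * u.fn x := H1.fn_cutoff _ _ _

theorem grad_cutBall {R : ℝ} (hR : 0 < R) (u : H1) :
    (cutBall hR u).grad =ᵐ[volume]
      fun x => ballCutoff R x • u.grad x + u.fn x • gradient (ballCutoff R) x :=
  H1.grad_cutoff _ _ _

theorem abs_ballCutoff_mul_le (R : ℝ) (x : R3) (s : ℝ) : |ballCutoff R x * s| ≤ |s| := by
  rw [abs_mul, abs_of_nonneg (ballCutoff_nonneg R x)]
  exact mul_le_of_le_one_left (abs_nonneg s) (ballCutoff_le_one R x)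

theorem powInt_cutBall_le {R : ℝ} (hR : 0 < R) (u : H1) :
    powInt 2 (cutBall hR u) ≤ ∫ x in Metric.closedBall 0 (2 * R), |u.fn x| ^ 2 := by
  rw [powInt_two_eq, ← integral_indicator Metric.isClosed_closedBall.measurableSet]
  refine integral_mono_ae (integrable_sq_fn _)
    ((integrable_sq_fn u).indicator Metric.isClosed_closedBall.measurableSet) ?_
  filter_upwards [fn_cutBall hR u] with x hx
  rw [hx]
  by_cases h : x ∈ Metric.closedBall (0 : R3) (2 * R)
  · rw [Set.indicator_of_mem h]
    exact pow_le_pow_left₀ (abs_nonneg _) (abs_ballCutoff_mul_le R x _) 2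
  · rw [Set.indicator_of_notMem h, ballCutoff_eq_zero hR]
    · simp
    · rw [mem_closedBall_zero_iff, not_le] at h
      exact h.le

theorem gradSq_cutBall_le {R : ℝ} (hR : 0 < R) {C : ℝ}
    (hC : ∀ x, ‖gradient (ballCutoff R) x‖ ≤ C) (u : H1) :
    gradSq (cutBall hR u) ≤ 2 * (∫ x in Metric.closedBall 0 (2 * R), ‖u.grad x‖ ^ 2)
      + 2 * C ^ 2 * ∫ x in Metric.closedBall 0 (2 * R), |u.fn x| ^ 2 := by
  have hS : MeasurableSet (Metric.closedBall (0 : R3) (2 * R)) :=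
    Metric.isClosed_closedBall.measurableSet
  have i1 := ((integrable_sq_grad u).indicator hS).const_mul 2
  have i2 := ((integrable_sq_fn u).indicator hS).const_mul (2 * C ^ 2)
  rw [← integral_indicator hS, ← integral_indicator hS, ← integral_const_mul, ← integral_const_mul,
    ← integral_add i1 i2]
  refine integral_mono_ae (integrable_sq_grad _) (i1.add i2) ?_
  filter_upwards [grad_cutBall hR u] with x hx
  rw [hx]
  by_cases h : x ∈ Metric.closedBall (0 : R3) (2 * R)
  · simp only [Set.indicator_of_mem h]
    have h1 : ‖ballCutoff R x • u.grad x + u.fn x • gradient (ballCutoff R) x‖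
        ≤ ‖u.grad x‖ + C * |u.fn x| := by
      refine (norm_add_le _ _).trans ?_
      rw [norm_smul, norm_smul, Real.norm_of_nonneg (ballCutoff_nonneg R x), Real.norm_eq_abs,
        mul_comm C]
      exact add_le_add (mul_le_of_le_one_left (norm_nonneg _) (ballCutoff_le_one R x))
        (mul_le_mul_of_nonneg_left (hC x) (abs_nonneg _))
    calc _ ≤ (‖u.grad x‖ + C * |u.fn x|) ^ 2 := by gcongr
      _ ≤ _ := by nlinarith [sq_nonneg (‖u.grad x‖ - C * |u.fn x|)]
  · simp only [Set.indicator_of_notMem h]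
    rw [mem_closedBall_zero_iff, not_le] at h
    rw [ballCutoff_eq_zero hR h.le, gradient_ballCutoff_eq_zero hR h]
    simp

theorem WeaklyTendsto.tendsto_setIntegral_sq' {v : ℕ → H1} (h : WeaklyTendsto v 0) (R : ℝ) :
    Tendsto (fun n => ∫ x in Metric.closedBall 0 R, |(v n).fn x| ^ 2) atTop (𝓝 0) := by
  simpa only [Real.rpow_two] using h.tendsto_setIntegral_sq R

/-! ### The potential -/

section Potential

variable {V : R3 → ℝ} {Vinf : ℝ}

theorem CondV2.exists_lt_of_norm_gt (hV2 : CondV2 V Vinf) {m : ℝ} (hm : m < Vinf) :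
    ∃ R : ℝ, 0 < R ∧ ∀ x, R < ‖x‖ → m < V x := by
  have h1 : (m : EReal) < liminf (fun y => (V y : EReal)) (cocompact R3) := by
    rw [hV2.liminf_eq]; exact_mod_cast hm
  have h2 := eventually_lt_of_lt_liminf h1
  obtain ⟨K, hK, hKs⟩ := mem_cocompact.1 h2
  obtain ⟨R, hR, hb⟩ := hK.isBounded.exists_pos_norm_le
  refine ⟨R, hR, fun x hx => ?_⟩
  have : x ∈ Kᶜ := fun hxK => absurd (hb x hxK) (not_le.2 hx)
  exact_mod_cast hKs this

theorem CondV3.integrable_sub (hV3 : CondV3 V) (Vinf : ℝ) (u : H1) :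
    Integrable (fun x => (Vinf - V x) * |u.fn x| ^ 2) := by
  refine (((integrable_sq_fn u).const_mul Vinf).sub (hV3.integrable u)).congr
    (.of_forall fun x => ?_)
  simp only [Pi.sub_apply]
  ring

/-- Integrability of `V|u|²` for cutoff functions `u` makes `V` times their squares measurable; at
each point these products eventually equal `V`. -/
theorem CondV3.aestronglyMeasurable (hV3 : CondV3 V) : AEStronglyMeasurable V volume := by
  have hpos : ∀ n : ℕ, (0 : ℝ) < n + 1 := fun n => by positivity
  refine aestronglyMeasurable_of_tendsto_ae atTop
    (f := fun n : ℕ => fun x => V x * |ballCutoff (n + 1) x| ^ 2) (fun n => ?_)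
    (.of_forall fun x => ?_)
  · refine (hV3.integrable (H1.ofTest (contDiff_ballCutoff _)
      (hasCompactSupport_ballCutoff (hpos n)))).1.congr ?_
    filter_upwards [H1.fn_ofTest (contDiff_ballCutoff _)
      (hasCompactSupport_ballCutoff (hpos n))] with x hx
    rw [hx]
  · refine tendsto_const_nhds.congr' ?_
    filter_upwards [eventually_ge_atTop ⌈‖x‖⌉₊] with n hn
    have : ‖x‖ ≤ n + 1 := (Nat.le_ceil _).trans (by
      have : ((⌈‖x‖⌉₊ : ℕ) : ℝ) ≤ n := by exact_mod_cast hn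
      linarith)
    rw [ballCutoff_eq_one (hpos n) this]
    simp

theorem memLp_sqrt_mul (hV2 : CondV2 V Vinf) (hV3 : CondV3 V) (u : H1) :
    MemLp (fun x => √(Vinf - V x) * u.fn x) 2 volume := by
  rw [memLp_two_iff_integrable_sq]
  · refine (hV3.integrable_sub Vinf u).congr ?_
    filter_upwards [hV2.le_ae] with x hx
    rw [mul_pow, Real.sq_sqrt (by linarith), sq_abs]
  · exact ((aestronglyMeasurable_const.sub hV3.aestronglyMeasurable).aemeasurable.sqrt.mul
      (memLp_fn u).1.aemeasurable).aestronglyMeasurable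

theorem exists_subseq_tendsto_ae {f : ℕ → Lp ℝ 2 (volume : Measure R3)}
    {g : Lp ℝ 2 (volume : Measure R3)} (h : Tendsto f atTop (𝓝 g)) :
    ∃ s : ℕ → ℕ, StrictMono s ∧ ∀ᵐ x, Tendsto (fun n => f (s n) x) atTop (𝓝 (g x)) :=
  (tendstoInMeasure_of_tendsto_Lp h).exists_seq_tendsto_ae

/-- The linear map `u ↦ (V_∞ - V)^{1/2} u` from `H¹` to `L²`. -/
def weightLinear (hV2 : CondV2 V Vinf) (hV3 : CondV3 V) :
    H1 →ₗ[ℝ] Lp ℝ 2 (volume : Measure R3) where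
  toFun u := (memLp_sqrt_mul hV2 hV3 u).toLp _
  map_add' u v := by
    refine Lp.ext ?_
    filter_upwards [(memLp_sqrt_mul hV2 hV3 (u + v)).coeFn_toLp,
      (memLp_sqrt_mul hV2 hV3 u).coeFn_toLp, (memLp_sqrt_mul hV2 hV3 v).coeFn_toLp,
      Lp.coeFn_add ((memLp_sqrt_mul hV2 hV3 u).toLp _) ((memLp_sqrt_mul hV2 hV3 v).toLp _),
      fn_add u v] with x h1 h2 h3 h4 h5
    rw [h1, h4, Pi.add_apply, h2, h3, h5]
    ring
  map_smul' c u := by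
    refine Lp.ext ?_
    filter_upwards [(memLp_sqrt_mul hV2 hV3 (c • u)).coeFn_toLp,
      (memLp_sqrt_mul hV2 hV3 u).coeFn_toLp,
      Lp.coeFn_smul c ((memLp_sqrt_mul hV2 hV3 u).toLp _), fn_smul c u] with x h1 h2 h4 h5
    rw [h1, RingHom.id_apply, h4, Pi.smul_apply, h2, h5, smul_eq_mul]
    ring

/-- The bounded operator `u ↦ (V_∞ - V)^{1/2} u` from `H¹` to `L²`. -/
def weightL (hV2 : CondV2 V Vinf) (hV3 : CondV3 V) : H1 →L[ℝ] Lp ℝ 2 (volume : Measure R3) where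
  toLinearMap := weightLinear hV2 hV3
  cont := by
    -- Boundedness comes from the closed graph theorem: along a common almost everywhere convergent
    -- subsequence the limit must be `(V_∞ - V)^{1/2}x`.
    refine LinearMap.continuous_of_seq_closed_graph _ fun u x y hu hy => ?_
    obtain ⟨s, hs, h1⟩ := exists_subseq_tendsto_ae ((toL2.continuous.tendsto x).comp hu)
    obtain ⟨s', hs', h2⟩ := exists_subseq_tendsto_ae (hy.comp hs.tendsto_atTop)
    refine Lp.ext ?_
    filter_upwards [h1, h2, (memLp_sqrt_mul hV2 hV3 x).coeFn_toLp, ae_all_iff.2 fun n =>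
      (memLp_sqrt_mul hV2 hV3 (u n)).coeFn_toLp] with z h1 h2 h3 h4
    refine (tendsto_nhds_unique h2 ?_)
    refine Tendsto.congr (fun n => (h4 (s (s' n))).symm) ?_
    refine Eq.subst (motive := fun t => Tendsto _ atTop (𝓝 t)) h3.symm ?_
    exact (h1.comp hs'.tendsto_atTop).const_mul _

theorem coeFn_weightL (hV2 : CondV2 V Vinf) (hV3 : CondV3 V) (u : H1) :
    weightL hV2 hV3 u =ᵐ[volume] fun x => √(Vinf - V x) * u.fn x :=
  (memLp_sqrt_mul hV2 hV3 u).coeFn_toLp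

theorem norm_weightL_sq (hV2 : CondV2 V Vinf) (hV3 : CondV3 V) (u : H1) :
    ‖weightL hV2 hV3 u‖ ^ 2 = ∫ x, (Vinf - V x) * |u.fn x| ^ 2 := by
  rw [norm_Lp_sq]
  refine integral_congr_ae ?_
  filter_upwards [coeFn_weightL hV2 hV3 u, hV2.le_ae] with x h1 h2
  rw [h1, norm_mul, mul_pow, Real.norm_of_nonneg (Real.sqrt_nonneg _), Real.sq_sqrt (by linarith),
    Real.norm_eq_abs]

/-- Writing the potential term through squared norms of bounded operators yields its
differentiability and, after polarisation, weak continuity. -/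
theorem potSq_eq (hV2 : CondV2 V Vinf) (hV3 : CondV3 V) (u : H1) :
    potSq V u = Vinf * ‖toL2 u‖ ^ 2 - ‖weightL hV2 hV3 u‖ ^ 2 := by
  rw [norm_weightL_sq, ← integral_sq_eq, ← integral_const_mul,
    ← integral_sub ((integrable_sq_fn u).const_mul _) (hV3.integrable_sub Vinf u), potSq]
  exact integral_congr_ae (.of_forall fun x => by simp only; ring)

theorem potSq_const (u : H1) : potSq (fun _ => Vinf) u = Vinf * ‖toL2 u‖ ^ 2 := by
  rw [potSq, integral_const_mul, integral_sq_eq]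

theorem CondV3.exists_le (hV3 : CondV3 V) :
    ∃ C : ℝ, 0 < C ∧ ∀ u : H1, C * ‖toL2 u‖ ^ 2 ≤ gradSq u + potSq V u := by
  obtain ⟨C, hC, hglb⟩ := hV3.inf_pos
  refine ⟨C, hC, fun u => ?_⟩
  by_cases hu : toL2 u = 0
  · have h0 : potSq V u = 0 := by
      have : (u.fn) =ᵐ[volume] 0 := by
        rw [← coe_toL2, hu]; exact Lp.coeFn_zero ℝ 2 volume
      rw [potSq, integral_eq_zero_of_ae]
      filter_upwards [this] with x hx
      simp [hx]
    rw [hu, h0, gradSq_eq]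
    simp
  · have hne : u ≠ 0 := by rintro rfl; exact hu (map_zero _)
    have h1 := hglb.1 ⟨u, hne, rfl⟩
    have h2 : 0 < ‖toL2 u‖ ^ 2 := by have := norm_pos_iff.2 hu; positivity
    rw [powInt_two, le_div_iff₀ h2] at h1
    exact h1

/-- The limit of the potential at infinity is positive. -/
theorem Vinf_pos (hV2 : CondV2 V Vinf) (hV3 : CondV3 V) : 0 < Vinf := by
  by_contra hcon
  push Not at hcon
  obtain ⟨C, hC, hle⟩ := hV3.exists_le
  obtain ⟨D, hD, hgrad⟩ := exists_norm_gradient_ballCutoff_le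
  set β := volume.real (Metric.closedBall (0 : R3) 1)
  have hβ : 0 < β := ENNReal.toReal_pos (Metric.measure_closedBall_pos volume _ one_pos).ne'
    measure_closedBall_lt_top.ne
  have hvol : ∀ R : ℝ, 0 < R → volume.real (Metric.closedBall (0 : R3) R) = R ^ 3 * β := by
    intro R hR
    rw [Measure.real, Measure.addHaar_closedBall' volume _ hR.le, ENNReal.toReal_mul,
      ENNReal.toReal_ofReal (by positivity)]
    simp [β, Measure.real]
  -- If `V_∞ ≤ 0`, the form in `(V₃)` is at most the Dirichlet integral. For the cutoff of radius
  -- `R` that integral is at most of order `R`, while the squared `L²` norm is at least of order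
  -- `R³`.
  have key : ∀ R : ℝ, 0 < R → C * R ^ 2 ≤ 8 * D ^ 2 := by
    intro R hR
    set u := H1.ofTest (contDiff_ballCutoff R) (hasCompactSupport_ballCutoff hR)
    have hfn := H1.fn_ofTest (contDiff_ballCutoff R) (hasCompactSupport_ballCutoff hR)
    have hgr := H1.grad_ofTest (contDiff_ballCutoff R) (hasCompactSupport_ballCutoff hR)
    have h1 : potSq V u ≤ 0 := by
      rw [potSq_eq hV2 hV3]
      nlinarith [sq_nonneg ‖toL2 u‖, sq_nonneg ‖weightL hV2 hV3 u‖]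
    have hS : ∀ r : ℝ, MeasurableSet (Metric.closedBall (0 : R3) r) := fun r =>
      Metric.isClosed_closedBall.measurableSet
    have h2 : R ^ 3 * β ≤ ‖toL2 u‖ ^ 2 := by
      rw [← integral_sq_eq, ← hvol R hR, ← integral_indicator_one (hS R)]
      refine integral_mono_ae ((integrable_indicator_iff (hS R)).2
        (integrableOn_const measure_closedBall_lt_top.ne)) (integrable_sq_fn u) ?_
      filter_upwards [hfn] with x hx
      rw [hx]
      by_cases h : x ∈ Metric.closedBall (0 : R3) R
      · rw [Set.indicator_of_mem h, ballCutoff_eq_one hR (by simpa using h)]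
        simp
      · rw [Set.indicator_of_notMem h]
        positivity
    have h3 : gradSq u ≤ (D / R) ^ 2 * ((2 * R) ^ 3 * β) := by
      rw [← hvol (2 * R) (by positivity), ← integral_indicator_one (hS (2 * R)),
        ← integral_const_mul]
      refine integral_mono_ae (integrable_sq_grad u) (((integrable_indicator_iff (hS _)).2
        (integrableOn_const measure_closedBall_lt_top.ne)).const_mul _) ?_
      filter_upwards [hgr] with x hx
      rw [hx]
      by_cases h : x ∈ Metric.closedBall (0 : R3) (2 * R)
      · rw [Set.indicator_of_mem h, Pi.one_apply, mul_one]
        gcongr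
        exact hgrad R hR x
      · rw [mem_closedBall_zero_iff, not_le] at h
        rw [gradient_ballCutoff_eq_zero hR h, norm_zero, zero_pow two_ne_zero]
        have : 0 ≤ (Metric.closedBall (0 : R3) (2 * R)).indicator (1 : R3 → ℝ) x :=
          Set.indicator_nonneg (fun _ _ => zero_le_one) x
        positivity
    have h4 := hle u
    have h5 : C * (R ^ 3 * β) ≤ (D / R) ^ 2 * ((2 * R) ^ 3 * β) := by
      have := mul_le_mul_of_nonneg_left h2 hC.le
      linarith
    have h6 : (D / R) ^ 2 * ((2 * R) ^ 3 * β) = 8 * D ^ 2 * (R * β) := by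
      field_simp; ring
    rw [h6] at h5
    have h7 : C * R ^ 2 * (R * β) ≤ 8 * D ^ 2 * (R * β) := by linarith
    exact le_of_mul_le_mul_right h7 (by positivity)
  -- This radius gives `9D² ≤ 8D²`.
  have h := key (D * (3 / √C)) (by positivity)
  rw [mul_pow, div_pow, Real.sq_sqrt hC.le] at h
  have : C * (D ^ 2 * (3 ^ 2 / C)) = 9 * D ^ 2 := by field_simp; ring
  nlinarith [sq_pos_of_pos hD]

/-- The weight `V_∞ - V` does not see translations to infinity. -/
theorem tendsto_weightL_translateL (hV2 : CondV2 V Vinf) (hV3 : CondV3 V) {y : ℕ → R3}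
    (hy : Tendsto (fun n => ‖y n‖) atTop atTop) (w : H1) :
    Tendsto (fun n => weightL hV2 hV3 (translateL (y n) w)) atTop (𝓝 0) := by
  set T := weightL hV2 hV3
  obtain ⟨D, hD, hgrad⟩ := exists_norm_gradient_ballCutoff_le
  suffices h : Tendsto (fun n => ‖T (translateL (y n) w)‖ ^ 2) atTop (𝓝 0) by
    rw [tendsto_zero_iff_norm_tendsto_zero]
    have := h.sqrt
    simpa [Real.sqrt_sq] using this
  rw [Metric.tendsto_atTop]
  intro ε hε
  set ε' := ε / (2 * (‖w‖ ^ 2 + 1))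
  have hε' : 0 < ε' := by positivity
  obtain ⟨R, hR, hout⟩ := hV2.exists_lt_of_norm_gt (by linarith : Vinf - ε' < Vinf)
  have hfn := tendsto_setIntegral_comp_sub (integrable_sq_fn w) hy (2 * R)
  have hgr := tendsto_setIntegral_comp_sub (integrable_sq_grad w) hy (2 * R)
  have hlim : Tendsto (fun n => ‖T‖ ^ 2 * ((∫ x in Metric.closedBall 0 (2 * R),
      |w.fn (x - y n)| ^ 2) + (2 * (∫ x in Metric.closedBall 0 (2 * R), ‖w.grad (x - y n)‖ ^ 2)
      + 2 * (D / R) ^ 2 * ∫ x in Metric.closedBall 0 (2 * R), |w.fn (x - y n)| ^ 2)))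
      atTop (𝓝 0) := by
    simpa using (hfn.add ((hgr.const_mul 2).add
      (hfn.const_mul (2 * (D / R) ^ 2)))).const_mul (‖T‖ ^ 2)
  obtain ⟨n₀, hn₀⟩ := Metric.tendsto_atTop.1 hlim (ε / 2) (by positivity)
  refine ⟨n₀, fun n hn => ?_⟩
  have h1 := hn₀ n hn
  rw [Real.dist_0_eq_abs] at h1 ⊢
  have h1 := (le_abs_self _).trans_lt h1
  rw [abs_of_nonneg (by positivity)]
  set v := translateL (y n) w
  have e1 : ∫ x in Metric.closedBall 0 (2 * R), |v.fn x| ^ 2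
      = ∫ x in Metric.closedBall 0 (2 * R), |w.fn (x - y n)| ^ 2 :=
    integral_congr_ae (ae_restrict_of_ae ((fn_translateL (y n) w).mono fun x hx => by
      simp only [v, hx]))
  have e2 : ∫ x in Metric.closedBall 0 (2 * R), ‖v.grad x‖ ^ 2
      = ∫ x in Metric.closedBall 0 (2 * R), ‖w.grad (x - y n)‖ ^ 2 :=
    integral_congr_ae (ae_restrict_of_ae ((grad_translateL (y n) w).mono fun x hx => by
      simp only [v, hx]))
  rw [← e1, ← e2] at h1
  -- Outside the ball of radius `R` the weight is below `ε'`. Inside, only the boundedness of `T` is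
  -- used, and the cut-off translate tends to zero in `H¹`.
  have h2 : ‖T v‖ ^ 2 ≤ ‖T (cutBall hR v)‖ ^ 2 + ε' * ‖toL2 v‖ ^ 2 := by
    rw [norm_weightL_sq, norm_weightL_sq, ← integral_sq_eq, ← integral_const_mul,
      ← integral_add (hV3.integrable_sub Vinf _) ((integrable_sq_fn v).const_mul _)]
    refine integral_mono_ae (hV3.integrable_sub Vinf v)
      ((hV3.integrable_sub Vinf _).add ((integrable_sq_fn v).const_mul _)) ?_
    filter_upwards [fn_cutBall hR v, hV2.le_ae] with x hx hVx
    rw [hx]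
    have p1 : 0 ≤ (Vinf - V x) * |ballCutoff R x * v.fn x| ^ 2 :=
      mul_nonneg (by linarith) (by positivity)
    rcases le_or_gt ‖x‖ R with h | h
    · rw [ballCutoff_eq_one hR h, one_mul]
      have : 0 ≤ ε' * |v.fn x| ^ 2 := by positivity
      linarith
    · have := hout x h
      have : (Vinf - V x) * |v.fn x| ^ 2 ≤ ε' * |v.fn x| ^ 2 := by
        gcongr; linarith
      linarith
  have h3 : ‖T (cutBall hR v)‖ ^ 2 ≤ ‖T‖ ^ 2 * ‖cutBall hR v‖ ^ 2 := by
    rw [← mul_pow]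
    gcongr
    exact T.le_opNorm _
  have h4 : ‖cutBall hR v‖ ^ 2 ≤ (∫ x in Metric.closedBall 0 (2 * R), |v.fn x| ^ 2)
      + (2 * (∫ x in Metric.closedBall 0 (2 * R), ‖v.grad x‖ ^ 2)
        + 2 * (D / R) ^ 2 * ∫ x in Metric.closedBall 0 (2 * R), |v.fn x| ^ 2) := by
    rw [norm_sq_eq]
    exact add_le_add (powInt_cutBall_le hR v) (gradSq_cutBall_le hR (hgrad R hR) v)
  have h5 : ε' * ‖toL2 v‖ ^ 2 ≤ ε / 2 := by
    have : ‖toL2 v‖ ≤ ‖w‖ := by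
      rw [← LinearIsometry.norm_map (translateL (y n)) w]; exact norm_toL2_le v
    calc _ ≤ ε' * (‖w‖ ^ 2 + 1) := by
          have : ‖toL2 v‖ ^ 2 ≤ ‖w‖ ^ 2 := by gcongr
          gcongr
          linarith
      _ = _ := by simp only [ε']; field_simp
  have h6 := mul_le_mul_of_nonneg_left h4 (sq_nonneg ‖T‖)
  linarith

/-- A form that is bounded below relative to `L²` is asymptotically nonnegative along weakly null
sequences. -/
theorem eventually_form_ge {a M : ℝ} (ha : 0 < a) (hV2 : CondV2 V Vinf) (hV3 : CondV3 V)
    (hM : ∀ v : H1, -M * powInt 2 v ≤ a * gradSq v + potSq V v)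
    {r : ℕ → H1} (hr : WeaklyTendsto r 0) {ε : ℝ} (hε : 0 < ε) :
    ∀ᶠ n in atTop, -ε < a * gradSq (r n) + potSq V (r n) := by
  obtain ⟨B, hB⟩ := hr.bounded
  obtain ⟨D, hD, hgrad⟩ := exists_norm_gradient_ballCutoff_le
  -- Outside this ball `V > 0`, so cutting off only lowers `∫V|v|²`; the lower bound of the form is
  -- needed only for the cut-off function, whose `L²` norm tends to zero.
  obtain ⟨R, hR, hout⟩ := hV2.exists_lt_of_norm_gt (Vinf_pos hV2 hV3)
  set C := D / R
  -- The Dirichlet integral of the cutoff exceeds that of `v` by at most the fraction `η`, plus a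
  -- local `L²` term; this `η` makes the excess cost at most `ε/2`.
  set η := ε / (2 * a * (B ^ 2 + 1))
  have hη : 0 < η := by positivity
  have hloc := hr.tendsto_setIntegral_sq' (2 * R)
  have hlim := hloc.const_mul (|M| + a * (C ^ 2 * (1 + 1 / η)))
  rw [mul_zero] at hlim
  filter_upwards [(tendsto_order.1 hlim).2 (ε / 2) (by positivity)] with n hn
  set v := r n
  set S := Metric.closedBall (0 : R3) (2 * R)
  have hS : MeasurableSet S := Metric.isClosed_closedBall.measurableSet
  have i1 := (integrable_sq_grad v).const_mul (a * (1 + η))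
  have i2 := hV3.integrable v
  have i3 := ((integrable_sq_fn v).indicator hS).const_mul (a * (C ^ 2 * (1 + 1 / η)))
  have j1 := (integrable_sq_grad (cutBall hR v)).const_mul a
  have j2 := hV3.integrable (cutBall hR v)
  have hmono : ∫ x, ((a * ‖(cutBall hR v).grad x‖ ^ 2) + V x * |(cutBall hR v).fn x| ^ 2)
      ≤ ∫ x, (a * (1 + η) * ‖v.grad x‖ ^ 2 + V x * |v.fn x| ^ 2
        + a * (C ^ 2 * (1 + 1 / η)) * S.indicator (fun x => |v.fn x| ^ 2) x) := by
    refine integral_mono_ae (j1.add j2) ((i1.add i2).add i3) ?_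
    filter_upwards [fn_cutBall hR v, grad_cutBall hR v] with x h1 h2
    simp only [h1, h2]
    have hV : V x * |ballCutoff R x * v.fn x| ^ 2 ≤ V x * |v.fn x| ^ 2 := by
      rcases le_or_gt ‖x‖ R with h | h
      · rw [ballCutoff_eq_one hR h, one_mul]
      · have := hout x h
        exact mul_le_mul_of_nonneg_left
          (pow_le_pow_left₀ (abs_nonneg _) (abs_ballCutoff_mul_le R x _) 2) this.le
    have hG : ‖ballCutoff R x • v.grad x + v.fn x • gradient (ballCutoff R) x‖ ^ 2
        ≤ (1 + η) * ‖v.grad x‖ ^ 2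
          + C ^ 2 * (1 + 1 / η) * S.indicator (fun x => |v.fn x| ^ 2) x := by
      by_cases h : x ∈ S
      · rw [Set.indicator_of_mem h]
        have h1 : ‖ballCutoff R x • v.grad x + v.fn x • gradient (ballCutoff R) x‖
            ≤ ‖v.grad x‖ + C * |v.fn x| := by
          refine (norm_add_le _ _).trans ?_
          rw [norm_smul, norm_smul, Real.norm_of_nonneg (ballCutoff_nonneg R x), Real.norm_eq_abs,
            mul_comm C]
          exact add_le_add (mul_le_of_le_one_left (norm_nonneg _) (ballCutoff_le_one R x))
            (mul_le_mul_of_nonneg_left (hgrad R hR x) (abs_nonneg _))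
        have h2 : (‖v.grad x‖ + C * |v.fn x|) ^ 2
            ≤ (1 + η) * ‖v.grad x‖ ^ 2 + C ^ 2 * (1 + 1 / η) * |v.fn x| ^ 2 := by
          have h3 : 0 ≤ (η * ‖v.grad x‖ - C * |v.fn x|) ^ 2 / η := by positivity
          have h4 : (η * ‖v.grad x‖ - C * |v.fn x|) ^ 2 / η = η * ‖v.grad x‖ ^ 2
              - 2 * (‖v.grad x‖ * (C * |v.fn x|)) + C ^ 2 * (1 / η) * |v.fn x| ^ 2 := by
            field_simp; ring
          rw [h4] at h3
          nlinarith
        exact (pow_le_pow_left₀ (norm_nonneg _) h1 2).trans h2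
      · rw [Set.indicator_of_notMem h]
        rw [mem_closedBall_zero_iff, not_le] at h
        rw [ballCutoff_eq_zero hR h.le, gradient_ballCutoff_eq_zero hR h]
        simp only [zero_smul, smul_zero, add_zero, norm_zero, mul_zero, zero_pow two_ne_zero]
        positivity
    have := mul_le_mul_of_nonneg_left hG ha.le
    linarith
  rw [integral_add j1 j2, integral_add _ i3, integral_add i1 i2, integral_const_mul,
    integral_const_mul, integral_const_mul, integral_indicator hS] at hmono
  rotate_left
  · exact i1.add i2
  change a * gradSq (cutBall hR v) + potSq V (cutBall hR v)
    ≤ a * (1 + η) * gradSq v + potSq V v + _ at hmono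
  have h1 := hM (cutBall hR v)
  have h2 := powInt_cutBall_le hR v
  have h3 : -M * powInt 2 (cutBall hR v) ≥ -|M| * ∫ x in S, |v.fn x| ^ 2 := by
    have hp := powInt_nonneg 2 (cutBall hR v)
    have := mul_le_mul_of_nonneg_right (le_abs_self M) hp
    have := mul_le_mul_of_nonneg_left h2 (abs_nonneg M)
    linarith
  have h4 : a * η * gradSq v ≤ ε / 2 := by
    have : gradSq v ≤ B ^ 2 + 1 := by
      have : gradSq v ≤ B ^ 2 := (gradSq_le v).trans (by gcongr; exact hB n)
      linarith
    calc _ ≤ a * η * (B ^ 2 + 1) := by gcongr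
      _ = _ := by simp only [η]; field_simp
  linarith

end Potential

/-! ### Derivatives of the functionals -/

section Derivative

variable {V : R3 → ℝ} {Vinf p : ℝ}

/-- The functional `ψ ↦ κ ∫ Du·Dψ + ∫ V u ψ - λ ∫ |u|^{p-1} u ψ`. -/
def frozenDeriv (hV2 : CondV2 V Vinf) (hV3 : CondV3 V) (hp : 2 < p) (hp5 : p < 5) (lam κ : ℝ)
    (u : H1) : H1 →L[ℝ] ℝ :=
  κ • (innerSL ℝ (gradL u)).comp gradL + Vinf • (innerSL ℝ (toL2 u)).comp toL2
    - (innerSL ℝ (weightL hV2 hV3 u)).comp (weightL hV2 hV3) - lam • powerL hp hp5 u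

variable (hV2 : CondV2 V Vinf) (hV3 : CondV3 V) (hp : 2 < p) (hp5 : p < 5)

theorem frozenDeriv_apply (lam κ : ℝ) (u ψ : H1) :
    frozenDeriv hV2 hV3 hp hp5 lam κ u ψ
      = κ * inner ℝ (gradL u) (gradL ψ) + Vinf * inner ℝ (toL2 u) (toL2 ψ)
        - inner ℝ (weightL hV2 hV3 u) (weightL hV2 hV3 ψ) - lam * powerL hp hp5 u ψ := rfl

theorem frozenDeriv_self (lam κ : ℝ) (u : H1) :
    frozenDeriv hV2 hV3 hp hp5 lam κ u u
      = κ * gradSq u + potSq V u - lam * powInt (p + 1) u := by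
  rw [frozenDeriv_apply, powerL_self, real_inner_self_eq_norm_sq, real_inner_self_eq_norm_sq,
    real_inner_self_eq_norm_sq, potSq_eq hV2 hV3, gradSq_eq]
  ring

theorem hasFDerivAt_norm_sq_clm {E : Type*} [NormedAddCommGroup E] [InnerProductSpace ℝ E]
    (L : H1 →L[ℝ] E) (u : H1) :
    HasFDerivAt (fun u => ‖L u‖ ^ 2) ((2 : ℝ) • (innerSL ℝ (L u)).comp L) u := by
  have h : HasFDerivAt (fun u => ‖L u‖ ^ 2) _ u := L.hasFDerivAt.norm_sq
  refine h.congr_fderiv ?_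
  ext ψ
  simp

theorem energyJ_eq (a b lam A : ℝ) :
    energyJ a b p lam A V = fun u => (a + b * A ^ 2) / 2 * ‖gradL u‖ ^ 2
      + 1 / 2 * (Vinf * ‖toL2 u‖ ^ 2 - ‖weightL hV2 hV3 u‖ ^ 2)
      - lam / (p + 1) * powInt (p + 1) u := by
  ext u
  rw [energyJ, gradSq_eq, potSq_eq hV2 hV3]

theorem energyI_eq (a b lam : ℝ) :
    energyI a b p lam V = fun u => 1 / 2 * (a * ‖gradL u‖ ^ 2
      + (Vinf * ‖toL2 u‖ ^ 2 - ‖weightL hV2 hV3 u‖ ^ 2)) + b / 4 * (‖gradL u‖ ^ 2) ^ 2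
      - lam / (p + 1) * powInt (p + 1) u := by
  ext u
  rw [energyI, gradSq_eq, potSq_eq hV2 hV3]

theorem hasFDerivAt_energyJ (a b lam A : ℝ) (u : H1) :
    HasFDerivAt (energyJ a b p lam A V)
      (frozenDeriv hV2 hV3 hp hp5 lam (a + b * A ^ 2) u) u := by
  rw [energyJ_eq hV2 hV3]
  have h := (((hasFDerivAt_norm_sq_clm gradL u).const_mul ((a + b * A ^ 2) / 2)).add
    ((((hasFDerivAt_norm_sq_clm toL2 u).const_mul Vinf).sub
      (hasFDerivAt_norm_sq_clm (weightL hV2 hV3) u)).const_mul (1 / 2))).sub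
    ((hasFDerivAt_powInt hp hp5 u).const_mul (lam / (p + 1)))
  refine HasFDerivAt.congr_fderiv h ?_
  ext ψ
  have hp1 : p + 1 ≠ 0 := by linarith
  simp only [sub_apply, add_apply, smul_apply, ContinuousLinearMap.comp_apply, innerSL_apply_apply,
    smul_eq_mul, frozenDeriv_apply]
  field_simp
  ring

/-- The quartic term contributes `b∫|Du|²` to the gradient coefficient, so the Kirchhoff functional
has the frozen derivative with `A²` replaced by the current Dirichlet integral. -/
theorem hasFDerivAt_energyI (a b lam : ℝ) (u : H1) :
    HasFDerivAt (energyI a b p lam V)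
      (frozenDeriv hV2 hV3 hp hp5 lam (a + b * gradSq u) u) u := by
  rw [energyI_eq hV2 hV3]
  have h := (((((hasFDerivAt_norm_sq_clm gradL u).const_mul a).add
    (((hasFDerivAt_norm_sq_clm toL2 u).const_mul Vinf).sub
      (hasFDerivAt_norm_sq_clm (weightL hV2 hV3) u))).const_mul (1 / 2)).add
    (((hasFDerivAt_norm_sq_clm gradL u).pow 2).const_mul (b / 4))).sub
    ((hasFDerivAt_powInt hp hp5 u).const_mul (lam / (p + 1)))
  refine HasFDerivAt.congr_fderiv h ?_
  ext ψ
  have hp1 : p + 1 ≠ 0 := by linarith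
  simp only [sub_apply, add_apply, smul_apply, ContinuousLinearMap.comp_apply, innerSL_apply_apply,
    smul_eq_mul, frozenDeriv_apply, gradSq_eq]
  field_simp
  simp
  ring

end Derivative

/-! ### Splitting functionals -/

/-- A translation invariant functional which splits along weakly convergent sequences. -/
structure IsSplitting (Φ : H1 → ℝ) : Prop where
  translateL_eq : ∀ y w, Φ (translateL y w) = Φ w
  tendsto : ∀ (z : ℕ → H1) (w : H1), WeaklyTendsto z w →
    Tendsto (fun n => Φ (z n) - Φ (z n - w)) atTop (𝓝 (Φ w))

theorem isSplitting_gradSq : IsSplitting gradSq where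
  translateL_eq := gradSq_translateL
  tendsto z w h := by
    have h1 := ((h.inner_gradL w).const_mul 2).sub_const (gradSq w)
    have e : 2 * inner ℝ (gradL w) (gradL w) - gradSq w = gradSq w := by
      rw [real_inner_self_eq_norm_sq, gradSq_eq]; ring
    rw [e] at h1
    refine h1.congr fun n => ?_
    rw [gradSq_eq, gradSq_eq, gradSq_eq, map_sub, norm_sub_sq_real]
    ring

theorem isSplitting_norm_sq : IsSplitting fun u => ‖u‖ ^ 2 where
  translateL_eq y w := by rw [LinearIsometry.norm_map]
  tendsto z w h := by
    have h1 := ((weaklyTendsto_iff.1 h w).const_mul 2).sub_const (‖w‖ ^ 2)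
    have e : 2 * inner ℝ w w - ‖w‖ ^ 2 = ‖w‖ ^ 2 := by
      rw [real_inner_self_eq_norm_sq]; ring
    rw [e] at h1
    refine h1.congr fun n => ?_
    rw [norm_sub_sq_real]
    ring

theorem isSplitting_powInt {p : ℝ} (hp : 2 < p) (hp5 : p < 5) : IsSplitting (powInt (p + 1)) where
  translateL_eq := powInt_translateL (p + 1)
  tendsto _ _ h := h.brezisLieb hp hp5

/-! ### Profile decompositions -/

/-- The remainder of a sequence after subtracting the profiles `w 0, …, w l`. -/
def remainder (u : ℕ → H1) (s : ℕ → ℕ) (y : ℕ → ℕ → R3) (w : ℕ → H1) (l n : ℕ) : H1 :=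
  u (s n) - ∑ k ∈ Finset.range (l + 1), translateL (y k n) (w k)

/-- A decomposition of a subsequence of `u` into the weak limit `u₀`, `l` nonzero profiles with
property `P` translated to infinity, and a remainder. -/
structure ProfileDecomp (P : H1 → Prop) (u : ℕ → H1) (u₀ : H1) (s : ℕ → ℕ) (y : ℕ → ℕ → R3)
    (w : ℕ → H1) (l : ℕ) : Prop where
  strictMono : StrictMono s
  w_zero : w 0 = u₀
  y_zero : y 0 = fun _ => 0
  ne_zero : ∀ k, 1 ≤ k → k ≤ l → w k ≠ 0
  prop : ∀ k, 1 ≤ k → k ≤ l → P (w k)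
  escape : ∀ k, 1 ≤ k → k ≤ l → Tendsto (fun n => ‖y k n‖) atTop atTop
  weak : ∀ k, k ≤ l → WeaklyTendsto (fun n => translateL (-(y k n)) (remainder u s y w l n)) 0
  split : ∀ Φ, IsSplitting Φ → Tendsto (fun n => Φ (u (s n)) - Φ (remainder u s y w l n)) atTop
    (𝓝 (∑ k ∈ Finset.range (l + 1), Φ (w k)))

theorem profileDecomp_zero (P : H1 → Prop) {u : ℕ → H1} {u₀ : H1} (h : WeaklyTendsto u u₀) :
    ProfileDecomp P u u₀ id (fun _ _ => 0) (fun _ => u₀) 0 where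
  strictMono := strictMono_id
  w_zero := rfl
  y_zero := rfl
  ne_zero k h1 h2 := by omega
  prop k h1 h2 := by omega
  escape k h1 h2 := by omega
  weak k _ := by
    simpa [remainder, translateL_zero] using h.sub_self
  split Φ hΦ := by
    simpa [remainder, translateL_zero] using hΦ.tendsto u u₀ h

theorem ProfileDecomp.remainder_weak {P : H1 → Prop} {u : ℕ → H1} {u₀ : H1} {s : ℕ → ℕ}
    {y : ℕ → ℕ → R3} {w : ℕ → H1} {l : ℕ} (D : ProfileDecomp P u u₀ s y w l) :
    WeaklyTendsto (remainder u s y w l) 0 := by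
  have := D.weak 0 (Nat.zero_le l)
  simpa [D.y_zero, translateL_zero] using this

/-- Extending a decomposition by a profile `w'` found in its remainder. -/
theorem ProfileDecomp.snoc {P : H1 → Prop} {u : ℕ → H1} {u₀ : H1} {s : ℕ → ℕ}
    {y : ℕ → ℕ → R3} {w : ℕ → H1} {l : ℕ} (D : ProfileDecomp P u u₀ s y w l)
    {s' : ℕ → ℕ} (hs' : StrictMono s') {y' : ℕ → R3} {w' : H1} (hw' : w' ≠ 0) (hPw' : P w')
    {z : ℕ → H1} (hz : WeaklyTendsto z w')
    (hrz : ∀ n, remainder u s y w l (s' n) = translateL (y' n) (z n))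
    (hdiv : ∀ k, k ≤ l → Tendsto (fun n => ‖y k (s' n) - y' n‖) atTop atTop)
    (hy' : Tendsto (fun n => ‖y' n‖) atTop atTop)
    {y'' : ℕ → ℕ → R3} {w'' : ℕ → H1} (yle : ∀ k, k ≤ l → y'' k = fun n => y k (s' n))
    (wle : ∀ k, k ≤ l → w'' k = w k) (ylast : y'' (l + 1) = y') (wlast : w'' (l + 1) = w') :
    ProfileDecomp P u u₀ (s ∘ s') y'' w'' (l + 1) := by
  -- In the frame of the new centre the new remainder is `z n - w'`. This gives its weak vanishing
  -- there and lets the splitting of `Φ` along `z` be added to the old one.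
  have hrem : ∀ n, remainder u (s ∘ s') y'' w'' (l + 1) n = translateL (y' n) (z n - w') := by
    intro n
    have e : ∀ k ∈ Finset.range (l + 1),
        translateL (y'' k n) (w'' k) = translateL (y k (s' n)) (w k) := fun k hk => by
      have hk := Nat.lt_succ_iff.1 (Finset.mem_range.1 hk)
      rw [yle k hk, wle k hk]
    rw [remainder, Finset.sum_range_succ, ylast, wlast, Function.comp_apply, map_sub, ← hrz,
      remainder, Finset.sum_congr rfl e]
    abel
  have hcases : ∀ k, k ≤ l + 1 → k ≤ l ∨ k = l + 1 := fun k hk => by omega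
  constructor
  · exact D.strictMono.comp hs'
  · rw [wle 0 (Nat.zero_le l), D.w_zero]
  · rw [yle 0 (Nat.zero_le l), D.y_zero]
  · intro k h1 h2
    rcases hcases k h2 with h | rfl
    · rw [wle k h]; exact D.ne_zero k h1 h
    · rw [wlast]; exact hw'
  · intro k h1 h2
    rcases hcases k h2 with h | rfl
    · rw [wle k h]; exact D.prop k h1 h
    · rw [wlast]; exact hPw'
  · intro k h1 h2
    rcases hcases k h2 with h | rfl
    · rw [yle k h]; exact (D.escape k h1 h).comp hs'.tendsto_atTop
    · rw [ylast]; exact hy'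
  · intro k h2
    rcases hcases k h2 with h | rfl
    · have h1 : Tendsto (fun n => ‖y' n - y k (s' n)‖) atTop atTop := by
        simpa only [norm_sub_rev] using hdiv k h
      have h3 := ((D.weak k h).comp hs').sub (weaklyTendsto_translateL h1 w')
      rw [sub_zero] at h3
      convert h3 using 2 with n
      rw [hrem, yle k h, map_sub, map_sub, ← hrz, translateL_translateL, sub_eq_add_neg (y' n)]
    · convert hz.sub_self using 2 with n
      rw [hrem, ylast, translateL_neg_translateL]
  · intro Φ hΦ
    have e : ∀ k ∈ Finset.range (l + 1), Φ (w'' k) = Φ (w k) := fun k hk => by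
      rw [wle k (Nat.lt_succ_iff.1 (Finset.mem_range.1 hk))]
    rw [Finset.sum_range_succ, wlast, Finset.sum_congr rfl e]
    refine (((D.split Φ hΦ).comp hs'.tendsto_atTop).add (hΦ.tendsto z w' hz)).congr fun n => ?_
    have e1 : Φ (remainder u s y w l (s' n)) = Φ (z n) := by rw [hrz, hΦ.translateL_eq]
    simp only [Function.comp_apply]
    rw [hrem, hΦ.translateL_eq, e1]
    ring

/-- A decomposition whose remainder does not vanish in `L^q` can be extended by one profile. -/
theorem ProfileDecomp.extend {P : H1 → Prop} {u : ℕ → H1} {u₀ : H1} {s : ℕ → ℕ}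
    {y : ℕ → ℕ → R3} {w : ℕ → H1} {l : ℕ} (D : ProfileDecomp P u u₀ s y w l)
    (hP : ∀ (s : ℕ → ℕ) (y : ℕ → R3) (w : H1), StrictMono s →
      Tendsto (fun n => ‖y n‖) atTop atTop →
      WeaklyTendsto (fun n => translateL (-(y n)) (u (s n))) w → P w)
    {q : ℝ} (hq : 2 < q) (hq6 : q < 6)
    (hnot : ¬ Tendsto (fun n => powInt q (remainder u s y w l n)) atTop (𝓝 0)) :
    ∃ s y w, ProfileDecomp P u u₀ s y w (l + 1) := by
  obtain ⟨M, hM⟩ := D.remainder_weak.bounded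
  obtain ⟨s', y', w', hs', hw', hz'⟩ := exists_translated_weak_limit hM hq hq6 hnot
  obtain ⟨z, hzdef⟩ : ∃ z : ℕ → H1,
      ∀ n, z n = translateL (-(y' n)) (remainder u s y w l (s' n)) := ⟨_, fun _ => rfl⟩
  have hz : WeaklyTendsto z w' := by
    rw [show z = _ from funext hzdef]; exact hz'
  have hrz : ∀ n, remainder u s y w l (s' n) = translateL (y' n) (z n) := fun n => by
    rw [hzdef, translateL_translateL_neg]
  -- The remainder is weakly null in the frame of each old centre but has the nonzero limit `w'` in
  -- the new frame, so the centres separate. The case `k = 0` says that the new centre escapes.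
  have hdiv : ∀ k, k ≤ l → Tendsto (fun n => ‖y k (s' n) - y' n‖) atTop atTop := by
    intro k hk
    refine tendsto_norm_of_translateL_weaklyTendsto ((D.weak k hk).comp hs') hw' ?_
    convert hz using 2 with n
    rw [translateL_translateL, hzdef]
    congr 2
    abel
  have hy' : Tendsto (fun n => ‖y' n‖) atTop atTop := by
    simpa [D.y_zero] using hdiv 0 (Nat.zero_le l)
  have hsol : P w' := by
    refine hP (s ∘ s') y' w' (D.strictMono.comp hs') hy' ?_
    -- In the new frame the old profiles vanish weakly, so `w'` is a weak limit of translates of `u`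
    -- itself, to which `hP` applies.
    have h1 := hz.add (WeaklyTendsto.finset_sum (Finset.range (l + 1)) fun k hk =>
      weaklyTendsto_translateL (hdiv k (Nat.lt_succ_iff.1 (Finset.mem_range.1 hk))) (w k))
    rw [Finset.sum_const_zero, add_zero] at h1
    convert h1 using 2 with n
    have e : u (s (s' n)) = remainder u s y w l (s' n)
        + ∑ k ∈ Finset.range (l + 1), translateL (y k (s' n)) (w k) := by
      rw [remainder, sub_add_cancel]
    rw [Function.comp_apply, e, hzdef, map_add, map_sum]
    simp only [translateL_translateL, sub_eq_add_neg]
  exact ⟨_, fun k => if k ≤ l then fun n => y k (s' n) else y', fun k => if k ≤ l then w k else w',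
    D.snoc hs' hw' hsol hz hrz hdiv hy' (fun k hk => if_pos hk) (fun k hk => if_pos hk)
      (if_neg (by omega)) (if_neg (by omega))⟩

/-- If nonzero profiles with property `P` are bounded away from zero, then a bounded sequence has
a profile decomposition whose remainder vanishes in `L^q`. -/
theorem exists_profileDecomp {P : H1 → Prop} {u : ℕ → H1} {u₀ : H1} (h : WeaklyTendsto u u₀)
    (hP : ∀ (s : ℕ → ℕ) (y : ℕ → R3) (w : H1), StrictMono s →
      Tendsto (fun n => ‖y n‖) atTop atTop →
      WeaklyTendsto (fun n => translateL (-(y n)) (u (s n))) w → P w)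
    {ρ : ℝ} (hρ : 0 < ρ) (hPρ : ∀ w, P w → w ≠ 0 → ρ ≤ ‖w‖ ^ 2)
    {q : ℝ} (hq : 2 < q) (hq6 : q < 6) :
    ∃ s y w l, ProfileDecomp P u u₀ s y w l ∧
      Tendsto (fun n => powInt q (remainder u s y w l n)) atTop (𝓝 0) := by
  by_contra hcon
  push Not at hcon
  have hall : ∀ l, ∃ s y w, ProfileDecomp P u u₀ s y w l := by
    intro l
    induction l with
    | zero => exact ⟨_, _, _, profileDecomp_zero P h⟩
    | succ l ih =>
      obtain ⟨s, y, w, D⟩ := ih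
      exact D.extend hP hq hq6 (hcon s y w l D)
  obtain ⟨M, hM⟩ := h.bounded
  -- If extraction never stopped, decompositions of every length would exist. Splitting of the
  -- squared norm bounds the total of the profiles by `M²`, which excludes `l` profiles of size at
  -- least `ρ`.
  obtain ⟨l, hl⟩ := exists_nat_gt (M ^ 2 / ρ)
  obtain ⟨s, y, w, D⟩ := hall l
  have h1 : ∑ k ∈ Finset.range (l + 1), ‖w k‖ ^ 2 ≤ M ^ 2 := by
    refine le_of_tendsto (D.split _ isSplitting_norm_sq) (.of_forall fun n => ?_)
    have : ‖u (s n)‖ ^ 2 ≤ M ^ 2 := by gcongr; exact hM _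
    have := sq_nonneg ‖remainder u s y w l n‖
    linarith
  rw [Finset.sum_range_succ'] at h1
  have h2 : ∑ k ∈ Finset.range l, ρ ≤ ∑ k ∈ Finset.range l, ‖w (k + 1)‖ ^ 2 :=
    Finset.sum_le_sum fun k hk => by
      have hk := Finset.mem_range.1 hk
      exact hPρ _ (D.prop (k + 1) (by omega) (by omega)) (D.ne_zero (k + 1) (by omega) (by omega))
  rw [Finset.sum_const, Finset.card_range, nsmul_eq_mul] at h2
  rw [div_lt_iff₀ hρ] at hl
  have := sq_nonneg ‖w 0‖
  linarith

/-! ### Limits of Palais-Smale sequences -/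

section PalaisSmale

variable {V : R3 → ℝ} {Vinf p : ℝ}

theorem tendsto_apply_of_norm_tendsto_zero {X : Type*} [NormedAddCommGroup X] [NormedSpace ℝ X]
    {D : ℕ → X →L[ℝ] ℝ} (hD : Tendsto (fun n => ‖D n‖) atTop (𝓝 0)) {ψ : ℕ → X} {M : ℝ}
    (hψ : ∀ n, ‖ψ n‖ ≤ M) : Tendsto (fun n => D n (ψ n)) atTop (𝓝 0) := by
  have h : Tendsto (fun n => ‖D n‖ * M) atTop (𝓝 0) := by simpa using hD.mul_const M
  refine squeeze_zero_norm (fun n => ?_) h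
  exact (D n).le_of_opNorm_le_of_le le_rfl (hψ n)

theorem tendsto_inner_zero_left {X : Type*} [NormedAddCommGroup X] [InnerProductSpace ℝ X]
    {x z : ℕ → X} (hx : Tendsto x atTop (𝓝 0)) {M : ℝ} (hz : ∀ n, ‖z n‖ ≤ M) :
    Tendsto (fun n => inner ℝ (x n) (z n)) atTop (𝓝 0) := by
  have h : Tendsto (fun n => ‖x n‖ * M) atTop (𝓝 0) := by
    simpa using hx.norm.mul_const M
  refine squeeze_zero_norm (fun n => (norm_inner_le_norm _ _).trans ?_) h
  gcongr
  exact hz n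

theorem tendsto_inner_zero_right {X : Type*} [NormedAddCommGroup X] [InnerProductSpace ℝ X]
    {x z : ℕ → X} (hx : Tendsto x atTop (𝓝 0)) {M : ℝ} (hz : ∀ n, ‖z n‖ ≤ M) :
    Tendsto (fun n => inner ℝ (z n) (x n)) atTop (𝓝 0) :=
  (tendsto_inner_zero_left hx hz).congr fun _ => real_inner_comm _ _

theorem inner_gradL_translateL_right (y : R3) (v w : H1) :
    inner ℝ (gradL v) (gradL (translateL y w)) = inner ℝ (gradL (translateL (-y) v)) (gradL w) := by
  rw [real_inner_comm, inner_gradL_translateL_left, real_inner_comm]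

theorem inner_toL2_translateL_right (y : R3) (v w : H1) :
    inner ℝ (toL2 v) (toL2 (translateL y w)) = inner ℝ (toL2 (translateL (-y) v)) (toL2 w) := by
  rw [real_inner_comm, inner_toL2_translateL_left, real_inner_comm]

theorem powerL_translateL_right (hp : 2 < p) (hp5 : p < 5) (y : R3) (v w : H1) :
    powerL hp hp5 v (translateL y w) = powerL hp hp5 (translateL (-y) v) w := by
  have h := powerL_translateL hp hp5 y (translateL (-y) v) w
  rwa [translateL_translateL_neg] at h

variable (hV2 : CondV2 V Vinf) (hV3 : CondV3 V) (hp : 2 < p) (hp5 : p < 5)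

theorem norm_frozenDeriv_le (lam κ κ' : ℝ) (u : H1) :
    ‖frozenDeriv hV2 hV3 hp hp5 lam κ u‖
      ≤ ‖frozenDeriv hV2 hV3 hp hp5 lam κ' u‖ + |κ - κ'| * ‖u‖ := by
  refine ContinuousLinearMap.opNorm_le_bound _ (by positivity) fun ψ => ?_
  have e : frozenDeriv hV2 hV3 hp hp5 lam κ u ψ = frozenDeriv hV2 hV3 hp hp5 lam κ' u ψ
      + (κ - κ') * inner ℝ (gradL u) (gradL ψ) := by
    rw [frozenDeriv_apply, frozenDeriv_apply]; ring
  rw [e, add_mul]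
  refine (norm_add_le _ _).trans (add_le_add (ContinuousLinearMap.le_opNorm _ _) ?_)
  rw [norm_mul, Real.norm_eq_abs, mul_assoc]
  gcongr
  exact (norm_inner_le_norm _ _).trans (by gcongr <;> exact norm_gradL_le _)

/-- This replaces the varying coefficient `a + b∫|Du_n|²` by its limit: on bounded sequences the
error in the dual norm is proportional to the difference of coefficients. -/
theorem tendsto_norm_frozenDeriv {lam κ M : ℝ} {κs : ℕ → ℝ} {u : ℕ → H1}
    (hκ : Tendsto κs atTop (𝓝 κ)) (hM : ∀ n, ‖u n‖ ≤ M)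
    (hD : Tendsto (fun n => ‖frozenDeriv hV2 hV3 hp hp5 lam (κs n) (u n)‖) atTop (𝓝 0)) :
    Tendsto (fun n => ‖frozenDeriv hV2 hV3 hp hp5 lam κ (u n)‖) atTop (𝓝 0) := by
  have h : Tendsto (fun n => |κ - κs n| * M) atTop (𝓝 0) := by
    simpa using ((hκ.const_sub κ).abs).mul_const M
  refine squeeze_zero (fun n => ContinuousLinearMap.opNorm_nonneg _) (fun n => ?_)
    (by simpa using hD.add h)
  refine (norm_frozenDeriv_le hV2 hV3 hp hp5 lam κ (κs n) (u n)).trans ?_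
  gcongr
  exact hM n

theorem frozenDeriv_eq_zero_of_weaklyTendsto {lam κ : ℝ} {u : ℕ → H1} {u₀ : H1}
    (hu : WeaklyTendsto u u₀)
    (hD : Tendsto (fun n => ‖frozenDeriv hV2 hV3 hp hp5 lam κ (u n)‖) atTop (𝓝 0)) :
    frozenDeriv hV2 hV3 hp hp5 lam κ u₀ = 0 := by
  ext ψ
  have h0 := tendsto_apply_of_norm_tendsto_zero hD (ψ := fun _ => ψ) fun _ => le_rfl
  refine tendsto_nhds_unique ?_ h0
  simp only [frozenDeriv_apply]
  exact ((((hu.inner_gradL ψ).const_mul κ).add ((hu.inner_toL2 ψ).const_mul Vinf)).sub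
    (weaklyTendsto_iff.1 (hu.map (weightL hV2 hV3)) _)).sub ((hu.powerL hp hp5 ψ).const_mul lam)

/-- The almost-equation is tested with `ψ(· - y_n)`. The invariant terms shift onto `u`, and the
only term seeing the origin, the weight `V_∞ - V`, disappears. -/
theorem isWeakSolution_of_translated_limit {lam κ M : ℝ} {u : ℕ → H1} (hM : ∀ n, ‖u n‖ ≤ M)
    (hD : Tendsto (fun n => ‖frozenDeriv hV2 hV3 hp hp5 lam κ (u n)‖) atTop (𝓝 0))
    {y : ℕ → R3} (hy : Tendsto (fun n => ‖y n‖) atTop atTop) {w : H1}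
    (hw : WeaklyTendsto (fun n => translateL (-(y n)) (u n)) w) :
    IsWeakSolution κ Vinf p lam w := by
  intro ψ
  have h0 := tendsto_apply_of_norm_tendsto_zero hD (ψ := fun n => translateL (y n) ψ) (M := ‖ψ‖)
    fun n => by rw [LinearIsometry.norm_map]
  have hT : Tendsto (fun n => inner ℝ (weightL hV2 hV3 (u n))
      (weightL hV2 hV3 (translateL (y n) ψ))) atTop (𝓝 0) :=
    tendsto_inner_zero_right (x := fun n => weightL hV2 hV3 (translateL (y n) ψ))
      (z := fun n => weightL hV2 hV3 (u n)) (tendsto_weightL_translateL hV2 hV3 hy ψ)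
      (M := ‖weightL hV2 hV3‖ * M) fun n => (weightL hV2 hV3).le_opNorm_of_le (hM n)
  have h1 := ((((hw.inner_gradL ψ).const_mul κ).add ((hw.inner_toL2 ψ).const_mul Vinf)).sub
    hT).sub ((hw.powerL hp hp5 ψ).const_mul lam)
  have e : ∀ n, frozenDeriv hV2 hV3 hp hp5 lam κ (u n) (translateL (y n) ψ)
      = κ * inner ℝ (gradL (translateL (-(y n)) (u n))) (gradL ψ)
        + Vinf * inner ℝ (toL2 (translateL (-(y n)) (u n))) (toL2 ψ)
        - inner ℝ (weightL hV2 hV3 (u n)) (weightL hV2 hV3 (translateL (y n) ψ))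
        - lam * powerL hp hp5 (translateL (-(y n)) (u n)) ψ := by
    intro n
    have e1 := inner_gradL_translateL_right (y n) (u n) ψ
    have e2 := inner_toL2_translateL_right (y n) (u n) ψ
    have e3 := powerL_translateL_right hp hp5 (y n) (u n) ψ
    rw [frozenDeriv_apply]
    linear_combination κ * e1 + Vinf * e2 - lam * e3
  have h2 := tendsto_nhds_unique (h1.congr fun n => (e n).symm) h0
  rw [integral_inner_grad, integral_fn_mul, ← powerL_apply hp hp5]
  linarith

theorem IsWeakSolution.self_eq {κ m lam : ℝ} {w : H1} (hp : 2 < p) (hp5 : p < 5)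
    (h : IsWeakSolution κ m p lam w) :
    κ * gradSq w + m * ‖toL2 w‖ ^ 2 = lam * powInt (p + 1) w := by
  have := h w
  rwa [integral_inner_grad, integral_fn_mul, ← powerL_apply hp hp5, powerL_self,
    real_inner_self_eq_norm_sq, real_inner_self_eq_norm_sq, ← gradSq_eq] at this

/-- Nontrivial weak solutions are bounded away from zero. -/
theorem exists_norm_sq_ge_of_isWeakSolution {κ m lam : ℝ} (hp : 2 < p) (hp5 : p < 5)
    (hκ : 0 < κ) (hm : 0 < m) (hlam : 0 < lam) :
    ∃ ρ : ℝ, 0 < ρ ∧ ∀ w : H1, IsWeakSolution κ m p lam w → w ≠ 0 → ρ ≤ ‖w‖ ^ 2 := by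
  obtain ⟨C, hC, hCw⟩ := exists_powInt_le (q := p + 1) (by linarith) (by linarith)
  have hmin : 0 < min κ m := lt_min hκ hm
  -- Testing with `w` itself gives `min(κ,m)‖w‖² ≤ λC‖w‖^{p+1}`, that is `‖w‖^{p-1} ≥ θ`.
  set θ := min κ m / (lam * C) with hθ
  have hθ0 : 0 < θ := by positivity
  refine ⟨(θ ^ (p - 1)⁻¹) ^ 2, by positivity, fun w hw hw0 => ?_⟩
  have hn : 0 < ‖w‖ := norm_pos_iff.2 hw0
  have h1 : min κ m * ‖w‖ ^ 2 ≤ lam * (C * ‖w‖ ^ (p + 1)) := by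
    have h2 := hw.self_eq hp hp5
    rw [gradSq_eq] at h2
    have h3 : min κ m * ‖gradL w‖ ^ 2 ≤ κ * ‖gradL w‖ ^ 2 := by gcongr; exact min_le_left _ _
    have h4 : min κ m * ‖toL2 w‖ ^ 2 ≤ m * ‖toL2 w‖ ^ 2 := by gcongr; exact min_le_right _ _
    have h5 : lam * powInt (p + 1) w ≤ lam * (C * ‖w‖ ^ (p + 1)) := by gcongr; exact hCw w
    rw [norm_sq_eq_toL2_add_gradL]
    linarith
  have h6 : ‖w‖ ^ (p + 1) = ‖w‖ ^ (p - 1) * ‖w‖ ^ 2 := by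
    rw [← Real.rpow_two, ← Real.rpow_add hn]; congr 1; ring
  have h7 : θ ≤ ‖w‖ ^ (p - 1) := by
    rw [hθ, div_le_iff₀ (by positivity)]
    rw [h6] at h1
    refine le_of_mul_le_mul_right ?_ (pow_pos hn 2)
    linarith
  have h8 : θ ^ (p - 1)⁻¹ ≤ ‖w‖ :=
    (Real.rpow_inv_le_iff_of_pos hθ0.le hn.le (by linarith)).2 h7
  gcongr

/-- The Sobolev inequality kills the `L⁶` part; the `L²` part, merely bounded, is made small by a
small threshold `θ`, since `q > 2`. -/
theorem tendsto_powInt_of_gradSq {u : ℕ → H1} {M : ℝ} (hM : ∀ n, ‖u n‖ ≤ M)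
    (hG : Tendsto (fun n => gradSq (u n)) atTop (𝓝 0)) {q : ℝ} (hq : 2 < q) (hq6 : q ≤ 6) :
    Tendsto (fun n => powInt q (u n)) atTop (𝓝 0) := by
  obtain ⟨K, hK, h6⟩ := exists_powInt_six_le
  rw [Metric.tendsto_atTop']
  refine fun ε hε => ?_
  set θ := (ε / 2 / (M ^ 2 + 1)) ^ (q - 2)⁻¹ with hθ
  have hθ0 : 0 < θ := by positivity
  have hθq : θ ^ (q - 2) = ε / 2 / (M ^ 2 + 1) :=
    Real.rpow_inv_rpow (by positivity) (by linarith)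
  have h1 : Tendsto (fun n => θ ^ (q - 6) * (K * gradSq (u n) ^ 3)) atTop (𝓝 0) := by
    simpa using ((hG.pow 3).const_mul K).const_mul (θ ^ (q - 6))
  obtain ⟨N, hN⟩ := eventually_atTop.1 (h1.eventually_lt_const (half_pos hε))
  refine ⟨N, fun n hn => ?_⟩
  rw [Real.dist_eq, sub_zero, abs_of_nonneg (powInt_nonneg _ _)]
  have h2 := powInt_le_interpolation hq.le hq6 hθ0 (u n)
  have h3 : θ ^ (q - 2) * powInt 2 (u n) ≤ ε / 2 := by
    rw [hθq, div_mul_eq_mul_div, div_le_iff₀ (by positivity)]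
    have : powInt 2 (u n) ≤ M ^ 2 + 1 := by
      rw [powInt_two]
      have h4 : ‖toL2 (u n)‖ ^ 2 ≤ M ^ 2 := by
        gcongr
        exact (norm_toL2_le _).trans (hM n)
      linarith
    gcongr
  have h5 : θ ^ (q - 6) * powInt 6 (u n) ≤ θ ^ (q - 6) * (K * gradSq (u n) ^ 3) := by
    gcongr
    refine (h6 (u n)).2.trans (le_of_eq ?_)
    rw [gradSq_eq]; ring
  have := hN n hn.le
  linarith

/-! ### The energy level and nonvanishing of the limiting Dirichlet integral. -/

theorem tendsto_frozenDeriv_self {lam κ M : ℝ} {u : ℕ → H1} (hM : ∀ n, ‖u n‖ ≤ M)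
    (hD : Tendsto (fun n => ‖frozenDeriv hV2 hV3 hp hp5 lam κ (u n)‖) atTop (𝓝 0)) :
    Tendsto (fun n => κ * gradSq (u n) + potSq V (u n) - lam * powInt (p + 1) (u n)) atTop
      (𝓝 0) :=
  (tendsto_apply_of_norm_tendsto_zero hD hM).congr fun n =>
    frozenDeriv_self hV2 hV3 hp hp5 lam κ (u n)

/-- The energy level in terms of the limits of `∫ |Du|²` and `∫ |u|^{p+1}`. -/
theorem energy_level_eq {a b lam A M N c : ℝ} {u : ℕ → H1} (hM : ∀ n, ‖u n‖ ≤ M)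
    (hG : Tendsto (fun n => gradSq (u n)) atTop (𝓝 (A ^ 2)))
    (hD : Tendsto (fun n => ‖frozenDeriv hV2 hV3 hp hp5 lam (a + b * A ^ 2) (u n)‖) atTop (𝓝 0))
    (hN : Tendsto (fun n => powInt (p + 1) (u n)) atTop (𝓝 N))
    (hI : Tendsto (fun n => energyI a b p lam V (u n)) atTop (𝓝 c)) :
    c + b * A ^ 4 / 4 = (1 / 2 - 1 / (p + 1)) * lam * N := by
  -- Half the tested equation removes the quadratic part of the energy. The gradient terms left over
  -- tend to `-bA⁴/2 + bA⁴/4 = -bA⁴/4`.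
  have h := ((((tendsto_frozenDeriv_self hV2 hV3 hp hp5 hM hD).const_mul (1 / 2)).sub
    (hG.const_mul (b * A ^ 2 / 2))).add ((hG.pow 2).const_mul (b / 4))).add
    (hN.const_mul ((1 / 2 - 1 / (p + 1)) * lam))
  have hc := tendsto_nhds_unique hI (h.congr fun n => by rw [energyI]; ring)
  rw [hc]
  ring

/-- If `A = 0`, the `L^{p+1}` integrals tend to zero and the level formula forces `c = 0`. -/
theorem gradSq_limit_ne_zero {a b lam A M c : ℝ} (hc : 0 < c) {u : ℕ → H1} (hM : ∀ n, ‖u n‖ ≤ M)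
    (hG : Tendsto (fun n => gradSq (u n)) atTop (𝓝 (A ^ 2)))
    (hD : Tendsto (fun n => ‖frozenDeriv hV2 hV3 hp hp5 lam (a + b * A ^ 2) (u n)‖) atTop (𝓝 0))
    (hI : Tendsto (fun n => energyI a b p lam V (u n)) atTop (𝓝 c)) : A ≠ 0 := by
  rintro rfl
  have hN := tendsto_powInt_of_gradSq hM (q := p + 1) (by simpa using hG) (by linarith)
    (by linarith)
  have := energy_level_eq hV2 hV3 hp hp5 hM hG hD hN hI
  simp at this
  exact hc.ne' this

/-! ### Strong convergence of the remainder -/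

/-- The bilinear form `κ ∫ Du·Dψ + ∫ V u ψ`. -/
def bilinForm (κ : ℝ) (u ψ : H1) : ℝ :=
  κ * inner ℝ (gradL u) (gradL ψ) + Vinf * inner ℝ (toL2 u) (toL2 ψ)
    - inner ℝ (weightL hV2 hV3 u) (weightL hV2 hV3 ψ)

theorem frozenDeriv_eq_bilinForm_sub (lam κ : ℝ) (u ψ : H1) :
    frozenDeriv hV2 hV3 hp hp5 lam κ u ψ
      = bilinForm hV2 hV3 κ u ψ - lam * powerL hp hp5 u ψ := rfl

theorem bilinForm_self (κ : ℝ) (u : H1) :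
    bilinForm hV2 hV3 κ u u = κ * gradSq u + potSq V u := by
  rw [bilinForm, real_inner_self_eq_norm_sq, real_inner_self_eq_norm_sq,
    real_inner_self_eq_norm_sq, potSq_eq hV2 hV3, gradSq_eq]
  ring

theorem bilinForm_sum_add_left (κ : ℝ) (S : Finset ℕ) (f : ℕ → H1) (v ψ : H1) :
    bilinForm hV2 hV3 κ (∑ k ∈ S, f k + v) ψ
      = ∑ k ∈ S, bilinForm hV2 hV3 κ (f k) ψ + bilinForm hV2 hV3 κ v ψ := by
  simp only [bilinForm, map_add, map_sum, inner_add_left, sum_inner, Finset.sum_sub_distrib,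
    Finset.sum_add_distrib, ← Finset.mul_sum]
  ring

/-- For the fixed profile `k = 0` this is weak convergence of the remainder; for the others the
weighted translated profile tends to zero strongly. -/
theorem ProfileDecomp.tendsto_inner_weightL {P : H1 → Prop} {u : ℕ → H1} {u₀ : H1} {s : ℕ → ℕ}
    {y : ℕ → ℕ → R3} {w : ℕ → H1} {l : ℕ} (D : ProfileDecomp P u u₀ s y w l) {k : ℕ}
    (hk : k ≤ l) : Tendsto (fun n => inner ℝ (weightL hV2 hV3 (translateL (y k n) (w k)))
      (weightL hV2 hV3 (remainder u s y w l n))) atTop (𝓝 0) := by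
  rcases Nat.eq_zero_or_pos k with rfl | hk0
  · have := weaklyTendsto_iff.1 (D.remainder_weak.map (weightL hV2 hV3)) (weightL hV2 hV3 (w 0))
    rw [map_zero, inner_zero_left] at this
    refine this.congr fun n => ?_
    rw [D.y_zero, translateL_zero]
    exact real_inner_comm _ _
  · obtain ⟨M, hM⟩ := D.remainder_weak.bounded
    exact tendsto_inner_zero_left (x := fun n => weightL hV2 hV3 (translateL (y k n) (w k)))
      (z := fun n => weightL hV2 hV3 (remainder u s y w l n))
      (tendsto_weightL_translateL hV2 hV3 (D.escape k hk0 hk) (w k))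
      (M := ‖weightL hV2 hV3‖ * M) fun n => (weightL hV2 hV3).le_opNorm_of_le (hM n)

theorem ProfileDecomp.tendsto_bilinForm {P : H1 → Prop} {u : ℕ → H1} {u₀ : H1} {s : ℕ → ℕ}
    {y : ℕ → ℕ → R3} {w : ℕ → H1} {l : ℕ} (D : ProfileDecomp P u u₀ s y w l) (κ : ℝ) {k : ℕ}
    (hk : k ≤ l) : Tendsto (fun n => bilinForm hV2 hV3 κ (translateL (y k n) (w k))
      (remainder u s y w l n)) atTop (𝓝 0) := by
  have h1 : Tendsto (fun n => inner ℝ (gradL (translateL (y k n) (w k)))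
      (gradL (remainder u s y w l n))) atTop (𝓝 0) := by
    have := (D.weak k hk).inner_gradL (w k)
    rw [map_zero, inner_zero_left] at this
    refine this.congr fun n => ?_
    exact (inner_gradL_translateL_right (y k n) (remainder u s y w l n) (w k)).symm.trans
      (real_inner_comm _ _)
  have h2 : Tendsto (fun n => inner ℝ (toL2 (translateL (y k n) (w k)))
      (toL2 (remainder u s y w l n))) atTop (𝓝 0) := by
    have := (D.weak k hk).inner_toL2 (w k)
    rw [map_zero, inner_zero_left] at this
    refine this.congr fun n => ?_
    exact (inner_toL2_translateL_right (y k n) (remainder u s y w l n) (w k)).symm.trans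
      (real_inner_comm _ _)
  have h3 := D.tendsto_inner_weightL hV2 hV3 hk
  have := ((h1.const_mul κ).add (h2.const_mul Vinf)).sub h3
  rw [mul_zero, mul_zero, add_zero, sub_zero] at this
  exact this

/-- The remainder itself is the test function. The surplus `β` over the coefficient `a`, equal to
`bA²` in the application, supplies the coercivity that the form with coefficient `a` may lack. -/
theorem ProfileDecomp.tendsto_remainder {P : H1 → Prop} {u : ℕ → H1} {u₀ : H1} {s : ℕ → ℕ}
    {y : ℕ → ℕ → R3} {w : ℕ → H1} {l : ℕ} (D : ProfileDecomp P u u₀ s y w l)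
    {a β lam M₀ : ℝ} (ha : 0 < a) (hβ : 0 < β)
    (hV : ∀ v : H1, -M₀ * powInt 2 v ≤ a * gradSq v + potSq V v)
    {M : ℝ} (hM : ∀ n, ‖u n‖ ≤ M)
    (hD : Tendsto (fun n => ‖frozenDeriv hV2 hV3 hp hp5 lam (a + β) (u n)‖) atTop (𝓝 0))
    (hr : Tendsto (fun n => powInt (p + 1) (remainder u s y w l n)) atTop (𝓝 0)) :
    Tendsto (remainder u s y w l) atTop (𝓝 0) := by
  obtain ⟨r, hrdef⟩ : ∃ r, r = remainder u s y w l := ⟨_, rfl⟩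
  have hweak := D.remainder_weak
  have hcross := fun k (hk : k ≤ l) => D.tendsto_bilinForm hV2 hV3 (a + β) hk
  have hus : ∀ n, u (s n) = ∑ k ∈ Finset.range (l + 1), translateL (y k n) (w k) + r n := fun n => by
    rw [hrdef, remainder, add_sub_cancel]
  rw [← hrdef] at hr hweak hcross ⊢
  obtain ⟨R, hR⟩ := hweak.bounded
  have h1 := tendsto_apply_of_norm_tendsto_zero (hD.comp D.strictMono.tendsto_atTop)
    (ψ := r) (D := fun n => frozenDeriv hV2 hV3 hp hp5 lam (a + β) (u (s n))) hR
  have h2 := tendsto_powerL_of_powInt hp hp5 (u := fun n => u (s n)) (fun n => hM (s n)) hr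
  have h3 : Tendsto (fun n => ∑ k ∈ Finset.range (l + 1), bilinForm hV2 hV3 (a + β)
      (translateL (y k n) (w k)) (r n)) atTop (𝓝 0) := by
    simpa using tendsto_finsetSum (Finset.range (l + 1)) fun k hk =>
      hcross k (Nat.lt_succ_iff.1 (Finset.mem_range.1 hk))
  -- Expanding `u = profiles + r` in the first slot of the bilinear form isolates the quadratic form
  -- of `r`; the power term vanishes because `r` does in `L^{p+1}`.
  have h4 : Tendsto (fun n => (a + β) * gradSq (r n) + potSq V (r n)) atTop (𝓝 0) := by
    have := (h1.add (h2.const_mul lam)).sub h3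
    rw [mul_zero, add_zero, sub_zero] at this
    refine this.congr fun n => ?_
    rw [frozenDeriv_eq_bilinForm_sub, hus n, bilinForm_sum_add_left, bilinForm_self]
    ring
  have h5 : Tendsto (fun n => gradSq (r n)) atTop (𝓝 0) := by
    rw [Metric.tendsto_atTop']
    refine fun ε hε => ?_
    -- The form with coefficient `a` exceeds `-βε/2` and that with `a + β` is below `βε/2`;
    -- subtracting leaves `β∫|Dr|² < βε`.
    have h6 := eventually_form_ge ha hV2 hV3 hV hweak (half_pos (mul_pos hβ hε))
    have h7 := h4.eventually_lt_const (half_pos (mul_pos hβ hε))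
    obtain ⟨N, hN⟩ := eventually_atTop.1 (h6.and h7)
    refine ⟨N, fun n hn => ?_⟩
    obtain ⟨h8, h9⟩ := hN n hn.le
    have h10 : 0 ≤ gradSq (r n) := by rw [gradSq_eq]; positivity
    rw [Real.dist_eq, sub_zero, abs_of_nonneg h10]
    refine lt_of_mul_lt_mul_left ?_ hβ.le
    linarith
  have h11 : Tendsto (fun n => potSq V (r n)) atTop (𝓝 0) := by
    have := h4.sub (h5.const_mul (a + β))
    rw [mul_zero, sub_zero] at this
    exact this.congr fun n => by ring
  -- With both the Dirichlet and the potential terms tending to zero, `(V₃)` yields the `L²` norm.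
  obtain ⟨C, hC, hCr⟩ := hV3.exists_le
  have h12 : Tendsto (fun n => ‖toL2 (r n)‖ ^ 2) atTop (𝓝 0) := by
    have := (h5.add h11).const_mul C⁻¹
    rw [add_zero, mul_zero] at this
    refine squeeze_zero (fun n => by positivity) (fun n => ?_) this
    rw [le_inv_mul_iff₀ hC]
    exact hCr (r n)
  have h13 : Tendsto (fun n => ‖r n‖ ^ 2) atTop (𝓝 0) := by
    have := h12.add h5
    rw [add_zero] at this
    refine this.congr fun n => ?_
    rw [norm_sq_eq_toL2_add_gradL, gradSq_eq]
  rw [tendsto_zero_iff_norm_tendsto_zero]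
  have := h13.sqrt
  rw [Real.sqrt_zero] at this
  exact this.congr fun n => Real.sqrt_sq (norm_nonneg _)

/-! ### Energies of the weak limit and of the profiles; choice of the subsequence. -/

theorem energyJ_eq_of_frozenDeriv_eq_zero {a b lam A : ℝ} {u : H1}
    (h : frozenDeriv hV2 hV3 hp hp5 lam (a + b * A ^ 2) u = 0) :
    energyJ a b p lam A V u = (1 / 2 - 1 / (p + 1)) * lam * powInt (p + 1) u := by
  have h1 := frozenDeriv_self hV2 hV3 hp hp5 lam (a + b * A ^ 2) u
  rw [h, zero_apply] at h1
  rw [energyJ]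
  linear_combination (-1 / 2) * h1

theorem IsWeakSolution.energyJ_eq {a b lam A m : ℝ} {w : H1} (hp : 2 < p) (hp5 : p < 5)
    (h : IsWeakSolution (a + b * A ^ 2) m p lam w) :
    energyJ a b p lam A (fun _ => m) w = (1 / 2 - 1 / (p + 1)) * lam * powInt (p + 1) w := by
  have h1 := h.self_eq hp hp5
  rw [energyJ, potSq_const]
  linear_combination (1 / 2) * h1

theorem IsPSSeq.tendsto_norm_frozenDeriv {a b lam c : ℝ} {u : ℕ → H1}
    (h : IsPSSeq (energyI a b p lam V) c u) :
    Tendsto (fun n => ‖frozenDeriv hV2 hV3 hp hp5 lam (a + b * gradSq (u n)) (u n)‖) atTop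
      (𝓝 0) := by
  obtain ⟨-, D, hD, hD0⟩ := h
  refine hD0.congr fun n => ?_
  rw [(hD n).unique (hasFDerivAt_energyI hV2 hV3 hp hp5 a b lam (u n))]

theorem exists_subseq_gradSq {u : ℕ → H1} {M : ℝ} (hM : ∀ n, ‖u n‖ ≤ M) :
    ∃ s : ℕ → ℕ, StrictMono s ∧ ∃ (u₀ : H1) (A : ℝ), WeaklyTendsto (u ∘ s) u₀ ∧
      Tendsto (fun n => gradSq (u (s n))) atTop (𝓝 (A ^ 2)) := by
  obtain ⟨s, hs, u₀, hu⟩ := exists_weaklyTendsto_subseq hM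
  have hb : ∀ n, gradSq (u (s n)) ∈ Set.Icc 0 (M ^ 2) := fun n => by
    refine ⟨by rw [gradSq_eq]; positivity, (gradSq_le _).trans ?_⟩
    gcongr
    exact hM _
  obtain ⟨G, hG, t, ht, htG⟩ := isCompact_Icc.tendsto_subseq hb
  refine ⟨s ∘ t, hs.comp ht, u₀, √G, hu.comp ht, ?_⟩
  rw [Real.sq_sqrt hG.1]
  exact htG

end PalaisSmale

end Kirchhoff

end

/-! ### The decomposition of Palais–Smale sequences. -/

theorem lemma3p4 (a b p δ lam c Vinf : ℝ) (V : Kirchhoff.R3 → ℝ)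
    (ha : 0 < a) (hb : 0 < b) (hp2 : 2 < p) (hp5 : p < 5)
    (hδ : δ ∈ Set.Ioo (0 : ℝ) 1) (hlam : lam ∈ Set.Icc δ 1) (hc : 0 < c)
    (hV2 : Kirchhoff.CondV2 V Vinf) (hV3 : Kirchhoff.CondV3 V)
    (hVsb : ∃ M : ℝ, ∀ v : Kirchhoff.H1,
      -M * Kirchhoff.powInt 2 v ≤ a * Kirchhoff.gradSq v + Kirchhoff.potSq V v)
    (u : ℕ → Kirchhoff.H1) (hbdd : ∃ R : ℝ, ∀ n, ‖u n‖ ≤ R)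
    (hPS : Kirchhoff.IsPSSeq (Kirchhoff.energyI a b p lam V) c u) :
    ∃ s : ℕ → ℕ, StrictMono s ∧ ∃ (u₀ : Kirchhoff.H1) (A : ℝ),
      Kirchhoff.WeaklyTendsto (fun n => u (s n)) u₀ ∧
      Tendsto (fun n => Kirchhoff.gradSq (u (s n))) atTop (𝓝 (A ^ 2)) ∧
      HasFDerivAt (Kirchhoff.energyJ a b p lam A V) (0 : Kirchhoff.H1 →L[ℝ] ℝ) u₀ ∧
      (Tendsto (fun n => u (s n)) atTop (𝓝 u₀) ∨
        ∃ (l : ℕ) (y : Fin l → ℕ → Kirchhoff.R3) (w : Fin l → Kirchhoff.H1),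
          1 ≤ l ∧
          (∀ k, Tendsto (fun n => ‖y k n‖) atTop atTop) ∧
          (∀ k, w k ≠ 0 ∧ Kirchhoff.IsWeakSolution (a + b * A ^ 2) Vinf p lam (w k)) ∧
          c + b * A ^ 4 / 4 = Kirchhoff.energyJ a b p lam A V u₀
            + ∑ k, Kirchhoff.energyJ a b p lam A (fun _ => Vinf) (w k) ∧
          Tendsto (fun n => ‖u (s n) - u₀ - ∑ k, (w k).translate (y k n)‖) atTop (𝓝 0) ∧
          A ^ 2 = Kirchhoff.gradSq u₀ + ∑ k, Kirchhoff.gradSq (w k)) := by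
  open Kirchhoff in
  obtain ⟨R, hR⟩ := hbdd
  obtain ⟨M, hVM⟩ := hVsb
  have hlam0 : 0 < lam := hδ.1.trans_le hlam.1
  obtain ⟨s, hs, u₀, A, hu, hG⟩ := exists_subseq_gradSq hR
  have hI : Tendsto (fun n => energyI a b p lam V (u (s n))) atTop (𝓝 c) :=
    hPS.1.comp hs.tendsto_atTop
  have hRs : ∀ n, ‖(u ∘ s) n‖ ≤ R := fun n => hR (s n)
  have hD : Tendsto (fun n => ‖frozenDeriv hV2 hV3 hp2 hp5 lam (a + b * A ^ 2) ((u ∘ s) n)‖)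
      atTop (𝓝 0) :=
    tendsto_norm_frozenDeriv hV2 hV3 hp2 hp5 ((hG.const_mul b).const_add a) hRs
      ((hPS.tendsto_norm_frozenDeriv hV2 hV3 hp2 hp5).comp hs.tendsto_atTop)
  have hA : A ≠ 0 := gradSq_limit_ne_zero hV2 hV3 hp2 hp5 hc hRs hG hD hI
  -- This is the surplus coefficient that makes the remainder converge strongly; its positivity
  -- rests on `A ≠ 0`.
  have hbA : 0 < b * A ^ 2 := by positivity
  have hκ : 0 < a + b * A ^ 2 := by positivity
  obtain ⟨ρ, hρ, hρw⟩ := exists_norm_sq_ge_of_isWeakSolution hp2 hp5 hκ (Vinf_pos hV2 hV3) hlam0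
  obtain ⟨t, y, w, l, D, hr⟩ := exists_profileDecomp hu
    (P := IsWeakSolution (a + b * A ^ 2) Vinf p lam)
    (fun σ y w hσ hy hw => isWeakSolution_of_translated_limit hV2 hV3 hp2 hp5
      (fun n => hRs (σ n)) (hD.comp hσ.tendsto_atTop) hy hw)
    hρ hρw (q := p + 1) (by linarith) (by linarith)
  have hrem := D.tendsto_remainder hV2 hV3 hp2 hp5 ha hbA hVM hRs hD hr
  have ht := D.strictMono
  have hu₀ := frozenDeriv_eq_zero_of_weaklyTendsto hV2 hV3 hp2 hp5 hu hD
  refine ⟨s ∘ t, hs.comp ht, u₀, A, hu.comp ht, hG.comp ht.tendsto_atTop, ?_, ?_⟩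
  · rw [← hu₀]
    exact hasFDerivAt_energyJ hV2 hV3 hp2 hp5 a b lam A u₀
  -- Index 0 of the decomposition is the weak limit with zero translation, so the escaping profiles
  -- are those with index `k + 1`.
  have hsum : ∀ n, remainder (u ∘ s) t y w l n = u (s (t n)) - u₀
      - ∑ k : Fin l, (w (k + 1)).translate (y (k + 1) n) := by
    intro n
    rw [remainder, Finset.sum_range_succ', D.w_zero, D.y_zero, translateL_zero,
      Finset.sum_range fun k => translateL (y (k + 1) n) (w (k + 1))]
    simp only [translateL_apply, Function.comp_apply]
    abel
  rcases Nat.eq_zero_or_pos l with rfl | hl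
  · left
    rw [← tendsto_sub_nhds_zero_iff]
    refine hrem.congr fun n => ?_
    rw [hsum]
    simp
  right
  -- The splitting functional of the remainder tends to zero, so the limit for `u` is exactly the
  -- sum over the profiles.
  have hN : Tendsto (fun n => powInt (p + 1) (u (s (t n)))) atTop
      (𝓝 (∑ k ∈ Finset.range (l + 1), powInt (p + 1) (w k))) := by
    have := (D.split _ (isSplitting_powInt hp2 hp5)).add hr
    rw [add_zero] at this
    exact this.congr fun n => by simp
  have hgr : Tendsto (fun n => gradSq (remainder (u ∘ s) t y w l n)) atTop (𝓝 0) := by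
    have := hrem.norm.pow 2
    rw [norm_zero, zero_pow two_ne_zero] at this
    exact squeeze_zero (fun n => by rw [gradSq_eq]; positivity) (fun n => gradSq_le _) this
  have hG' : Tendsto (fun n => gradSq (u (s (t n)))) atTop
      (𝓝 (∑ k ∈ Finset.range (l + 1), gradSq (w k))) := by
    have := (D.split _ isSplitting_gradSq).add hgr
    rw [add_zero] at this
    exact this.congr fun n => by simp
  have hsol : ∀ k : Fin l, IsWeakSolution (a + b * A ^ 2) Vinf p lam (w (k + 1)) := fun k =>
    D.prop (k + 1) (by omega) (by omega)
  refine ⟨l, fun k => y (k + 1), fun k => w (k + 1), hl, fun k => ?_, fun k => ⟨?_, hsol k⟩,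
    ?_, ?_, ?_⟩
  · exact D.escape (k + 1) (by omega) (by omega)
  · exact D.ne_zero (k + 1) (by omega) (by omega)
  -- Both sides become `(1/2 - 1/(p+1))λ` times the same sum of `L^{p+1}` integrals.
  · rw [energy_level_eq hV2 hV3 hp2 hp5 (fun n => hRs (t n)) (hG.comp ht.tendsto_atTop)
      (hD.comp ht.tendsto_atTop) hN (hI.comp ht.tendsto_atTop),
      energyJ_eq_of_frozenDeriv_eq_zero hV2 hV3 hp2 hp5 hu₀, Finset.sum_range_succ', D.w_zero,
      Finset.sum_range fun k => powInt (p + 1) (w (k + 1)),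
      Finset.sum_congr rfl fun k _ => (hsol k).energyJ_eq hp2 hp5, ← Finset.mul_sum]
    ring
  · have := hrem.norm
    rw [norm_zero] at this
    exact this.congr fun n => by rw [hsum]; rfl
  · rw [tendsto_nhds_unique (hG.comp ht.tendsto_atTop) hG', Finset.sum_range_succ', D.w_zero,
      Finset.sum_range fun k => gradSq (w (k + 1)), add_comm]
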